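/- Let $F$ be a finite field, $n\ge 0$, $V=F^n$ the space of row vectors, and $X\in \mathrm{GL}(n,F)$ acting on $V$ by $v\mapsto vX$. Write $X\sim Y$ if $X,Y$ are conjugate in $\mathrm{GL}(n,F)$. Decompose the $F[t]$-module $V$ (on which $t$ acts as $X$) as a direct sum of cyclic modules $F[t]/(f_i^{e_i})$ with $f_i$ monic irreducible and $e_i\ge1$; the polynomials $f_i^{e_i}$, listed with repetitions, are the elementary divisors of $X$, and $m(f^e)$ denotes the multiplicity of $f^e$ in this list ($0$ if it does not occur). A sesquilinear form $\beta$ (resp. quadratic form $Q$) on $V$ is preserved by $X$ if $\beta(uX,vX)=\beta(u,v)$ for all $u,v$ (resp. $Q(vX)=Q(v)$ for all $v$). A quadratic form $Q$ is non-singular if the bilinear form $Q(u+v)-Q(u)-Q(v)$ is non-degenerate. If $n=2k$, a non-singular $Q$ has plus type (resp. minus type) if the maximal dimension of a subspace on which $Q$ vanishes identically is $k$ (resp. $k-1$). For monic $f$ of degree $d$ with $f(0)\ne0$ put $f^*(t)=f(0)^{-1}t^df(t^{-1})$, let $\Phi_3$ be the set of monic irreducible $f\in F[t]$ with $f=f^*$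 and $\deg f>1$, and let $S(X)=\sum_{f\in\Phi_3,\ e\ge1} e\,m(f^e)$. 1. Suppose $|F|=q^2$. For a matrix $A$ let $A^*$ be the transpose of the matrix obtained by raising every entry to the $q$-th power. There exists a non-degenerate hermitian form on $V$ (linear in the first variable, with $\beta(u,v)=\beta(v,u)^q$) preserved by $X$ if and only if $X\sim (X^{*})^{-1}$. 2. There exists a non-degenerate alternating bilinear form on $V$ preserved by $X$ if and only if $X\sim X^{-1}$ and, for each $k\ge0$, both $m((t-1)^{2k+1})$ and $m((t+1)^{2k+1})$ are even. 3. Suppose $|F|$ is odd. There exists a non-singular quadratic form on $V$ preserved by $X$ if and only if $X\sim X^{-1}$ and, for each $k\ge1$, both $m((t-1)^{2k})$ and $m((t+1)^{2k})$ are even. Moreover, suppose that $n$ is even and that $X$ preserves some non-singular quadratic form. Then $X$ preserves both a non-singular quadratic form of plus type and one of minus type if and only if $X$ has at least one elementary divisor of the form $(t-1)^{2k+1}$ or $(t+1)^{2k+1}$ with $k\ge0$. If $X$ has no such elementary divisor, then, for every non-singular quadratic form $Q$ preserved by $X$: $Q$ has plus type if and only if $S(X)$ is even, and $Q$ has minus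 type if and only if $S(X)$ is odd. 4. Suppose $|F|$ is even. There exists a non-singular quadratic form on $V$ preserved by $X$ if and only if $X\sim X^{-1}$ and, for each $k\ge0$, $m((t+1)^{2k+1})$ is even. Moreover, suppose that $X$ preserves some non-singular quadratic form. Then $X$ preserves both a non-singular quadratic form of plus type and one of minus type if and only if $X$ has at least one elementary divisor $(t+1)^{k}$ with $k\ge1$. If $X$ has no such elementary divisor, then, for every non-singular quadratic form $Q$ preserved by $X$: $Q$ has plus type if and only if $S(X)$ is even, and $Q$ has minus type if and only if $S(X)$ is odd. -/

import Mathlib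

open Polynomial

namespace FormIsometry

/-! ### Elementary divisors -/

section ElementaryDivisors

variable {F V : Type*} [Field F] [AddCommGroup V] [Module F V]

/-- `s` is a list of elementary divisors of the endomorphism `φ` of `V`: regarding `V` as an
`F[t]`-module on which `t` acts as `φ`, it is a direct sum of cyclic modules `F[t] / (f i ^ e i)`
with `f i` monic irreducible and `e i ≥ 1`, and `s` is the multiset of the `f i ^ e i`. -/
def IsElementaryDivisors (φ : V →ₗ[F] V) (s : Multiset F[X]) : Prop :=
  ∃ (r : ℕ) (f : Fin r → F[X]) (e : Fin r → ℕ),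
    (∀ i, (f i).Monic ∧ Irreducible (f i) ∧ 0 < e i) ∧
    s = Finset.univ.val.map (fun i => f i ^ e i) ∧
    Nonempty (Module.AEval' φ ≃ₗ[F[X]] ((i : Fin r) → F[X] ⧸ Ideal.span {f i ^ e i}))

/-- Trivial factors can be dropped from a product of modules. -/
theorem nonempty_equiv_pi_subtype {R ι : Type*} [Ring R] {M : ι → Type*}
    [∀ i, AddCommGroup (M i)] [∀ i, Module R (M i)] (P : ι → Prop)
    (h : ∀ i, ¬ P i → Subsingleton (M i)) :
    Nonempty (((i : ι) → M i) ≃ₗ[R] ((i : {i // P i}) → M i)) := by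
  classical
  refine ⟨LinearEquiv.ofBijective
    (LinearMap.pi fun i : {i // P i} => LinearMap.proj (i : ι)) ⟨?_, ?_⟩⟩
  · intro a b hab
    funext i
    by_cases hi : P i
    · exact congrFun hab ⟨i, hi⟩
    · have := h i hi
      exact Subsingleton.elim _ _
  · intro a
    refine ⟨fun i => if hi : P i then a ⟨i, hi⟩ else 0, ?_⟩
    funext i
    simp [i.2]

/-- Every endomorphism of a finite-dimensional space has a list of elementary divisors. -/
theorem exists_isElementaryDivisors [FiniteDimensional F V] (φ : V →ₗ[F] V) :
    ∃ s : Multiset F[X], IsElementaryDivisors φ s := by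
  classical
  obtain ⟨ι, hι, p, hp, e, ⟨E⟩⟩ :=
    Module.equiv_directSum_of_isTorsion (R := F[X]) (M := Module.AEval' φ)
      (Module.AEval.isTorsion_of_finiteDimensional F V φ)
  obtain ⟨E₂⟩ := nonempty_equiv_pi_subtype (R := F[X])
    (M := fun i => F[X] ⧸ Submodule.span F[X] {p i ^ e i}) (fun i => 0 < e i) (by
      intro i hi
      have h0 : e i = 0 := by omega
      simp only [h0, pow_zero]
      rw [Submodule.Quotient.subsingleton_iff]
      exact Ideal.span_singleton_one)
  let g := (Fintype.equivFin {i // 0 < e i}).symm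
  refine ⟨_, Fintype.card {i // 0 < e i}, fun i => normalize (p (g i)), fun i => e (g i),
    fun i => ⟨Polynomial.monic_normalize (hp _).ne_zero,
      (normalize_associated _).symm.irreducible (hp _), (g i).2⟩, rfl, ⟨?_⟩⟩
  let E₃ := (E.trans (DirectSum.linearEquivFunOnFintype F[X] ι _)).trans E₂
  let E₄ := E₃.trans (LinearEquiv.piCongrLeft' F[X]
    (fun i : {i // 0 < e i} => F[X] ⧸ Submodule.span F[X] {p i ^ e i}) g.symm)
  refine E₄.trans (LinearEquiv.piCongrRight fun i => ?_)
  refine Submodule.quotEquivOfEq _ _ ?_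
  exact Ideal.span_singleton_eq_span_singleton.2 ((normalize_associated _).symm.pow_pow)

/-- The multiset of elementary divisors of `φ` (the list is unique up to order, by the structure
theorem for modules over a principal ideal domain). -/
noncomputable def elementaryDivisors [FiniteDimensional F V] (φ : V →ₗ[F] V) : Multiset F[X] :=
  (exists_isElementaryDivisors φ).choose

theorem elementaryDivisors_spec [FiniteDimensional F V] (φ : V →ₗ[F] V) :
    IsElementaryDivisors φ (elementaryDivisors φ) :=
  (exists_isElementaryDivisors φ).choose_spec

end ElementaryDivisors

section Matrices

variable {F : Type*} [Field F] {n : ℕ}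

/-- The elementary divisors of an invertible matrix, acting on row vectors by `v ↦ v X`. -/
noncomputable def elemDiv (X : GL (Fin n) F) : Multiset F[X] :=
  elementaryDivisors (Matrix.vecMulLinear (X : Matrix (Fin n) (Fin n) F))

open Classical in
/-- The multiplicity of `g` as an elementary divisor of `X`. -/
noncomputable def mult (X : GL (Fin n) F) (g : F[X]) : ℕ := (elemDiv X).count g

/-! ### Dual polynomials -/

/-- The dual polynomial `f^*(t) = f(0)⁻¹ t ^ d f(t⁻¹)`, `d = deg f`
(for the trivial field automorphism). -/
noncomputable def dual (f : F[X]) : F[X] := C (f.coeff 0)⁻¹ * f.reverse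

variable (F) in
/-- The self-dual monic irreducible polynomials of degree greater than one. -/
def Phi3 : Set F[X] := {f | f.Monic ∧ Irreducible f ∧ f = dual f ∧ 1 < f.natDegree}

/-- The sum of `e * m(f ^ e)` over all `f` in `Phi3` and all `e ≥ 1`. -/
noncomputable def phi3Sum (X : GL (Fin n) F) : ℕ :=
  ∑ᶠ p ∈ {p : F[X] × ℕ | p.1 ∈ Phi3 F ∧ 1 ≤ p.2}, p.2 * mult X (p.1 ^ p.2)

/-- Only finitely many terms of the sum are non-zero. -/
theorem phi3Sum_finite (X : GL (Fin n) F) :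
    ({p : F[X] × ℕ | p.1 ∈ Phi3 F ∧ 1 ≤ p.2} ∩
      Function.support fun p => p.2 * mult X (p.1 ^ p.2)).Finite := by
  classical
  refine Set.Finite.of_finite_image (f := fun p : F[X] × ℕ => p.1 ^ p.2)
    ((elemDiv X).toFinset.finite_toSet.subset ?_) ?_
  · rintro _ ⟨p, ⟨-, hp⟩, rfl⟩
    have h : mult X (p.1 ^ p.2) ≠ 0 := fun h => hp (by simp [h])
    simpa [mult] using h
  · rintro ⟨f, a⟩ ⟨⟨hf, ha⟩, -⟩ ⟨g, b⟩ ⟨⟨hg, hb⟩, -⟩ h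
    simp only [Phi3, Set.mem_ofPred_eq] at hf hg ha hb h
    have hfg : f = g := by
      refine Polynomial.eq_of_monic_of_associated hf.1 hg.1
        (hf.2.1.associated_of_dvd hg.2.1 ?_)
      exact hf.2.1.prime.dvd_of_dvd_pow (h ▸ dvd_pow_self f (by omega))
    subst hfg
    have hd := congrArg Polynomial.natDegree h
    rw [Polynomial.natDegree_pow, Polynomial.natDegree_pow] at hd
    have hab : a = b := Nat.eq_of_mul_eq_mul_right (by omega) hd
    rw [hab]

/-! ### Conjugation in a field of order `q ^ 2` -/

/-- The automorphism `x ↦ x ^ q` of a field of order `q ^ 2`. -/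
noncomputable def conj [Finite F] (q : ℕ) (hq : Nat.card F = q ^ 2) : F →+* F where
  toFun x := x ^ q
  map_one' := one_pow q
  map_mul' x y := mul_pow x y q
  map_zero' := zero_pow (by rintro rfl; exact Nat.card_pos.ne' (by simpa using hq))
  map_add' x y := by
    have := Fintype.ofFinite F
    obtain ⟨p, hp⟩ := CharP.exists F
    obtain ⟨m, hprime, hm⟩ := FiniteField.card F p
    have : Fact p.Prime := ⟨hprime⟩
    rw [Nat.card_eq_fintype_card] at hq
    obtain ⟨k, -, rfl⟩ := (Nat.dvd_prime_pow hprime).1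
      (show q ∣ p ^ (m : ℕ) from hm ▸ hq ▸ dvd_pow_self q two_ne_zero)
    exact add_pow_char_pow x y p k

/-- The matrix `X^*`, the transpose of `X` with `σ` applied to every entry. -/
def adj (σ : F →+* F) (X : GL (Fin n) F) : GL (Fin n) F where
  val := ((X : Matrix (Fin n) (Fin n) F).map σ).transpose
  inv := (((X⁻¹ : GL (Fin n) F) : Matrix (Fin n) (Fin n) F).map σ).transpose
  val_inv := by
    rw [← Matrix.transpose_mul, ← Matrix.map_mul, Units.inv_mul]
    simp
  inv_val := by
    rw [← Matrix.transpose_mul, ← Matrix.map_mul, Units.mul_inv]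
    simp

/-! ### Forms on the space of row vectors and their isometries -/

/-- A form which is linear in the first and `σ`-semilinear in the second variable is hermitian
if `β(u, v) = σ (β(v, u))`. -/
def IsHermitian {σ : F →+* F} (β : (Fin n → F) →ₗ[F] (Fin n → F) →ₛₗ[σ] F) : Prop :=
  ∀ u v, β u v = σ (β v u)

/-- `X` is an isometry of the sesquilinear form `β`. -/
def Preserves {σ : F →+* F} (X : GL (Fin n) F)
    (β : (Fin n → F) →ₗ[F] (Fin n → F) →ₛₗ[σ] F) : Prop :=
  ∀ u v, β (Matrix.vecMul u X.1) (Matrix.vecMul v X.1) = β u v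

/-- `X` is an isometry of the quadratic form `Q`. -/
def PreservesQuad (X : GL (Fin n) F) (Q : QuadraticForm F (Fin n → F)) : Prop :=
  ∀ v, Q (Matrix.vecMul v X.1) = Q v

/-- `Q` is non-singular: the bilinear form `Q(u + v) - Q(u) - Q(v)` is non-degenerate. -/
def NonSingular (Q : QuadraticForm F (Fin n → F)) : Prop :=
  LinearMap.Nondegenerate Q.polarBilin

/-- The Witt index: the maximal dimension of a totally singular subspace. -/
noncomputable def wittIndex (Q : QuadraticForm F (Fin n → F)) : ℕ :=
  sSup {d | ∃ W : Submodule F (Fin n → F), (∀ w ∈ W, Q w = 0) ∧ Module.finrank F W = d}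

/-- Plus type: the dimension is `2 * k` and the Witt index is `k`. -/
def PlusType (Q : QuadraticForm F (Fin n → F)) : Prop := n = 2 * wittIndex Q

/-- Minus type: the dimension is `2 * k` and the Witt index is `k - 1`. -/
def MinusType (Q : QuadraticForm F (Fin n → F)) : Prop := n = 2 * (wittIndex Q + 1)

end Matrices

end FormIsometry

/-!
# Isometries of forms over finite fields and their elementary divisors

The elementary divisors of an endomorphism `φ` are encoded by the dimensions of the kernels of the
polynomials in `φ`: the multiplicity of `f ^ e` is, up to the factor `deg f`, a second difference of
the nullities of `f ^ (e - 1)`, `f ^ e`, `f ^ (e + 1)` at `φ`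
(`IsElementaryDivisors.two_mul_nul`). Hence conjugacy in `GL (n, F)` is decided by nullities
(`isConj_of_nul_eq`).

*Necessary conditions.* If `φ` preserves a non-degenerate sesquilinear form, then `g(φ)` and the
reversed polynomial at `φ` are adjoint up to a power of `φ`, so that they have the same nullity
(`isSelfDual_of_form`). This self-duality of nullities is equivalent to the conjugacy of `X` with
`X⁻¹`, or with `(X*)⁻¹` in the hermitian case (`isConj_inv_iff`, `isConj_adj_inv_iff`). The parity
conditions hold because an alternating form has even rank; this is applied to the forms
`β (N ^ j u, N ^ j v)` for alternating `β` (`count_even_of_alternating`), and to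
`β (N ^ j u, φ N ^ j v) - β (φ N ^ j u, N ^ j v)` for symmetric `β` (`count_even_of_symmetric`),
where `N = φ - c` and `c = ± 1`.

*Existence of forms.* Under these conditions the elementary divisors split into pairs `p`, `p*` and
single self-dual `p` (`multiset_induction_of_involution`). A pair is realized by the hyperbolic form
on `F[X] / (p) × F[X] / (p*)`. On `F[X] / (f ^ e)` with self-dual `f ^ e` there is an involution `ι`
inverting `X`, and the forms `T (a * ι b)` and `S (a * ι a)` are preserved by `X`; they are
non-degenerate for a suitable functional, depending on how `ι` acts on the minimal ideal of
`F[X] / (f ^ e)`. In characteristic two, `(X + 1) ^ (2 * k)` is realized by a form that descends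
from `F[X] / (X + 1) ^ (2 * k + 1)` (`exists_quadraticForm_X_add_one_pow`).

*Types.* For a non-trivial additive character `ψ` the Gauss sum `∑ ψ (Q v)` of a non-singular form
on an even-dimensional `V` is `√|V|` for plus type and `-√|V|` for minus type
(`gaussSumOf_type`). If some elementary divisors admit a family of preserved forms whose Gauss sums
add up to zero (`GaussSumsCancel`), then both types occur. Such families are the multiples of a form
of odd dimension, for `(X ∓ 1) ^ e` with odd `e` in odd characteristic, and explicit families
`Q + c • R` for `(X + 1) ^ (2 * k)` and for pairs of `(X + 1) ^ (2 * k + 1)` in characteristic two.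

In the remaining cases the sign is determined. A totally singular invariant subspace can be split
off together with its dual without changing the sign (`exists_reduction`). Without eigenvalues `± 1`
one is left with orthogonal summands which are fields `F[X] / (f)`, `f ∈ Phi3`; there the form is a
function of the norm `a * ι a`, which takes all its non-zero values equally often, and this makes
the Gauss sum negative (`gaussSumOf_adjoinRoot`, `gaussSumOf_eq_of_isCoprime_charpoly`). In odd
characteristic, elementary divisors `(X ∓ 1) ^ (2 * k)` contribute a totally singular subspace of
half the dimension of their generalized eigenspaces (`middle`, `gaussSumOf_eq_of_even_exponents`).
Thus the sign is `(-1)` to the number of factors of the characteristic polynomial in `Phi3`, which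
is `phi3Sum`.
-/

namespace FormIsometry

universe u

/-! ### Elementary divisors -/

section ElementaryDivisorsAPI

variable {F : Type u} [Field F]

/-- A power `f ^ e`, `e ≥ 1`, of a monic irreducible polynomial. -/
def IsMonicPrimePow (p : F[X]) : Prop :=
  ∃ (f : F[X]) (e : ℕ), f.Monic ∧ Irreducible f ∧ 0 < e ∧ p = f ^ e

lemma IsMonicPrimePow.monic {p : F[X]} (h : IsMonicPrimePow p) : p.Monic := by
  obtain ⟨f, e, hf, -, -, rfl⟩ := h
  exact hf.pow e

lemma X_smul_eq_root_mul {p : F[X]} (a : AdjoinRoot p) :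
    (show F[X] ⧸ Ideal.span {p} from (X : F[X]) • (show F[X] ⧸ Ideal.span {p} from a)) =
      (AdjoinRoot.root p * a : AdjoinRoot p) := by
  obtain ⟨g, rfl⟩ := AdjoinRoot.mk_surjective a
  rfl

variable {V W : Type*} [AddCommGroup V] [Module F V] [AddCommGroup W] [Module F W]

/-- A decomposition into cyclic modules gives a list of elementary divisors. -/
lemma isElementaryDivisors_of_equiv {φ : V →ₗ[F] V} {ι : Type*} [Fintype ι] (p : ι → F[X])
    (hp : ∀ i, IsMonicPrimePow (p i)) (E : V ≃ₗ[F] ∀ i, AdjoinRoot (p i))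
    (hE : ∀ v i, E (φ v) i = AdjoinRoot.root (p i) * E v i) :
    IsElementaryDivisors φ (Finset.univ.val.map p) := by
  choose f e hf hi he hfe using hp
  let g := (Fintype.equivFin ι).symm
  refine ⟨Fintype.card ι, fun j => f (g j), fun j => e (g j),
    fun j => ⟨hf _, hi _, he _⟩, ?_, ?_⟩
  · have h1 : (Finset.univ.val.map p) = (Finset.univ.val.map g).map p := by
      rw [Multiset.map_univ_val_equiv]
    rw [h1, Multiset.map_map]
    exact Multiset.map_congr rfl fun j _ => hfe _
  · obtain rfl : p = fun i => f i ^ e i := funext hfe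
    let E' : V ≃ₗ[F] ((j : Fin (Fintype.card ι)) → F[X] ⧸ Ideal.span {f (g j) ^ e (g j)}) :=
      E.trans (LinearEquiv.piCongrLeft' F (fun i => AdjoinRoot (f i ^ e i)) g.symm)
    refine ⟨LinearEquiv.ofAEval φ E' ?_⟩
    intro v
    funext j
    exact (hE v (g j)).trans (X_smul_eq_root_mul _).symm

/-- Elementary divisors in terms of `F`-linear maps: the endomorphism is, up to a linear
isomorphism, multiplication by the class of `X` on a product of rings `F[X] / (p i)`. -/
lemma isElementaryDivisors_iff {φ : V →ₗ[F] V} {s : Multiset F[X]} :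
    IsElementaryDivisors φ s ↔ ∃ (r : ℕ) (p : Fin r → F[X]),
      (∀ i, IsMonicPrimePow (p i)) ∧ s = Finset.univ.val.map p ∧
      ∃ E : V ≃ₗ[F] ∀ i, AdjoinRoot (p i),
        ∀ v i, E (φ v) i = AdjoinRoot.root (p i) * E v i := by
  constructor
  · rintro ⟨r, f, e, h, hs, ⟨E⟩⟩
    refine ⟨r, fun i => f i ^ e i, fun i => ⟨f i, e i, (h i).1, (h i).2.1, (h i).2.2, rfl⟩, hs, ?_⟩
    let E' : V ≃ₗ[F] ((i : Fin r) → F[X] ⧸ Ideal.span {f i ^ e i}) :=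
      (Module.AEval'.of φ).trans (E.restrictScalars F)
    refine ⟨E', fun v i => ?_⟩
    have : E' (φ v) = (X : F[X]) • E' v := by
      change E (Module.AEval'.of φ (φ v)) = (X : F[X]) • E (Module.AEval'.of φ v)
      rw [← map_smul, Module.AEval'.X_smul_of]
    exact (congrFun this i).trans (X_smul_eq_root_mul (p := f i ^ e i) (E' v i))
  · rintro ⟨r, p, hp, rfl, E, hE⟩
    exact isElementaryDivisors_of_equiv p hp E hE

lemma IsElementaryDivisors.isMonicPrimePow {φ : V →ₗ[F] V} {s : Multiset F[X]}
    (h : IsElementaryDivisors φ s) {p : F[X]} (hp : p ∈ s) : IsMonicPrimePow p := by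
  obtain ⟨r, p', hp', rfl, -⟩ := isElementaryDivisors_iff.1 h
  obtain ⟨i, -, rfl⟩ := Multiset.mem_map.1 hp
  exact hp' i

lemma IsElementaryDivisors.zero {φ : V →ₗ[F] V} [Subsingleton V] :
    IsElementaryDivisors φ 0 := by
  refine isElementaryDivisors_iff.2 ⟨0, Fin.elim0, fun i => i.elim0, rfl, ?_, ?_⟩
  · exact LinearEquiv.ofSubsingleton _ _
  · intro v i
    exact i.elim0

/-- Multiplication by the class of `X` on `F[X] / (p)`. -/
noncomputable def rootMul (p : F[X]) : AdjoinRoot p →ₗ[F] AdjoinRoot p :=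
  LinearMap.mulLeft F (AdjoinRoot.root p)

@[simp] lemma rootMul_apply (p : F[X]) (a : AdjoinRoot p) :
    rootMul p a = AdjoinRoot.root p * a := rfl

lemma isElementaryDivisors_rootMul {p : F[X]} (hp : IsMonicPrimePow p) :
    IsElementaryDivisors (rootMul p) {p} :=
  isElementaryDivisors_of_equiv (ι := Unit) (fun _ => p) (fun _ => hp)
    (LinearEquiv.funUnique Unit F (AdjoinRoot p)).symm fun _ _ => rfl

lemma IsElementaryDivisors.add {φ : V →ₗ[F] V} {ψ : W →ₗ[F] W} {s t : Multiset F[X]}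
    (hs : IsElementaryDivisors φ s) (ht : IsElementaryDivisors ψ t) :
    IsElementaryDivisors (φ.prodMap ψ) (s + t) := by
  obtain ⟨r, p, hp, rfl, E, hE⟩ := isElementaryDivisors_iff.1 hs
  obtain ⟨r', p', hp', rfl, E', hE'⟩ := isElementaryDivisors_iff.1 ht
  have h1 : Finset.univ.val.map p + Finset.univ.val.map p' =
      Finset.univ.val.map (Sum.elim p p') := by
    rw [← Finset.univ_disjSum_univ, Finset.val_disjSum, Multiset.disjSum, Multiset.map_add,
      Multiset.map_map, Multiset.map_map]
    rfl
  rw [h1]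
  refine isElementaryDivisors_of_equiv (Sum.elim p p') ?_
    ((E.prodCongr E').trans
      (LinearEquiv.sumPiEquivProdPi F (Fin r) (Fin r')
        (fun i => AdjoinRoot (Sum.elim p p' i))).symm) ?_
  · rintro (i | i)
    · exact hp i
    · exact hp' i
  · rintro v (i | i)
    · exact hE v.1 i
    · exact hE' v.2 i

/-- Endomorphisms with the same elementary divisors are isomorphic. -/
lemma IsElementaryDivisors.exists_equiv {φ : V →ₗ[F] V} {ψ : W →ₗ[F] W} {s : Multiset F[X]}
    (hs : IsElementaryDivisors φ s) (ht : IsElementaryDivisors ψ s) :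
    ∃ E : V ≃ₗ[F] W, ∀ v, E (φ v) = ψ (E v) := by
  classical
  obtain ⟨r, p, hp, rfl, E, hE⟩ := isElementaryDivisors_iff.1 hs
  obtain ⟨r', p', hp', hpp, E', hE'⟩ := isElementaryDivisors_iff.1 ht
  have hc : ∀ c, Nonempty ({i // p i = c} ≃ {i // p' i = c}) := by
    intro c
    refine Fintype.card_eq.1 ?_
    have h := congrArg (Multiset.count c) hpp
    rw [Multiset.count_map, Multiset.count_map] at h
    rw [Fintype.card_subtype, Fintype.card_subtype]
    simpa [Finset.card, eq_comm] using h
  obtain ⟨g, hg⟩ : ∃ g : Fin r ≃ Fin r', ∀ i, p' (g i) = p i :=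
    ⟨Equiv.ofFiberEquiv (f := p) (g := p') fun c => (hc c).some,
      fun i => Equiv.ofFiberEquiv_map _ i⟩
  obtain rfl : p = fun i => p' (g i) := funext fun i => (hg i).symm
  obtain ⟨E₂, hE₂⟩ : ∃ E₂ : W ≃ₗ[F] (∀ i, AdjoinRoot (p' (g i))),
      ∀ w i, E₂ (ψ w) i = AdjoinRoot.root (p' (g i)) * E₂ w i :=
    ⟨E'.trans (LinearEquiv.piCongrLeft' F (fun i => AdjoinRoot (p' i)) g.symm),
      fun w i => hE' w (g i)⟩
  refine ⟨E.trans E₂.symm, fun v => ?_⟩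
  apply E₂.injective
  rw [LinearEquiv.trans_apply, LinearEquiv.apply_symm_apply]
  funext i
  rw [hE]
  rw [hE₂, LinearEquiv.trans_apply, LinearEquiv.apply_symm_apply]

/-- Every multiset of powers of monic irreducible polynomials occurs. -/
lemma exists_model (s : Multiset F[X]) (hs : ∀ p ∈ s, IsMonicPrimePow p) :
    ∃ (V : Type u) (_ : AddCommGroup V) (_ : Module F V) (_ : FiniteDimensional F V)
      (φ : V →ₗ[F] V), IsElementaryDivisors φ s := by
  induction s using Multiset.induction with
  | empty => exact ⟨PUnit, inferInstance, inferInstance, inferInstance, 0, .zero⟩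
  | cons p s ih =>
    obtain ⟨V, _, _, _, φ, h⟩ := ih fun q hq => hs q (Multiset.mem_cons_of_mem hq)
    have hp := hs p (Multiset.mem_cons_self p s)
    have := hp.monic.finite_adjoinRoot
    refine ⟨AdjoinRoot p × V, inferInstance, inferInstance, inferInstance,
      (rootMul p).prodMap φ, ?_⟩
    rw [← Multiset.singleton_add]
    exact (isElementaryDivisors_rootMul hp).add h

/-! ### Dimensions of kernels -/

/-- The nullity of `g(φ)`. -/
noncomputable def nul (φ : V →ₗ[F] V) (g : F[X]) : ℕ :=
  Module.finrank F (LinearMap.ker (aeval φ g))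

/-- The nullity of multiplication by `g` on `F[X] / (p)`. -/
noncomputable def modNul (g p : F[X]) : ℕ :=
  Module.finrank F (LinearMap.ker (LinearMap.mulLeft F (AdjoinRoot.mk p g)))

/-- A map intertwining `φ` with multiplication by `X` intertwines `g(φ)` with multiplication
by `g`. -/
lemma map_aeval_eq_mk_mul {φ : V →ₗ[F] V} {p : F[X]} (E : V →ₗ[F] AdjoinRoot p)
    (hE : ∀ v, E (φ v) = AdjoinRoot.root p * E v) (g : F[X]) (v : V) :
    E (aeval φ g v) = AdjoinRoot.mk p g * E v := by
  induction g using Polynomial.induction_on generalizing v with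
  | C a =>
    rw [aeval_C, Module.algebraMap_end_apply, map_smul, Algebra.smul_def]
    rfl
  | add g h hg hh => rw [map_add, LinearMap.add_apply, map_add, hg, hh, map_add, add_mul]
  | monomial n a h =>
    rw [pow_succ, ← mul_assoc, map_mul, Module.End.mul_apply, h, aeval_X, hE,
      map_mul (AdjoinRoot.mk p) _ X, AdjoinRoot.mk_X, mul_assoc]

/-- A map intertwining `φ` and `ψ` intertwines `g(φ)` and `g(ψ)`. -/
lemma map_aeval_of_intertwines {φ : V →ₗ[F] V} {ψ : W →ₗ[F] W} (E : V →ₗ[F] W)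
    (hE : ∀ v, E (φ v) = ψ (E v)) (g : F[X]) (v : V) :
    E (aeval φ g v) = aeval ψ g (E v) := by
  induction g using Polynomial.induction_on generalizing v with
  | C a => simp [aeval_C, Module.algebraMap_end_apply]
  | add g h hg hh => simp [hg, hh]
  | monomial n a h =>
    rw [pow_succ, ← mul_assoc, map_mul, Module.End.mul_apply, h, aeval_X, hE,
      map_mul (aeval ψ) _ X, Module.End.mul_apply, aeval_X]

lemma nul_congr {φ : V →ₗ[F] V} {ψ : W →ₗ[F] W} (E : V ≃ₗ[F] W)
    (hE : ∀ v, E (φ v) = ψ (E v)) (g : F[X]) : nul φ g = nul ψ g := by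
  have h := map_aeval_of_intertwines (E : V →ₗ[F] W) hE g
  refine LinearEquiv.finrank_eq (LinearEquiv.ofSubmodules E _ _ ?_)
  ext w
  constructor
  · rintro ⟨v, hv, rfl⟩
    exact (h v).symm.trans (by rw [LinearMap.mem_ker.1 hv, map_zero])
  · intro hw
    refine ⟨E.symm w, ?_, E.apply_symm_apply w⟩
    refine E.injective ((h _).trans ?_)
    rw [map_zero]
    simpa using hw

lemma IsElementaryDivisors.nul_eq {φ : V →ₗ[F] V} {s : Multiset F[X]}
    (hs : IsElementaryDivisors φ s) (g : F[X]) : nul φ g = (s.map (modNul g)).sum := by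
  obtain ⟨r, p, hp, rfl, E, hE⟩ := isElementaryDivisors_iff.1 hs
  have hg : ∀ v i, E (aeval φ g v) i = AdjoinRoot.mk (p i) g * E v i := fun v i =>
    map_aeval_eq_mk_mul ((LinearMap.proj i).comp E.toLinearMap) (fun v => hE v i) g v
  let K : LinearMap.ker (aeval φ g) ≃ₗ[F]
      ∀ i, LinearMap.ker (LinearMap.mulLeft F (AdjoinRoot.mk (p i) g)) :=
    { toFun := fun v i => ⟨E v i, by
        have := congrFun (congrArg E (LinearMap.mem_ker.1 v.2)) i
        rw [hg, map_zero] at this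
        exact this⟩
      map_add' := fun v w => by ext i; simp
      map_smul' := fun c w => by ext i; simp
      invFun := fun w => ⟨E.symm fun i => w i, by
        rw [LinearMap.mem_ker]
        apply E.injective
        funext i
        rw [hg, map_zero, LinearEquiv.apply_symm_apply]
        exact (w i).2⟩
      left_inv := fun v => by ext; simp
      right_inv := fun w => by ext; simp }
  have : ∀ i, Module.Finite F (AdjoinRoot (p i)) := fun i => (hp i).monic.finite_adjoinRoot
  rw [nul, LinearEquiv.finrank_eq K, Module.finrank_pi_fintype]
  simp only [Multiset.map_map]
  rfl

lemma finrank_adjoinRoot (p : F[X]) : Module.finrank F (AdjoinRoot p) = p.natDegree :=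
  finrank_quotient_span_eq_natDegree

/-- Multiplication by a divisor `g` of `p` has a kernel of dimension `deg g` on `F[X] / (p)`. -/
lemma modNul_of_dvd {g p : F[X]} (hp : p ≠ 0) (h : g ∣ p) : modNul g p = g.natDegree := by
  have : Module.Finite F (AdjoinRoot p) := (AdjoinRoot.powerBasis hp).finite
  have hg : g ≠ 0 := ne_zero_of_dvd_ne_zero hp h
  have : Module.Finite F (AdjoinRoot g) := (AdjoinRoot.powerBasis hg).finite
  let π := (AdjoinRoot.algHomOfDvd F p g h).toLinearMap
  have hπ : ∀ x, π (AdjoinRoot.mk p x) = AdjoinRoot.mk g x := by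
    intro x
    change AdjoinRoot.algHomOfDvd F p g h (AdjoinRoot.mk p x) = _
    rw [← AdjoinRoot.aeval_eq, ← AdjoinRoot.aeval_eq, ← Polynomial.aeval_algHom_apply,
      AdjoinRoot.algHomOfDvd_root]
  have hsurj : Function.Surjective π := by
    intro y
    obtain ⟨y, rfl⟩ := AdjoinRoot.mk_surjective y
    exact ⟨_, hπ y⟩
  have hker : LinearMap.ker π = LinearMap.range (LinearMap.mulLeft F (AdjoinRoot.mk p g)) := by
    ext x
    obtain ⟨x, rfl⟩ := AdjoinRoot.mk_surjective x
    rw [LinearMap.mem_ker, hπ, AdjoinRoot.mk_eq_zero, LinearMap.mem_range]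
    constructor
    · rintro ⟨y, rfl⟩
      exact ⟨AdjoinRoot.mk p y, by simp⟩
    · rintro ⟨y, hy⟩
      obtain ⟨y, rfl⟩ := AdjoinRoot.mk_surjective y
      rw [LinearMap.mulLeft_apply, ← map_mul, AdjoinRoot.mk_eq_mk] at hy
      exact (dvd_sub_right (dvd_mul_right g y)).1 (h.trans hy)
  have h1 := LinearMap.finrank_range_add_finrank_ker π
  have h2 := LinearMap.finrank_range_add_finrank_ker (LinearMap.mulLeft F (AdjoinRoot.mk p g))
  rw [LinearMap.range_eq_top.2 hsurj, finrank_top, hker, finrank_adjoinRoot] at h1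
  unfold modNul
  omega

/-- A factor coprime to `p` does not change the nullity on `F[X] / (p)`. -/
lemma modNul_mul_of_isCoprime {g h p : F[X]} (hc : IsCoprime h p) :
    modNul (h * g) p = modNul g p := by
  obtain ⟨a, b, hab⟩ := hc
  have hu : AdjoinRoot.mk p a * AdjoinRoot.mk p h = 1 := by
    rw [← map_mul, ← map_one (AdjoinRoot.mk p), AdjoinRoot.mk_eq_mk]
    exact ⟨-b, by linear_combination hab⟩
  suffices hk : LinearMap.ker (LinearMap.mulLeft F (AdjoinRoot.mk p (h * g))) =
      LinearMap.ker (LinearMap.mulLeft F (AdjoinRoot.mk p g)) by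
    rw [modNul, hk, modNul]
  ext x
  simp only [LinearMap.mem_ker, LinearMap.mulLeft_apply, map_mul]
  constructor
  · intro hx
    have := congrArg (AdjoinRoot.mk p a * ·) hx
    simp only [mul_zero] at this
    rwa [mul_assoc, ← mul_assoc, hu, one_mul] at this
  · intro hx
    rw [mul_assoc, hx, mul_zero]

lemma modNul_pow_mul_pow {f h : F[X]} (hf : f.Monic) (hh : IsCoprime h f) (j a : ℕ) :
    modNul (f ^ j * h) (f ^ a) = f.natDegree * min j a := by
  rw [mul_comm (f ^ j) h, modNul_mul_of_isCoprime (hh.pow_right)]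
  rcases le_total j a with hja | hja
  · rw [modNul_of_dvd (hf.pow a).ne_zero (pow_dvd_pow f hja), natDegree_pow, min_eq_left hja,
      mul_comm]
  · have : modNul (f ^ j) (f ^ a) = modNul (f ^ a) (f ^ a) := by
      unfold modNul
      rw [AdjoinRoot.mk_eq_zero.2 (pow_dvd_pow f hja), AdjoinRoot.mk_self]
    rw [this, modNul_of_dvd (hf.pow a).ne_zero dvd_rfl, natDegree_pow, min_eq_right hja, mul_comm]

lemma isCoprime_of_monic_irreducible_ne {f g : F[X]} (hf : f.Monic) (hfi : Irreducible f)
    (hg : g.Monic) (hgi : Irreducible g) (h : f ≠ g) : IsCoprime f g :=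
  (hfi.coprime_iff_not_dvd).2 fun hd =>
    h (eq_of_monic_of_associated hf hg (hfi.associated_of_dvd hgi hd))

lemma eq_of_pow_eq_pow {f g : F[X]} (hf : f.Monic) (hfi : Irreducible f)
    (hg : g.Monic) (hgi : Irreducible g) {a b : ℕ} (ha : 0 < a) (h : f ^ a = g ^ b) :
    f = g ∧ a = b := by
  have hfg : f = g := eq_of_monic_of_associated hf hg (hfi.associated_of_dvd hgi
    (hfi.prime.dvd_of_dvd_pow (h ▸ dvd_pow_self f ha.ne')))
  subst hfg
  refine ⟨rfl, ?_⟩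
  have hd := congrArg Polynomial.natDegree h
  rw [natDegree_pow, natDegree_pow] at hd
  exact Nat.eq_of_mul_eq_mul_right hfi.natDegree_pos hd

open Classical in
/-- The multiplicities of the elementary divisors are the second differences of the nullities of
the powers of `f(φ)`; the auxiliary factor `h`, coprime to `f`, has no influence. -/
lemma IsElementaryDivisors.two_mul_nul {φ : V →ₗ[F] V} {s : Multiset F[X]}
    (hs : IsElementaryDivisors φ s) {f h : F[X]} (hf : f.Monic) (hfi : Irreducible f)
    (hh : IsCoprime h f) (e : ℕ) :
    2 * nul φ (f ^ (e + 1) * h) = nul φ (f ^ e * h) + nul φ (f ^ (e + 2) * h) +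
      f.natDegree * s.count (f ^ (e + 1)) := by
  rw [hs.nul_eq, hs.nul_eq, hs.nul_eq]
  have hpp : ∀ p ∈ s, IsMonicPrimePow p := fun p hp => hs.isMonicPrimePow hp
  clear hs
  induction s using Multiset.induction with
  | empty => simp
  | cons p s ih =>
    have ih := ih fun q hq => hpp q (Multiset.mem_cons_of_mem hq)
    have key : 2 * modNul (f ^ (e + 1) * h) p = modNul (f ^ e * h) p +
        modNul (f ^ (e + 2) * h) p + f.natDegree * (if f ^ (e + 1) = p then 1 else 0) := by
      obtain ⟨g, a, hg, hgi, ha, rfl⟩ := hpp p (Multiset.mem_cons_self _ _)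
      by_cases hfg : f = g
      · subst hfg
        rw [modNul_pow_mul_pow hf hh, modNul_pow_mul_pow hf hh, modNul_pow_mul_pow hf hh]
        have hif : (if f ^ (e + 1) = f ^ a then 1 else 0) = if e + 1 = a then 1 else 0 := by
          refine if_congr ⟨fun h => (eq_of_pow_eq_pow hf hfi hf hfi (by omega) h).2, ?_⟩ rfl rfl
          rintro rfl
          rfl
        rw [hif, ← mul_add, ← mul_add, mul_left_comm]
        congr 1
        split_ifs <;> omega
      · have hc := isCoprime_of_monic_irreducible_ne hf hfi hg hgi hfg
        have hne : f ^ (e + 1) ≠ g ^ a := fun h =>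
          hfg (eq_of_pow_eq_pow hf hfi hg hgi (by omega) h).1
        rw [if_neg hne, modNul_mul_of_isCoprime hc.pow, modNul_mul_of_isCoprime hc.pow,
          modNul_mul_of_isCoprime hc.pow]
        ring
    simp only [Multiset.map_cons, Multiset.sum_cons, Multiset.count_cons, mul_add] at ih key ⊢
    linarith

/-- The elementary divisors are determined by the nullities of polynomials in `φ`. -/
lemma IsElementaryDivisors.eq_of_nul_eq {φ : V →ₗ[F] V} {ψ : W →ₗ[F] W} {s t : Multiset F[X]}
    (hs : IsElementaryDivisors φ s) (ht : IsElementaryDivisors ψ t)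
    (h : ∀ f : F[X], f.Monic → Irreducible f → ∀ e, nul φ (f ^ e) = nul ψ (f ^ e)) : s = t := by
  classical
  have key : ∀ p, IsMonicPrimePow p → s.count p = t.count p := by
    rintro p ⟨f, e, hf, hfi, he, rfl⟩
    obtain ⟨e, rfl⟩ := Nat.exists_eq_succ_of_ne_zero he.ne'
    have h1 := hs.two_mul_nul hf hfi isCoprime_one_left e
    have h2 := ht.two_mul_nul hf hfi isCoprime_one_left e
    simp only [mul_one, h f hf hfi] at h1 h2
    exact Nat.eq_of_mul_eq_mul_left hfi.natDegree_pos (by simp only [Nat.succ_eq_add_one]; omega)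
  ext p
  by_cases hp : IsMonicPrimePow p
  · exact key p hp
  · rw [Multiset.count_eq_zero_of_notMem fun h => hp (hs.isMonicPrimePow h),
      Multiset.count_eq_zero_of_notMem fun h => hp (ht.isMonicPrimePow h)]

/-- The characteristic polynomial is the product of the elementary divisors. -/
lemma IsElementaryDivisors.charpoly_eq {φ : V →ₗ[F] V} [FiniteDimensional F V]
    {s : Multiset F[X]} (hs : IsElementaryDivisors φ s) : φ.charpoly = s.prod := by
  have key : ∀ s : Multiset F[X], (∀ p ∈ s, IsMonicPrimePow p) →
      ∃ (W : Type u) (_ : AddCommGroup W) (_ : Module F W) (_ : FiniteDimensional F W)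
        (ψ : W →ₗ[F] W), IsElementaryDivisors ψ s ∧ ψ.charpoly = s.prod := by
    intro s hs
    induction s using Multiset.induction with
    | empty =>
      refine ⟨PUnit, inferInstance, inferInstance, inferInstance, 0, .zero, ?_⟩
      rw [Multiset.prod_zero, ← (LinearMap.charpoly_monic _).natDegree_eq_zero,
        LinearMap.charpoly_natDegree, Module.finrank_zero_of_subsingleton]
    | cons p s ih =>
      obtain ⟨W, _, _, _, ψ, h, h'⟩ := ih fun q hq => hs q (Multiset.mem_cons_of_mem hq)
      have hp := hs p (Multiset.mem_cons_self p s)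
      have := hp.monic.finite_adjoinRoot
      refine ⟨AdjoinRoot p × W, inferInstance, inferInstance, inferInstance,
        (rootMul p).prodMap ψ, ?_, ?_⟩
      · rw [← Multiset.singleton_add]
        exact (isElementaryDivisors_rootMul hp).add h
      · rw [LinearMap.charpoly_prodMap, h', Multiset.prod_cons]
        congr 1
        rw [← LinearMap.charpoly_toMatrix (rootMul p) (AdjoinRoot.powerBasis' hp.monic).basis]
        have h2 := charpoly_leftMulMatrix (AdjoinRoot.powerBasis' hp.monic)
        rw [Algebra.leftMulMatrix_apply] at h2
        refine h2.trans ?_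
        rw [AdjoinRoot.powerBasis'_gen, AdjoinRoot.minpoly_root hp.monic.ne_zero,
          hp.monic.leadingCoeff, inv_one, C_1, mul_one]
  obtain ⟨W, _, _, _, ψ, h, h'⟩ := key s fun p hp => hs.isMonicPrimePow hp
  obtain ⟨E, hE⟩ := hs.exists_equiv h
  rw [← h', ← LinearEquiv.charpoly_conj E φ]
  congr 1
  ext w
  simp [LinearEquiv.conj_apply, hE]

/-- In `F[X] / (f ^ e)`, an element not divisible by `f ^ (j + 1)` divides `f ^ j`. -/
lemma exists_mul_eq_mk_pow {f : F[X]} (hf : Irreducible f) {e j : ℕ} {g : F[X]}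
    (hg : ¬ f ^ (j + 1) ∣ g) :
    ∃ r : AdjoinRoot (f ^ e), AdjoinRoot.mk _ g * r = AdjoinRoot.mk _ (f ^ j) := by
  have hg0 : g ≠ 0 := by rintro rfl; exact hg (dvd_zero _)
  obtain ⟨m, c, hc, rfl⟩ := WfDvdMonoid.max_power_factor hg0 hf
  have hm : m ≤ j := by
    by_contra h
    exact hg ((pow_dvd_pow f (by omega)).trans (dvd_mul_right _ _))
  obtain ⟨a, b, hab⟩ : IsCoprime c (f ^ e) := ((hf.coprime_iff_not_dvd).2 hc).symm.pow_right
  refine ⟨AdjoinRoot.mk _ (f ^ (j - m) * a), ?_⟩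
  rw [← map_mul, AdjoinRoot.mk_eq_mk]
  refine ⟨-b * f ^ j, ?_⟩
  have h1 : f ^ m * f ^ (j - m) = f ^ j := by rw [← pow_add, Nat.add_sub_cancel' hm]
  linear_combination (a * c) * h1 + f ^ j * hab

end ElementaryDivisorsAPI

end FormIsometry

namespace FormIsometry

universe u

/-! ### Dual polynomials -/

section DualPolynomials

variable {F : Type u} [Field F]

lemma natTrailingDegree_eq_zero_of_coeff {f : F[X]} (hf : f.coeff 0 ≠ 0) :
    f.natTrailingDegree = 0 :=
  natTrailingDegree_eq_zero.2 (Or.inr hf)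

lemma natDegree_reverse_of_coeff {f : F[X]} (hf : f.coeff 0 ≠ 0) :
    f.reverse.natDegree = f.natDegree := by
  rw [reverse_natDegree, natTrailingDegree_eq_zero_of_coeff hf, Nat.sub_zero]

lemma reverse_reverse {f : F[X]} (hf : f.coeff 0 ≠ 0) : f.reverse.reverse = f := by
  have h : f.reverse.reverse = reflect f.reverse.natDegree (reflect f.natDegree f) := rfl
  rw [h, natDegree_reverse_of_coeff hf, reflect_reflect]

lemma dual_mul (f g : F[X]) : dual (f * g) = dual f * dual g := by
  rw [dual, dual, dual, reverse_mul_of_domain, mul_coeff_zero, mul_inv, C_mul]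
  ring

lemma dual_one : dual (1 : F[X]) = 1 := by
  have h : (1 : F[X]).reverse = 1 := by rw [← C_1, reverse_C]
  simp [dual, h]

lemma dual_pow (f : F[X]) (e : ℕ) : dual (f ^ e) = dual f ^ e := by
  induction e with
  | zero => simp [dual_one]
  | succ e ih => rw [pow_succ, dual_mul, ih, pow_succ]

lemma natDegree_dual {f : F[X]} (hf : f.coeff 0 ≠ 0) : (dual f).natDegree = f.natDegree := by
  rw [dual, natDegree_C_mul (inv_ne_zero hf), natDegree_reverse_of_coeff hf]

lemma monic_dual {f : F[X]} (hf : f.coeff 0 ≠ 0) : (dual f).Monic := by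
  have h : f.trailingCoeff = f.coeff 0 := by
    rw [trailingCoeff, natTrailingDegree_eq_zero_of_coeff hf]
  rw [Monic, dual, leadingCoeff_mul, leadingCoeff_C, reverse_leadingCoeff, h, inv_mul_cancel₀ hf]

lemma dual_coeff_zero {f : F[X]} (hf : f.coeff 0 ≠ 0) : (dual f).coeff 0 ≠ 0 := by
  rw [dual, coeff_C_mul, coeff_zero_reverse]
  refine mul_ne_zero (inv_ne_zero hf) (leadingCoeff_ne_zero.2 ?_)
  rintro rfl
  exact hf (coeff_zero 0)

lemma dual_dual {f : F[X]} (hf : f.coeff 0 ≠ 0) (hm : f.Monic) : dual (dual f) = f := by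
  have h : (C (f.coeff 0)⁻¹ * f.reverse).reverse = C (f.coeff 0)⁻¹ * f := by
    rw [reverse_mul_of_domain, reverse_C, reverse_reverse hf]
  have h0 : (C (f.coeff 0)⁻¹ * f.reverse).coeff 0 = (f.coeff 0)⁻¹ := by
    rw [coeff_C_mul, coeff_zero_reverse, hm.leadingCoeff, mul_one]
  rw [dual, dual, h0, h, inv_inv, ← mul_assoc, ← C_mul, mul_inv_cancel₀ hf, C_1, one_mul]

lemma coeff_zero_ne_zero_of_dvd {f g : F[X]} (hg : g.coeff 0 ≠ 0) (h : f ∣ g) :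
    f.coeff 0 ≠ 0 := by
  obtain ⟨k, rfl⟩ := h
  rw [mul_coeff_zero] at hg
  exact left_ne_zero_of_mul hg

lemma irreducible_dual {f : F[X]} (hf : f.coeff 0 ≠ 0) (hm : f.Monic) (hi : Irreducible f) :
    Irreducible (dual f) := by
  have hunit : ∀ g : F[X], g.coeff 0 ≠ 0 → (IsUnit (dual g) → IsUnit g) := by
    intro g hg h
    have hg0 : g ≠ 0 := by rintro rfl; exact hg (coeff_zero 0)
    have := natDegree_eq_zero_of_isUnit h
    rw [natDegree_dual hg] at this
    rw [isUnit_iff_degree_eq_zero, degree_eq_natDegree hg0, this]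
    rfl
  refine ⟨fun h => hi.not_isUnit (hunit f hf h), fun a b hab => ?_⟩
  have h0 := dual_coeff_zero hf
  have ha := coeff_zero_ne_zero_of_dvd h0 (hab ▸ dvd_mul_right a b)
  have hb := coeff_zero_ne_zero_of_dvd h0 (hab ▸ dvd_mul_left b a)
  have h := congrArg dual hab
  rw [dual_dual hf hm, dual_mul] at h
  exact (hi.isUnit_or_isUnit h).imp (hunit a ha) (hunit b hb)

/-- The dual polynomial with respect to a field endomorphism `σ`, which is applied to the
coefficients. -/
noncomputable def sdual (σ : F →+* F) (f : F[X]) : F[X] := dual (f.map σ)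

@[simp] lemma sdual_id (f : F[X]) : sdual (RingHom.id F) f = dual f := by
  rw [sdual, Polynomial.map_id]

lemma map_dual (σ : F →+* F) (f : F[X]) : (dual f).map σ = dual (f.map σ) := by
  rw [dual, dual, Polynomial.map_mul, map_C, reverse, reverse, reflect_map,
    natDegree_map_eq_of_injective σ.injective, coeff_map, map_inv₀]

variable {σ : F →+* F}

lemma map_coeff_zero_ne_zero {f : F[X]} (hf : f.coeff 0 ≠ 0) : (f.map σ).coeff 0 ≠ 0 := by
  rw [coeff_map]
  exact (map_ne_zero σ).2 hf

lemma sdual_coeff_zero {f : F[X]} (hf : f.coeff 0 ≠ 0) : (sdual σ f).coeff 0 ≠ 0 :=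
  dual_coeff_zero (map_coeff_zero_ne_zero hf)

lemma sdual_pow (f : F[X]) (e : ℕ) : sdual σ (f ^ e) = sdual σ f ^ e := by
  rw [sdual, Polynomial.map_pow, dual_pow, sdual]

lemma map_map_of_involutive (hσ : ∀ x, σ (σ x) = x) (f : F[X]) : (f.map σ).map σ = f := by
  ext i
  simp [hσ]

lemma sdual_sdual (hσ : ∀ x, σ (σ x) = x) {f : F[X]} (hf : f.coeff 0 ≠ 0) (hm : f.Monic) :
    sdual σ (sdual σ f) = f := by
  rw [sdual, sdual, map_dual, map_map_of_involutive hσ, dual_dual hf hm]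

lemma irreducible_map_of_involutive (hσ : ∀ x, σ (σ x) = x) {f : F[X]} (hi : Irreducible f) :
    Irreducible (f.map σ) := by
  let E : F ≃+* F := RingEquiv.ofRingHom σ σ (RingHom.ext hσ) (RingHom.ext hσ)
  have h : f.map σ = mapEquiv E f := rfl
  rw [h, MulEquiv.irreducible_iff]
  exact hi

lemma IsMonicPrimePow.sdual (hσ : ∀ x, σ (σ x) = x) {p : F[X]} (hp : IsMonicPrimePow p)
    (h0 : p.coeff 0 ≠ 0) : IsMonicPrimePow (sdual σ p) := by
  obtain ⟨f, e, hf, hi, he, rfl⟩ := hp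
  have hf0 := coeff_zero_ne_zero_of_dvd h0 (dvd_pow_self f he.ne')
  exact ⟨FormIsometry.sdual σ f, e, monic_dual (map_coeff_zero_ne_zero hf0),
    irreducible_dual (map_coeff_zero_ne_zero hf0) (hf.map σ) (irreducible_map_of_involutive hσ hi),
    he, sdual_pow f e⟩

end DualPolynomials

/-! ### Duality of nullities -/

section Nullity

variable {F : Type u} [Field F] {V : Type*} [AddCommGroup V] [Module F V]

lemma nul_C_mul {φ : V →ₗ[F] V} {c : F} (hc : c ≠ 0) (g : F[X]) : nul φ (C c * g) = nul φ g := by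
  unfold nul
  rw [map_mul, aeval_C, Algebra.algebraMap_eq_smul_one, smul_mul_assoc, one_mul,
    LinearMap.ker_smul _ _ hc]

lemma aeval_reverse {A : Type*} [Ring A] [Algebra F A] (x : A) (g : F[X]) :
    aeval x g.reverse =
      ∑ i ∈ Finset.range (g.natDegree + 1), g.coeff i • x ^ (g.natDegree - i) := by
  rw [aeval_eq_sum_range' (Nat.lt_succ_of_le (reverse_natDegree_le g)),
    ← Finset.sum_range_reflect]
  refine Finset.sum_congr rfl fun i hi => ?_
  have hi : i ≤ g.natDegree := Nat.lt_succ_iff.1 (Finset.mem_range.1 hi)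
  have h1 : g.natDegree + 1 - 1 - i = g.natDegree - i := by omega
  rw [h1, coeff_reverse, revAt_le (Nat.sub_le _ _), Nat.sub_sub_self hi]

/-- If `y` is the inverse of `x`, then `g(y)` is, up to a power of `x`, the value of the reversed
polynomial at `x`. -/
lemma aeval_mul_pow_natDegree {A : Type*} [Ring A] [Algebra F A] {x y : A} (hxy : y * x = 1)
    (g : F[X]) : aeval y g * x ^ g.natDegree = aeval x g.reverse := by
  rw [aeval_reverse, aeval_eq_sum_range, Finset.sum_mul]
  refine Finset.sum_congr rfl fun i hi => ?_
  have hi : i ≤ g.natDegree := Nat.lt_succ_iff.1 (Finset.mem_range.1 hi)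
  have h1 : ∀ i, y ^ i * x ^ i = 1 := by
    intro i
    induction i with
    | zero => simp
    | succ i ih => rw [pow_succ, pow_succ', mul_assoc, ← mul_assoc y, hxy, one_mul, ih]
  rw [smul_mul_assoc]
  congr 1
  conv_lhs => rw [← Nat.add_sub_cancel' hi, pow_add, ← mul_assoc, h1 i, one_mul]

variable {σ : F →+* F}

/-- The adjoint of `g(φ)` with respect to a form preserved by `φ` is, up to a power of `φ`,
the value of the reversed polynomial at `φ`. -/
lemma form_aeval_pow {φ : V →ₗ[F] V} {β : V →ₗ[F] V →ₛₗ[σ] F}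
    (hσ : ∀ x, σ (σ x) = x) (hβ : ∀ u v, β (φ u) (φ v) = β u v) (g : F[X]) (u v : V) :
    β (aeval φ g u) ((φ ^ g.natDegree) v) = β u (aeval φ (g.map σ).reverse v) := by
  have hpow : ∀ i u v, β ((φ ^ i) u) ((φ ^ i) v) = β u v := by
    intro i
    induction i with
    | zero => simp
    | succ i ih => intro u v; rw [pow_succ', Module.End.mul_apply, Module.End.mul_apply, hβ, ih]
  rw [aeval_reverse, aeval_eq_sum_range, natDegree_map_eq_of_injective σ.injective]
  simp only [LinearMap.sum_apply, map_sum, LinearMap.smul_apply, map_smul, LinearMap.map_smulₛₗ,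
    coeff_map, hσ]
  refine Finset.sum_congr rfl fun i hi => ?_
  have hi : i ≤ g.natDegree := Nat.lt_succ_iff.1 (Finset.mem_range.1 hi)
  congr 1
  conv_lhs => rw [← Nat.add_sub_cancel' hi, pow_add, Module.End.mul_apply, hpow]

/-- The nullities of `g(φ)` and of `g*(φ)` agree for every monic `g` with non-zero constant term,
where `g*` is the dual polynomial. -/
def IsSelfDual (σ : F →+* F) (φ : V →ₗ[F] V) : Prop :=
  ∀ g : F[X], g.Monic → g.coeff 0 ≠ 0 → nul φ g = nul φ (sdual σ g)

/-- The nullities of an isometry are self-dual: `g(φ)` and the reversed polynomial at `φ` are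
adjoint up to an invertible factor, hence have the same rank. -/
lemma isSelfDual_of_form [FiniteDimensional F V] {φ : V →ₗ[F] V} (hφ : Function.Surjective φ)
    {β : V →ₗ[F] V →ₛₗ[σ] F} (hσ : ∀ x, σ (σ x) = x) (hβ : ∀ u v, β (φ u) (φ v) = β u v)
    (hnd : LinearMap.SeparatingLeft β) : IsSelfDual σ φ := by
  -- The kernel of `g(φ)` contains everything orthogonal to the range of the dual polynomial.
  have key : ∀ g : F[X], g.coeff 0 ≠ 0 → nul φ (sdual σ g) ≤ nul φ g := by
    intro g hg
    have hpow : Function.Surjective (φ ^ g.natDegree) := by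
      rw [Module.End.coe_pow]
      exact hφ.iterate _
    set R := LinearMap.range (aeval φ (g.map σ).reverse) with hR
    let b := Module.finBasis F R
    let θ : V →ₗ[F] (Fin (Module.finrank F R) → F) :=
      LinearMap.pi fun i => β.flip (b i : V)
    have hθ : ∀ u i, θ u i = β u (b i) := fun u i => rfl
    have hker : LinearMap.ker θ ≤ LinearMap.ker (aeval φ g) := by
      intro u hu
      rw [LinearMap.mem_ker] at hu ⊢
      refine hnd _ fun w => ?_
      obtain ⟨v, rfl⟩ := hpow w
      rw [form_aeval_pow hσ hβ]
      have hw : aeval φ (g.map σ).reverse v ∈ R := ⟨v, rfl⟩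
      have h2 := congrArg (Submodule.subtype R) (b.sum_repr ⟨_, hw⟩)
      simp only [map_sum, map_smul, Submodule.subtype_apply] at h2
      rw [← h2]
      simp only [map_sum, LinearMap.map_smulₛₗ]
      refine Finset.sum_eq_zero fun i _ => ?_
      rw [← hθ, hu, Pi.zero_apply, smul_zero]
    have h1 := Submodule.finrank_mono hker
    have h2 := LinearMap.finrank_range_add_finrank_ker θ
    have h3 := LinearMap.finrank_range_add_finrank_ker (aeval φ (g.map σ).reverse)
    have h4 := Submodule.finrank_le (LinearMap.range θ)
    rw [Module.finrank_fin_fun] at h4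
    have h5 : nul φ (sdual σ g) =
        Module.finrank F (LinearMap.ker (aeval φ (g.map σ).reverse)) :=
      nul_C_mul (inv_ne_zero (map_coeff_zero_ne_zero hg)) _
    rw [h5, nul]
    rw [← hR] at h3
    omega
  intro g hm hg
  refine le_antisymm ?_ (key g hg)
  have := key _ (sdual_coeff_zero (σ := σ) hg)
  rwa [sdual_sdual hσ hg hm] at this

/-- A root `0` is impossible for elementary divisors of an injective map. -/
lemma IsElementaryDivisors.coeff_zero_ne_zero {φ : V →ₗ[F] V} (hφ : Function.Injective φ)
    {s : Multiset F[X]} (hs : IsElementaryDivisors φ s) {p : F[X]} (hp : p ∈ s) :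
    p.coeff 0 ≠ 0 := by
  classical
  obtain ⟨f, e, hf, hi, he, rfl⟩ := hs.isMonicPrimePow hp
  intro h0
  have hX : f = X := by
    have : X ∣ f := by
      rw [X_dvd_iff]
      rw [coeff_zero_eq_eval_zero, eval_pow] at h0
      rw [coeff_zero_eq_eval_zero]
      exact pow_eq_zero_iff he.ne' |>.1 h0
    exact (eq_of_monic_of_associated monic_X hf (irreducible_X.associated_of_dvd hi this)).symm
  subst hX
  obtain ⟨e, rfl⟩ := Nat.exists_eq_succ_of_ne_zero he.ne'
  have hz : ∀ i, nul φ (X ^ i) = 0 := by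
    intro i
    have : Function.Injective (φ ^ i) := by
      rw [Module.End.coe_pow]
      exact hφ.iterate i
    rw [nul, map_pow, aeval_X, LinearMap.ker_eq_bot.2 this, finrank_bot]
  have h1 := hs.two_mul_nul hf hi isCoprime_one_left e
  simp only [mul_one, hz, natDegree_X] at h1
  have h2 := Multiset.count_pos.2 hp
  simp only [Nat.succ_eq_add_one] at h2
  omega

/-- Self-dual nullities have self-dual multiplicities, as the multiplicities are second differences
of nullities. -/
lemma IsSelfDual.count_sdual [DecidableEq F[X]] {φ : V →ₗ[F] V} (hφ : IsSelfDual σ φ)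
    (hσ : ∀ x, σ (σ x) = x) {s : Multiset F[X]} (hs : IsElementaryDivisors φ s) {p : F[X]}
    (hp : IsMonicPrimePow p) (h0 : p.coeff 0 ≠ 0) : s.count (sdual σ p) = s.count p := by
  obtain ⟨f, e, hf, hi, he, rfl⟩ := hp
  have hf0 := coeff_zero_ne_zero_of_dvd h0 (dvd_pow_self f he.ne')
  obtain ⟨e, rfl⟩ := Nat.exists_eq_succ_of_ne_zero he.ne'
  have hf0' := map_coeff_zero_ne_zero (σ := σ) hf0
  have h1 := hs.two_mul_nul hf hi isCoprime_one_left e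
  have h2 := hs.two_mul_nul (f := sdual σ f) (monic_dual hf0')
    (irreducible_dual hf0' (hf.map σ) (irreducible_map_of_involutive hσ hi)) isCoprime_one_left e
  have h3 : ∀ i, nul φ (sdual σ f ^ i) = nul φ (f ^ i) := by
    intro i
    rw [← sdual_pow]
    refine (hφ _ (hf.pow i) ?_).symm
    rw [coeff_zero_eq_eval_zero, eval_pow, ← coeff_zero_eq_eval_zero]
    exact pow_ne_zero _ hf0
  simp only [mul_one, h3] at h1 h2
  have h4 : (sdual σ f).natDegree = f.natDegree := by
    rw [sdual, natDegree_dual hf0', natDegree_map_eq_of_injective σ.injective]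
  rw [h4] at h2
  have h5 : (Multiset.count (sdual σ f ^ (e + 1)) s) = (Multiset.count (f ^ (e + 1)) s) := by
    refine Nat.eq_of_mul_eq_mul_left hi.natDegree_pos ?_
    convert! Nat.add_left_cancel (h2.symm.trans h1)
  rw [sdual_pow]
  exact h5

end Nullity

/-! ### Conjugacy of matrices -/

section Conjugacy

variable {F : Type u} [Field F] {n : ℕ}

lemma aeval_vecMulLinear (M : Matrix (Fin n) (Fin n) F) (g : F[X]) :
    aeval (Matrix.vecMulLinear M) g = Matrix.vecMulLinear (aeval M g) := by
  induction g using Polynomial.induction_on with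
  | C a =>
    ext v
    simp [aeval_C, Algebra.algebraMap_eq_smul_one]
  | add g h hg hh =>
    rw [map_add, hg, hh, map_add]
    ext
    simp
  | monomial k a h =>
    have h1 : aeval M (C a * X ^ (k + 1)) = aeval M (C a * X ^ k) * M := by
      rw [pow_succ, ← mul_assoc, map_mul (aeval M), aeval_X]
    rw [h1, pow_succ', mul_left_comm, map_mul, h, aeval_X]
    refine LinearMap.ext fun v => ?_
    rw [Module.End.mul_apply, Matrix.vecMulLinear_apply, Matrix.vecMulLinear_apply,
      Matrix.vecMulLinear_apply, Matrix.vecMul_vecMul]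

lemma rank_add_finrank_ker_vecMulLinear (M : Matrix (Fin n) (Fin n) F) :
    M.rank + Module.finrank F (LinearMap.ker (Matrix.vecMulLinear M)) = n := by
  have h := LinearMap.finrank_range_add_finrank_ker (Matrix.vecMulLinear M)
  rwa [_root_.range_vecMulLinear, ← Matrix.rank_eq_finrank_span_row, Module.finrank_fin_fun] at h

lemma nul_vecMulLinear (M : Matrix (Fin n) (Fin n) F) (g : F[X]) :
    nul (Matrix.vecMulLinear M) g + (aeval M g).rank = n := by
  rw [nul, aeval_vecMulLinear, add_comm, rank_add_finrank_ker_vecMulLinear]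

lemma matrix_ext_vecMul {M N : Matrix (Fin n) (Fin n) F}
    (h : ∀ v, Matrix.vecMul v M = Matrix.vecMul v N) : M = N := by
  ext i j
  simpa using congrFun (h (Pi.single i 1)) j

/-- Two invertible matrices are conjugate if corresponding polynomials in them have the same
nullities, as these determine the elementary divisors. -/
lemma isConj_of_nul_eq {X Y : GL (Fin n) F}
    (h : ∀ f : F[X], f.Monic → Irreducible f → ∀ e, nul (Matrix.vecMulLinear X.1) (f ^ e) =
      nul (Matrix.vecMulLinear Y.1) (f ^ e)) : IsConj X Y := by
  have hX := elementaryDivisors_spec (Matrix.vecMulLinear X.1)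
  have hY := elementaryDivisors_spec (Matrix.vecMulLinear Y.1)
  rw [← hX.eq_of_nul_eq hY h] at hY
  obtain ⟨E, hE⟩ := hX.exists_equiv hY
  let M := (LinearMap.toMatrix' (E : (Fin n → F) →ₗ[F] (Fin n → F))).transpose
  let N := (LinearMap.toMatrix' (E.symm : (Fin n → F) →ₗ[F] (Fin n → F))).transpose
  have hM : ∀ v, Matrix.vecMul v M = E v := fun v => by
    rw [Matrix.vecMul_transpose, LinearMap.toMatrix'_mulVec]
    rfl
  have hN : ∀ v, Matrix.vecMul v N = E.symm v := fun v => by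
    rw [Matrix.vecMul_transpose, LinearMap.toMatrix'_mulVec]
    rfl
  have hMN : M * N = 1 := by
    refine matrix_ext_vecMul fun v => ?_
    rw [← Matrix.vecMul_vecMul, hM, hN, E.symm_apply_apply, Matrix.vecMul_one]
  have hNM : N * M = 1 := by
    refine matrix_ext_vecMul fun v => ?_
    rw [← Matrix.vecMul_vecMul, hM, hN, E.apply_symm_apply, Matrix.vecMul_one]
  rw [isConj_iff]
  refine ⟨⟨N, M, hNM, hMN⟩, ?_⟩
  ext1
  change N * X.1 * M = Y.1
  refine matrix_ext_vecMul fun v => ?_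
  have := hE (E.symm v)
  rw [← Matrix.vecMul_vecMul, ← Matrix.vecMul_vecMul, hN, hM]
  rw [Matrix.vecMulLinear_apply, Matrix.vecMulLinear_apply, E.apply_symm_apply] at this
  exact this

lemma nul_eq_of_isConj {X Y : GL (Fin n) F} (h : IsConj X Y) (g : F[X]) :
    nul (Matrix.vecMulLinear X.1) g = nul (Matrix.vecMulLinear Y.1) g := by
  obtain ⟨c, rfl⟩ := isConj_iff.1 h
  let E : (Fin n → F) ≃ₗ[F] (Fin n → F) :=
    LinearEquiv.ofLinearMap (Matrix.vecMulLinear c⁻¹.1) (Matrix.vecMulLinear c.1)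
      (LinearMap.ext fun v => by simp) (LinearMap.ext fun v => by simp)
  refine nul_congr E (fun v => ?_) g
  change Matrix.vecMul (Matrix.vecMul v X.1) c⁻¹.1 =
    Matrix.vecMul (Matrix.vecMul v c⁻¹.1) (c * X * c⁻¹).1
  rw [Matrix.vecMul_vecMul, Matrix.vecMul_vecMul]
  congr 1
  rw [← Units.val_mul, ← Units.val_mul]
  congr 1
  group

lemma nul_inv (X : GL (Fin n) F) (g : F[X]) :
    nul (Matrix.vecMulLinear X⁻¹.1) g = nul (Matrix.vecMulLinear X.1) g.reverse := by
  have h1 := nul_vecMulLinear X⁻¹.1 g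
  have h2 := nul_vecMulLinear X.1 g.reverse
  rw [← aeval_mul_pow_natDegree (y := X⁻¹.1) X.inv_mul,
    Matrix.rank_mul_eq_left_of_isUnit_det] at h2
  · omega
  · rw [← Units.val_pow_eq_pow_val]
    exact Matrix.isUnits_det_units _

/-- Applying an involution of a finite field to the entries does not change the rank: it maps the
kernels bijectively onto each other, and over a finite field the size of a kernel determines its
dimension. -/
lemma rank_map_of_involutive [Finite F] {σ : F →+* F} (hσ : ∀ x, σ (σ x) = x)
    (M : Matrix (Fin n) (Fin n) F) : (M.map σ).rank = M.rank := by
  have hinv : ∀ v : Fin n → F, σ ∘ (σ ∘ v) = v := fun v => funext fun i => hσ _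
  have hmap : ∀ (M : Matrix (Fin n) (Fin n) F) (v : Fin n → F),
      Matrix.vecMul (σ ∘ v) (M.map σ) = σ ∘ Matrix.vecMul v M := by
    intro M v
    funext i
    exact (RingHom.map_vecMul σ M v i).symm
  have hMM : (M.map σ).map σ = M := by ext; simp [hσ]
  let e : LinearMap.ker (Matrix.vecMulLinear M) ≃ LinearMap.ker (Matrix.vecMulLinear (M.map σ)) :=
    { toFun := fun v => ⟨σ ∘ v.1, by
        have := v.2
        rw [LinearMap.mem_ker, Matrix.vecMulLinear_apply] at this ⊢
        rw [hmap, this]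
        ext; simp⟩
      invFun := fun v => ⟨σ ∘ v.1, by
        have := v.2
        rw [LinearMap.mem_ker, Matrix.vecMulLinear_apply] at this ⊢
        have h := hmap (M.map σ) v.1
        rw [hMM, this] at h
        rw [h]
        ext; simp⟩
      left_inv := fun v => Subtype.ext (hinv _)
      right_inv := fun v => Subtype.ext (hinv _) }
  have hcard := Nat.card_congr e
  rw [Module.natCard_eq_pow_finrank (K := F)
      (V := LinearMap.ker (Matrix.vecMulLinear M)), Module.natCard_eq_pow_finrank (K := F)
      (V := LinearMap.ker (Matrix.vecMulLinear (M.map σ)))] at hcard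
  have h3 := Nat.pow_right_injective (Nat.succ_le_of_lt (Finite.one_lt_card (α := F))) hcard
  have h1 := rank_add_finrank_ker_vecMulLinear M
  have h2 := rank_add_finrank_ker_vecMulLinear (M.map σ)
  omega

lemma nul_adj [Finite F] {σ : F →+* F} (hσ : ∀ x, σ (σ x) = x) (X : GL (Fin n) F) (g : F[X]) :
    nul (Matrix.vecMulLinear (adj σ X).1) g = nul (Matrix.vecMulLinear X.1) (g.map σ) := by
  have h1 := nul_vecMulLinear (adj σ X).1 g
  have h2 := nul_vecMulLinear X.1 (g.map σ)
  have h3 : aeval (adj σ X).1 g = ((aeval X.1 (g.map σ)).map σ).transpose := by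
    rw [aeval_eq_sum_range, aeval_eq_sum_range, natDegree_map_eq_of_injective σ.injective]
    have hs : ∀ (f : ℕ → Matrix (Fin n) (Fin n) F) (k : ℕ),
        ((∑ i ∈ Finset.range k, f i).map σ).transpose =
          ∑ i ∈ Finset.range k, ((f i).map σ).transpose := by
      intro f k
      induction k with
      | zero => simp
      | succ k ih =>
        rw [Finset.sum_range_succ, Finset.sum_range_succ, ← ih, Matrix.map_add _ (map_add σ),
          Matrix.transpose_add]
    rw [hs]
    refine Finset.sum_congr rfl fun i _ => ?_
    have hp : (adj σ X).1 ^ i = ((X.1 ^ i).map σ).transpose := by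
      change ((X.1).map σ).transpose ^ i = _
      rw [← Matrix.transpose_pow, ← RingHom.mapMatrix_apply, ← map_pow, RingHom.mapMatrix_apply]
    rw [hp]
    ext a b
    simp [hσ]
  rw [h3, Matrix.rank_transpose, rank_map_of_involutive hσ] at h1
  omega

lemma vecMulLinear_injective (X : GL (Fin n) F) : Function.Injective (Matrix.vecMulLinear X.1) := by
  refine Function.LeftInverse.injective (g := fun v => Matrix.vecMul v X⁻¹.1) fun v => ?_
  simp

lemma vecMulLinear_surjective (X : GL (Fin n) F) :
    Function.Surjective (Matrix.vecMulLinear X.1) :=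
  LinearMap.surjective_of_injective (vecMulLinear_injective X)

/-- Let the nullities at `Y` be those of the reversed, `σ`-twisted polynomials at `X`, as is the
case for `Y = X⁻¹` and `Y = (X*)⁻¹`. Conjugacy is decided by nullities, so that `X` and `Y` are
conjugate if and only if the nullities at `X` are invariant under duality; powers of the
indeterminate, which have no dual, have nullity zero. -/
lemma isConj_iff_isSelfDual_of_nul_eq {σ : F →+* F} {X Y : GL (Fin n) F}
    (hY : ∀ g : F[X], nul (Matrix.vecMulLinear Y.1) g =
      nul (Matrix.vecMulLinear X.1) (g.map σ).reverse) :
    IsConj X Y ↔ IsSelfDual σ (Matrix.vecMulLinear X.1) := by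
  have hrev : ∀ g : F[X], g.coeff 0 ≠ 0 → nul (Matrix.vecMulLinear X.1) (sdual σ g) =
      nul (Matrix.vecMulLinear X.1) (g.map σ).reverse := fun g hg =>
    nul_C_mul (inv_ne_zero (map_coeff_zero_ne_zero hg)) _
  constructor
  · intro h g _ hg
    rw [nul_eq_of_isConj h, hY, hrev g hg]
  · intro h
    refine isConj_of_nul_eq fun f hf hi e => ?_
    by_cases hf0 : (f ^ e).coeff 0 = 0
    · have hz : ∀ Z : GL (Fin n) F, nul (Matrix.vecMulLinear Z.1) (f ^ e) = 0 := by
        intro Z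
        have hX : f = Polynomial.X := by
          have : Polynomial.X ∣ f := by
            rw [X_dvd_iff]
            rw [coeff_zero_eq_eval_zero, eval_pow] at hf0
            rw [coeff_zero_eq_eval_zero]
            exact eq_zero_of_pow_eq_zero hf0
          exact (eq_of_monic_of_associated monic_X hf
            (irreducible_X.associated_of_dvd hi this)).symm
        have : Function.Injective (Matrix.vecMulLinear Z.1 ^ e) := by
          rw [Module.End.coe_pow]
          exact (vecMulLinear_injective Z).iterate e
        rw [nul, hX, map_pow, aeval_X, LinearMap.ker_eq_bot.2 this, finrank_bot]
      rw [hz, hz]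
    · rw [h _ (hf.pow e) hf0, hY, hrev _ hf0]

lemma isConj_inv_iff (X : GL (Fin n) F) :
    IsConj X X⁻¹ ↔ IsSelfDual (RingHom.id F) (Matrix.vecMulLinear X.1) :=
  isConj_iff_isSelfDual_of_nul_eq fun g => by rw [nul_inv, Polynomial.map_id]

lemma isConj_adj_inv_iff [Finite F] {σ : F →+* F} (hσ : ∀ x, σ (σ x) = x) (X : GL (Fin n) F) :
    IsConj X (adj σ X)⁻¹ ↔ IsSelfDual σ (Matrix.vecMulLinear X.1) :=
  isConj_iff_isSelfDual_of_nul_eq fun g => by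
    rw [nul_inv, nul_adj hσ, reverse, reverse, reflect_map,
      natDegree_map_eq_of_injective σ.injective]

end Conjugacy

end FormIsometry

namespace FormIsometry

universe u

/-! ### Isometries with prescribed elementary divisors -/

/-- Induction over the multisets that are invariant under an involution `D`, as multisets split
into pairs `{p, D p}` and, for the `p = D p` satisfying `C`, singletons. -/
lemma multiset_induction_of_involution {α : Type*} [DecidableEq α] (D : α → α) (P C : α → Prop)
    (G : Multiset α → Prop) (hD : ∀ p, P p → D (D p) = p)
    (h0 : G 0) (hadd : ∀ s t, G s → G t → G (s + t)) (hpair : ∀ p, P p → G {p, D p})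
    (hself : ∀ p, P p → D p = p → C p → G {p}) (s : Multiset α) (hs : ∀ p ∈ s, P p)
    (hcount : ∀ p, P p → s.count (D p) = s.count p)
    (heven : ∀ p, P p → D p = p → ¬ C p → Even (s.count p)) : G s := by
  induction hn : Multiset.card s using Nat.strong_induction_on generalizing s with
  | _ n ih =>
  rcases s.empty_or_exists_mem with rfl | ⟨p, hp⟩
  · exact h0
  have hPp := hs p hp
  by_cases hC : D p = p ∧ C p
  · obtain ⟨t, rfl⟩ := Multiset.exists_cons_of_mem hp
    rw [← Multiset.singleton_add]
    refine hadd _ _ (hself p hPp hC.1 hC.2) (ih _ ?_ t (fun q hq => hs q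
      (Multiset.mem_cons_of_mem hq)) (fun q hq => ?_) (fun q hq hq' hqC => ?_) rfl)
    · rw [← hn, Multiset.card_cons]; omega
    · have h := hcount q hq
      rw [Multiset.count_cons, Multiset.count_cons] at h
      have : D q = p ↔ q = p := by
        constructor
        · intro h; rw [← hD q hq, h, hC.1]
        · rintro rfl; exact hC.1
      simp only [this] at h
      omega
    · have h := heven q hq hq' hqC
      rwa [Multiset.count_cons_of_ne] at h
      rintro rfl
      exact hqC hC.2
  · obtain ⟨t, rfl⟩ : ∃ t, s = {p, D p} + t := by
      refine Multiset.le_iff_exists_add.1 (Multiset.le_iff_count.2 fun q => ?_)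
      rw [Multiset.insert_eq_cons, Multiset.count_cons, Multiset.count_singleton]
      have hpos := Multiset.count_pos.2 hp
      have h1 := hcount p hPp
      by_cases hDp : D p = p
      · have h2 : Even (s.count p) := heven p hPp hDp fun h => hC ⟨hDp, h⟩
        obtain ⟨k, hk⟩ := h2
        rw [hDp]
        split_ifs with h
        · rw [h]; omega
        · omega
      · split_ifs with h h'
        · exact absurd (h'.symm.trans h).symm hDp
        · rw [h]; omega
        · rw [‹q = p›]; omega
        · omega
    have hDD : ∀ q, P q → (D q = p ↔ q = D p) := fun q hq =>
      ⟨fun h => by rw [← h, hD q hq], fun h => by rw [h, hD p hPp]⟩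
    have hDD' : ∀ q, P q → (D q = D p ↔ q = p) := fun q hq =>
      ⟨fun h => by rw [← hD q hq, h, hD p hPp], fun h => by rw [h]⟩
    refine hadd _ _ (hpair p hPp) (ih _ ?_ t (fun q hq => hs q
      (Multiset.mem_add.2 (Or.inr hq))) (fun q hq => ?_) (fun q hq hq' hqC => ?_) rfl)
    · rw [← hn, Multiset.card_add, Multiset.card_pair]; omega
    · have h := hcount q hq
      simp only [Multiset.count_add, Multiset.insert_eq_cons, Multiset.count_cons,
        Multiset.count_singleton, hDD q hq, hDD' q hq] at h
      omega
    · have h := heven q hq hq' hqC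
      simp only [Multiset.count_add, Multiset.insert_eq_cons, Multiset.count_cons,
        Multiset.count_singleton] at h
      have h2 : (q = D p) ↔ (q = p) := by rw [← hDD q hq, hq']
      simp only [h2] at h
      by_cases h3 : q = p
      · simp only [h3, if_true] at h ⊢
        rw [Nat.even_iff] at h ⊢
        omega
      · simpa [h3] using h

section Forms

variable {F : Type u} [Field F]

/-! ### Sums of forms -/

section Sums

variable {σ : F →+* F} {V W : Type*} [AddCommGroup V] [Module F V] [AddCommGroup W] [Module F W]

/-- The orthogonal sum of two sesquilinear forms. -/
def formProd (β : V →ₗ[F] V →ₛₗ[σ] F) (γ : W →ₗ[F] W →ₛₗ[σ] F) :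
    (V × W) →ₗ[F] (V × W) →ₛₗ[σ] F :=
  LinearMap.mk₂'ₛₗ (RingHom.id F) σ (fun x y => β x.1 y.1 + γ x.2 y.2)
    (fun x y z => by simp only [Prod.fst_add, Prod.snd_add, map_add, LinearMap.add_apply]; ring)
    (fun c x y => by simp [mul_add])
    (fun x y z => by simp only [Prod.fst_add, Prod.snd_add, map_add]; ring)
    (fun c x y => by simp [mul_add])

@[simp] lemma formProd_apply (β : V →ₗ[F] V →ₛₗ[σ] F) (γ : W →ₗ[F] W →ₛₗ[σ] F) (x y : V × W) :
    formProd β γ x y = β x.1 y.1 + γ x.2 y.2 := rfl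

lemma formProd_nondegenerate {β : V →ₗ[F] V →ₛₗ[σ] F} {γ : W →ₗ[F] W →ₛₗ[σ] F}
    (hβ : LinearMap.Nondegenerate β) (hγ : LinearMap.Nondegenerate γ) :
    LinearMap.Nondegenerate (formProd β γ) := by
  constructor
  · intro x hx
    refine Prod.ext (hβ.1 _ fun y => ?_) (hγ.1 _ fun y => ?_)
    · simpa using hx (y, 0)
    · simpa using hx (0, y)
  · intro x hx
    refine Prod.ext (hβ.2 _ fun y => ?_) (hγ.2 _ fun y => ?_)
    · simpa using hx (y, 0)
    · simpa using hx (0, y)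

end Sums

/-- Some isometry of a non-degenerate hermitian form has the elementary divisors `s`. -/
def HermitianRealizes (σ : F →+* F) (s : Multiset F[X]) : Prop :=
  ∃ (V : Type u) (_ : AddCommGroup V) (_ : Module F V) (φ : V →ₗ[F] V)
    (β : V →ₗ[F] V →ₛₗ[σ] F), IsElementaryDivisors φ s ∧ LinearMap.Nondegenerate β ∧
      (∀ u v, β u v = σ (β v u)) ∧ ∀ u v, β (φ u) (φ v) = β u v

/-- Some isometry of a non-degenerate alternating form has the elementary divisors `s`. -/
def AlternatingRealizes (s : Multiset F[X]) : Prop :=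
  ∃ (V : Type u) (_ : AddCommGroup V) (_ : Module F V) (φ : V →ₗ[F] V)
    (β : V →ₗ[F] V →ₗ[F] F), IsElementaryDivisors φ s ∧ LinearMap.Nondegenerate β ∧
      (∀ v, β v v = 0) ∧ ∀ u v, β (φ u) (φ v) = β u v

/-- Some isometry of a non-singular quadratic form has the elementary divisors `s`. -/
def QuadraticRealizes (s : Multiset F[X]) : Prop :=
  ∃ (V : Type u) (_ : AddCommGroup V) (_ : Module F V) (φ : V →ₗ[F] V)
    (Q : QuadraticForm F V), IsElementaryDivisors φ s ∧ LinearMap.Nondegenerate Q.polarBilin ∧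
      ∀ v, Q (φ v) = Q v

lemma HermitianRealizes.zero (σ : F →+* F) : HermitianRealizes σ 0 :=
  ⟨PUnit, inferInstance, inferInstance, 0, 0, .zero,
    ⟨fun _ _ => Subsingleton.elim _ _, fun _ _ => Subsingleton.elim _ _⟩, by simp, by simp⟩

lemma HermitianRealizes.add {σ : F →+* F} {s t : Multiset F[X]} (hs : HermitianRealizes σ s)
    (ht : HermitianRealizes σ t) : HermitianRealizes σ (s + t) := by
  obtain ⟨V, _, _, φ, β, h1, h2, h3, h4⟩ := hs
  obtain ⟨W, _, _, ψ, γ, k1, k2, k3, k4⟩ := ht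
  refine ⟨V × W, inferInstance, inferInstance, φ.prodMap ψ, formProd β γ, h1.add k1,
    formProd_nondegenerate h2 k2, fun u v => ?_, fun u v => ?_⟩
  · rw [formProd_apply, formProd_apply, h3, k3, map_add]
  · simp [h4, k4]

lemma AlternatingRealizes.zero : AlternatingRealizes (0 : Multiset F[X]) :=
  ⟨PUnit, inferInstance, inferInstance, 0, 0, .zero,
    ⟨fun _ _ => Subsingleton.elim _ _, fun _ _ => Subsingleton.elim _ _⟩, by simp, by simp⟩

lemma AlternatingRealizes.add {s t : Multiset F[X]} (hs : AlternatingRealizes s)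
    (ht : AlternatingRealizes t) : AlternatingRealizes (s + t) := by
  obtain ⟨V, _, _, φ, β, h1, h2, h3, h4⟩ := hs
  obtain ⟨W, _, _, ψ, γ, k1, k2, k3, k4⟩ := ht
  refine ⟨V × W, inferInstance, inferInstance, φ.prodMap ψ, formProd β γ, h1.add k1,
    formProd_nondegenerate h2 k2, fun v => ?_, fun u v => ?_⟩
  · rw [formProd_apply, h3, k3, add_zero]
  · simp [h4, k4]

lemma nondegenerate_polarBilin_prod {V W : Type*} [AddCommGroup V] [Module F V] [AddCommGroup W]
    [Module F W] {Q : QuadraticForm F V} {R : QuadraticForm F W}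
    (hQ : LinearMap.Nondegenerate Q.polarBilin) (hR : LinearMap.Nondegenerate R.polarBilin) :
    LinearMap.Nondegenerate (QuadraticMap.polarBilin (Q.prod R)) := by
  have h : QuadraticMap.polarBilin (Q.prod R) = formProd Q.polarBilin R.polarBilin := by
    ext <;> simp
  rw [h]
  exact formProd_nondegenerate hQ hR

lemma QuadraticRealizes.zero : QuadraticRealizes (0 : Multiset F[X]) :=
  ⟨PUnit, inferInstance, inferInstance, 0, 0, .zero,
    ⟨fun _ _ => Subsingleton.elim _ _, fun _ _ => Subsingleton.elim _ _⟩, by simp⟩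

lemma QuadraticRealizes.add {s t : Multiset F[X]} (hs : QuadraticRealizes s)
    (ht : QuadraticRealizes t) : QuadraticRealizes (s + t) := by
  obtain ⟨V, _, _, φ, Q, h1, h2, h3⟩ := hs
  obtain ⟨W, _, _, ψ, R, k1, k2, k3⟩ := ht
  refine ⟨V × W, inferInstance, inferInstance, φ.prodMap ψ, Q.prod R, h1.add k1,
    nondegenerate_polarBilin_prod h2 k2, fun v => ?_⟩
  simp [h3, k3]

lemma nondegenerate_polarBilin_iff {V : Type*} [AddCommGroup V] [Module F V]
    {Q : QuadraticForm F V} : LinearMap.Nondegenerate Q.polarBilin ↔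
      ∀ v, (∀ w, QuadraticMap.polar Q v w = 0) → v = 0 := by
  constructor
  · intro h v hv
    exact h.1 v hv
  · intro h
    refine ⟨fun v hv => h v hv, fun v hv => h v fun w => ?_⟩
    rw [QuadraticMap.polar_comm]
    exact hv w

/-- In characteristic two the polar form of a quadratic form is alternating. -/
lemma QuadraticRealizes.alternatingRealizes [CharP F 2] {s : Multiset F[X]}
    (hs : QuadraticRealizes s) : AlternatingRealizes s := by
  obtain ⟨V, _, _, φ, Q, h1, h2, h3⟩ := hs
  refine ⟨V, inferInstance, inferInstance, φ, Q.polarBilin, h1, h2, fun v => ?_, fun u v => ?_⟩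
  · rw [QuadraticMap.polarBilin_apply_apply, QuadraticMap.polar_self, two_smul,
      CharTwo.add_self_eq_zero]
  · simp only [QuadraticMap.polarBilin_apply_apply, QuadraticMap.polar]
    rw [← map_add, h3, h3, h3]

/-! ### Inversion on `F[X] / (p)` -/

section Inversion

variable {σ : F →+* F}

lemma exists_root_mul_eq_one {p : F[X]} (hp : p.coeff 0 ≠ 0) :
    ∃ u : AdjoinRoot p, AdjoinRoot.root p * u = 1 := by
  have h : IsCoprime X p := (irreducible_X.coprime_iff_not_dvd).2 fun h => hp (X_dvd_iff.1 h)
  obtain ⟨a, b, hab⟩ := h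
  refine ⟨AdjoinRoot.mk p a, ?_⟩
  rw [← AdjoinRoot.mk_X, ← map_mul, ← map_one (AdjoinRoot.mk p), AdjoinRoot.mk_eq_mk]
  exact ⟨-b, by linear_combination hab⟩

/-- The `σ`-semilinear ring homomorphism that inverts the class of `X`. -/
lemma exists_inversion (hσ : ∀ x, σ (σ x) = x) {p : F[X]} (hp : p.coeff 0 ≠ 0) :
    ∃ ι : AdjoinRoot (sdual σ p) →+* AdjoinRoot p,
      (∀ c, ι (AdjoinRoot.of _ c) = AdjoinRoot.of _ (σ c)) ∧
      AdjoinRoot.root p * ι (AdjoinRoot.root (sdual σ p)) = 1 := by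
  obtain ⟨u, hu⟩ := exists_root_mul_eq_one hp
  have hrev : ((p.map σ).reverse).map σ = p.reverse := by
    rw [reverse, reverse, reflect_map, natDegree_map_eq_of_injective σ.injective,
      map_map_of_involutive hσ]
  have h0 : aeval u p.reverse = 0 := by
    have h := aeval_mul_pow_natDegree (F := F) ((mul_comm _ _).trans hu) p.reverse
    rw [reverse_reverse hp, AdjoinRoot.aeval_eq, AdjoinRoot.mk_self] at h
    have h2 := congrArg (· * u ^ p.reverse.natDegree) h
    simpa only [mul_assoc, ← mul_pow, hu, one_pow, mul_one, zero_mul] using h2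
  refine ⟨AdjoinRoot.lift ((AdjoinRoot.of p).comp σ) u ?_, fun c => ?_, ?_⟩
  · rw [← eval₂_map, sdual, dual, Polynomial.map_mul, hrev, eval₂_mul]
    have h1 : eval₂ (AdjoinRoot.of p) u p.reverse = 0 := h0
    rw [h1, mul_zero]
  · rw [AdjoinRoot.lift_of]; rfl
  · rw [AdjoinRoot.lift_root, hu]

lemma inversion_comp {p q : F[X]} (hσ : ∀ x, σ (σ x) = x)
    {ι : AdjoinRoot q →+* AdjoinRoot p} {ι' : AdjoinRoot p →+* AdjoinRoot q}
    (h1 : ∀ c, ι (AdjoinRoot.of _ c) = AdjoinRoot.of _ (σ c))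
    (h2 : AdjoinRoot.root p * ι (AdjoinRoot.root q) = 1)
    (h1' : ∀ c, ι' (AdjoinRoot.of _ c) = AdjoinRoot.of _ (σ c))
    (h2' : AdjoinRoot.root q * ι' (AdjoinRoot.root p) = 1) (a : AdjoinRoot q) :
    ι' (ι a) = a := by
  have h : ι'.comp ι = RingHom.id _ := by
    refine AdjoinRoot.ringHom_ext (RingHom.ext fun c => ?_) ?_
    · simp [h1, h1', hσ]
    · have h3 := congrArg ι' h2
      rw [map_mul, map_one] at h3
      rw [RingHom.comp_apply, RingHom.id_apply]
      calc ι' (ι (AdjoinRoot.root q))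
          = (AdjoinRoot.root q * ι' (AdjoinRoot.root p)) * ι' (ι (AdjoinRoot.root q)) := by
            rw [h2', one_mul]
        _ = AdjoinRoot.root q := by rw [mul_assoc, h3, mul_one]
  exact RingHom.congr_fun h a

lemma inversion_smul {p q : F[X]} {ι : AdjoinRoot q →+* AdjoinRoot p}
    (h1 : ∀ c, ι (AdjoinRoot.of _ c) = AdjoinRoot.of _ (σ c)) (c : F) (a : AdjoinRoot q) :
    ι (c • a) = σ c • ι a := by
  rw [Algebra.smul_def, Algebra.smul_def, map_mul]
  exact congrArg (· * ι a) (h1 c)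

/-- For a self-dual polynomial the inversion is an involution of `F[X] / (p)`. -/
lemma exists_involution (hσ : ∀ x, σ (σ x) = x) {p : F[X]} (hp : p.coeff 0 ≠ 0)
    (hd : sdual σ p = p) :
    ∃ ι : AdjoinRoot p →+* AdjoinRoot p,
      (∀ c a, ι (c • a) = σ c • ι a) ∧ AdjoinRoot.root p * ι (AdjoinRoot.root p) = 1 ∧
      ∀ a, ι (ι a) = a := by
  have h := exists_inversion hσ hp
  rw [hd] at h
  obtain ⟨ι, h1, h2⟩ := h
  exact ⟨ι, inversion_smul h1, h2, inversion_comp hσ h1 h2 h1 h2⟩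

/-- The sesquilinear pairing `T (a * ι b)`. -/
noncomputable def pairing {p q : F[X]} (T : AdjoinRoot p →ₗ[F] F)
    (ι : AdjoinRoot q →+* AdjoinRoot p) (hι : ∀ c a, ι (c • a) = σ c • ι a) :
    AdjoinRoot p →ₗ[F] AdjoinRoot q →ₛₗ[σ] F :=
  LinearMap.mk₂'ₛₗ (RingHom.id F) σ (fun a b => T (a * ι b))
    (fun a b c => by rw [add_mul, map_add])
    (fun c a b => by rw [smul_mul_assoc, map_smul]; rfl)
    (fun a b c => by rw [map_add, mul_add, map_add])
    (fun c a b => by rw [hι, mul_smul_comm, map_smul])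

@[simp] lemma pairing_apply {p q : F[X]} (T : AdjoinRoot p →ₗ[F] F)
    (ι : AdjoinRoot q →+* AdjoinRoot p) (hι : ∀ c a, ι (c • a) = σ c • ι a)
    (a : AdjoinRoot p) (b : AdjoinRoot q) : pairing T ι hι a b = T (a * ι b) := rfl

/-- Multiplication by the class of `X` preserves `a * ι b`. -/
lemma root_mul_mul_inversion {p q : F[X]} {ι : AdjoinRoot q →+* AdjoinRoot p}
    (h2 : AdjoinRoot.root p * ι (AdjoinRoot.root q) = 1) (a : AdjoinRoot p) (b : AdjoinRoot q) :
    (AdjoinRoot.root p * a) * ι (AdjoinRoot.root q * b) = a * ι b := by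
  rw [map_mul]
  linear_combination (a * ι b) * h2

/-- A functional that does not vanish on the minimal ideal of `F[X] / (f ^ e)` defines a
non-degenerate pairing. -/
lemma exists_mul_ne_zero_of_socle {f : F[X]} (hf : Irreducible f) {e : ℕ} (he : 0 < e)
    {T : AdjoinRoot (f ^ e) →ₗ[F] F} {r : AdjoinRoot (f ^ e)}
    (hT : T (AdjoinRoot.mk _ (f ^ (e - 1)) * r) ≠ 0) {a : AdjoinRoot (f ^ e)} (ha : a ≠ 0) :
    ∃ b, T (a * b) ≠ 0 := by
  obtain ⟨g, rfl⟩ := AdjoinRoot.mk_surjective a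
  have hg : ¬ f ^ (e - 1 + 1) ∣ g := by
    rw [Nat.sub_add_cancel he]
    exact fun h => ha (AdjoinRoot.mk_eq_zero.2 h)
  obtain ⟨b, hb⟩ := exists_mul_eq_mk_pow (e := e) hf hg
  exact ⟨b * r, by rwa [← mul_assoc, hb]⟩

lemma socle_ne_zero {f : F[X]} (hf : Irreducible f) {e : ℕ} (he : 0 < e) :
    AdjoinRoot.mk (f ^ e) (f ^ (e - 1)) ≠ 0 := by
  rw [Ne, AdjoinRoot.mk_eq_zero, pow_dvd_pow_iff hf.ne_zero hf.not_isUnit]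
  omega

lemma exists_functional_ne_zero {V : Type*} [AddCommGroup V] [Module F V] {v : V} (hv : v ≠ 0) :
    ∃ T : V →ₗ[F] F, T v ≠ 0 := by
  by_contra! h
  exact hv ((Module.forall_dual_apply_eq_zero_iff F v).1 h)

end Inversion

/-! ### Hyperbolic pairs -/

section Hyperbolic

variable {σ : F →+* F}

/-- The space `F[X] / (p)` is dual to `F[X] / (p*)`, compatibly with the multiplication by `X`. -/
lemma exists_pairing (hσ : ∀ x, σ (σ x) = x) {p : F[X]} (hp : IsMonicPrimePow p)
    (h0 : p.coeff 0 ≠ 0) :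
    ∃ P : AdjoinRoot p →ₗ[F] AdjoinRoot (sdual σ p) →ₛₗ[σ] F,
      (∀ a b, P (rootMul _ a) (rootMul _ b) = P a b) ∧
      (∀ a, (∀ b, P a b = 0) → a = 0) ∧ (∀ b, (∀ a, P a b = 0) → b = 0) := by
  obtain ⟨ι, h1, h2⟩ := exists_inversion hσ h0
  have h := exists_inversion hσ (sdual_coeff_zero (σ := σ) h0)
  rw [sdual_sdual hσ h0 hp.monic] at h
  obtain ⟨ι', h1', h2'⟩ := h
  have hc := inversion_comp hσ h1 h2 h1' h2'
  have hc' := inversion_comp hσ h1' h2' h1 h2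
  obtain ⟨f, e, hf, hi, he, rfl⟩ := hp
  obtain ⟨T, hT⟩ := exists_functional_ne_zero (F := F) (socle_ne_zero hi he)
  rw [← mul_one (AdjoinRoot.mk (f ^ e) _)] at hT
  refine ⟨pairing T ι (inversion_smul h1), fun a b => ?_, fun a ha => ?_, fun b hb => ?_⟩
  · rw [pairing_apply, rootMul_apply, rootMul_apply, root_mul_mul_inversion h2, pairing_apply]
  · by_contra hne
    obtain ⟨b, hb⟩ := exists_mul_ne_zero_of_socle hi he hT hne
    apply hb
    rw [← hc' b]
    exact ha (ι' b)
  · by_contra hne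
    have hne' : ι b ≠ 0 := fun h => hne (by rw [← hc b, h, map_zero])
    obtain ⟨a, ha⟩ := exists_mul_ne_zero_of_socle hi he hT hne'
    apply ha
    rw [mul_comm]
    exact hb a

lemma isElementaryDivisors_pair (hσ : ∀ x, σ (σ x) = x) {p : F[X]} (hp : IsMonicPrimePow p)
    (h0 : p.coeff 0 ≠ 0) : IsElementaryDivisors
      ((rootMul p).prodMap (rootMul (sdual σ p))) {p, sdual σ p} :=
  (isElementaryDivisors_rootMul hp).add (isElementaryDivisors_rootMul (hp.sdual hσ h0))

/-- The hermitian form on `F[X] / (p) × F[X] / (p*)` defined by the duality of the two factors. -/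
lemma hermitianRealizes_pair (hσ : ∀ x, σ (σ x) = x) {p : F[X]} (hp : IsMonicPrimePow p)
    (h0 : p.coeff 0 ≠ 0) : HermitianRealizes σ {p, sdual σ p} := by
  obtain ⟨P, hP, hl, hr⟩ := exists_pairing hσ hp h0
  let β : (AdjoinRoot p × AdjoinRoot (sdual σ p)) →ₗ[F]
      (AdjoinRoot p × AdjoinRoot (sdual σ p)) →ₛₗ[σ] F :=
    LinearMap.mk₂'ₛₗ (RingHom.id F) σ (fun x y => P x.1 y.2 + σ (P y.1 x.2))
      (fun x y z => by simp only [Prod.fst_add, Prod.snd_add, map_add, LinearMap.add_apply]; ring)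
      (fun c x y => by simp [mul_add, hσ])
      (fun x y z => by simp only [Prod.fst_add, Prod.snd_add, map_add, LinearMap.add_apply]; ring)
      (fun c x y => by simp [mul_add])
  have hβ : ∀ x y, β x y = P x.1 y.2 + σ (P y.1 x.2) := fun _ _ => rfl
  have hherm : ∀ x y, β x y = σ (β y x) := fun x y => by
    rw [hβ, hβ, map_add, hσ, add_comm]
  have hleft : ∀ x, (∀ y, β x y = 0) → x = 0 := by
    intro x hx
    refine Prod.ext (hl _ fun b => ?_) (hr _ fun a => ?_)
    · simpa [hβ] using hx (0, b)
    · simpa [hβ] using hx (a, 0)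
  refine ⟨_, inferInstance, inferInstance, _, β, isElementaryDivisors_pair hσ hp h0,
    ⟨hleft, fun y hy => hleft y fun x => ?_⟩, hherm, fun u v => ?_⟩
  · rw [hherm, hy, map_zero]
  · simp only [hβ, LinearMap.prodMap_apply, hP]

/-- The alternating form on `F[X] / (p) × F[X] / (p*)` defined by the duality of the two factors. -/
lemma alternatingRealizes_pair {p : F[X]} (hp : IsMonicPrimePow p)
    (h0 : p.coeff 0 ≠ 0) : AlternatingRealizes {p, dual p} := by
  obtain ⟨P, hP, hl, hr⟩ := exists_pairing (σ := RingHom.id F) (fun _ => rfl) hp h0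
  let β : (AdjoinRoot p × AdjoinRoot (sdual (RingHom.id F) p)) →ₗ[F]
      (AdjoinRoot p × AdjoinRoot (sdual (RingHom.id F) p)) →ₗ[F] F :=
    LinearMap.mk₂ F (fun x y => P x.1 y.2 - P y.1 x.2)
      (fun x y z => by simp only [Prod.fst_add, Prod.snd_add, map_add, LinearMap.add_apply]; ring)
      (fun c x y => by simp [mul_sub])
      (fun x y z => by simp only [Prod.fst_add, Prod.snd_add, map_add, LinearMap.add_apply]; ring)
      (fun c x y => by simp [mul_sub])
  have hβ : ∀ x y, β x y = P x.1 y.2 - P y.1 x.2 := fun _ _ => rfl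
  have hleft : ∀ x, (∀ y, β x y = 0) → x = 0 := by
    intro x hx
    refine Prod.ext (hl _ fun b => ?_) (hr _ fun a => ?_)
    · simpa [hβ] using hx (0, b)
    · simpa [hβ] using hx (a, 0)
  have hdiv := isElementaryDivisors_pair (σ := RingHom.id F) (fun _ => rfl) hp h0
  rw [← sdual_id]
  refine ⟨_, inferInstance, inferInstance, _, β, hdiv,
    ⟨hleft, fun y hy => hleft y fun x => ?_⟩, fun v => ?_, fun u v => ?_⟩
  · have := hy x
    rw [hβ] at this ⊢
    rw [← neg_sub, this, neg_zero]
  · rw [hβ, sub_self]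
  · simp only [hβ, LinearMap.prodMap_apply, hP]

/-- The hyperbolic quadratic form on `F[X] / (p) × F[X] / (p*)` defined by the duality of the two
factors. -/
lemma quadraticRealizes_pair {p : F[X]} (hp : IsMonicPrimePow p)
    (h0 : p.coeff 0 ≠ 0) : QuadraticRealizes {p, dual p} := by
  obtain ⟨P, hP, hl, hr⟩ := exists_pairing (σ := RingHom.id F) (fun _ => rfl) hp h0
  let β : (AdjoinRoot p × AdjoinRoot (sdual (RingHom.id F) p)) →ₗ[F]
      (AdjoinRoot p × AdjoinRoot (sdual (RingHom.id F) p)) →ₗ[F] F :=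
    LinearMap.mk₂ F (fun x y => P x.1 y.2)
      (fun x y z => by simp)
      (fun c x y => by simp)
      (fun x y z => by simp)
      (fun c x y => by simp)
  have hβ : ∀ x y, β x y = P x.1 y.2 := fun _ _ => rfl
  have hdiv := isElementaryDivisors_pair (σ := RingHom.id F) (fun _ => rfl) hp h0
  rw [← sdual_id]
  refine ⟨_, inferInstance, inferInstance, _, LinearMap.BilinMap.toQuadraticMap β, hdiv,
    nondegenerate_polarBilin_iff.2 fun x hx => ?_, fun v => ?_⟩
  · simp only [LinearMap.BilinMap.polar_toQuadraticMap, hβ] at hx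
    refine Prod.ext (hl _ fun b => ?_) (hr _ fun a => ?_)
    · simpa [hβ] using hx (0, b)
    · simpa [hβ] using hx (a, 0)
  · simp only [LinearMap.BilinMap.toQuadraticMap_apply, hβ, LinearMap.prodMap_apply, hP]

end Hyperbolic

/-! ### Cyclic isometries -/

section Cyclic

variable {σ : F →+* F}

/-- If `σ` is not the identity, every self-dual elementary divisor belongs to an isometry of a
hermitian form on `F[X] / (p)`. -/
lemma hermitianRealizes_singleton (hσ : ∀ x, σ (σ x) = x) (hne : ∃ x, σ x ≠ x) {p : F[X]}
    (hp : IsMonicPrimePow p) (h0 : p.coeff 0 ≠ 0) (hd : sdual σ p = p) :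
    HermitianRealizes σ {p} := by
  obtain ⟨ι, h1, h2, h3⟩ := exists_involution hσ h0 hd
  have hdiv := isElementaryDivisors_rootMul hp
  obtain ⟨f, e, hf, hi, he, rfl⟩ := hp
  obtain ⟨S, hS⟩ := exists_functional_ne_zero (F := F) (socle_ne_zero hi he)
  set z := AdjoinRoot.mk (f ^ e) (f ^ (e - 1)) with hz
  let T : F → AdjoinRoot (f ^ e) →ₗ[F] F := fun c =>
    { toFun := fun a => c * S a + σ (c * S (ι a))
      map_add' := fun a b => by simp only [map_add, mul_add]; ring
      map_smul' := fun d a => by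
        simp only [h1, map_smul, smul_eq_mul, map_mul, hσ, RingHom.id_apply]; ring }
  have hT : ∀ c a, T c a = c * S a + σ (c * S (ι a)) := fun _ _ => rfl
  -- If all `T c` vanished at `z`, then so would `(x - σ x) * S z`.
  obtain ⟨c, hc⟩ : ∃ c, T c z ≠ 0 := by
    by_contra! h
    obtain ⟨x, hx⟩ := hne
    have e1 := h 1
    have e2 := h x
    rw [hT, one_mul, one_mul] at e1
    rw [hT, map_mul] at e2
    have : (x - σ x) * S z = 0 := by linear_combination e2 - σ x * e1
    rcases mul_eq_zero.1 this with h | h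
    · exact hx (sub_eq_zero.1 h).symm
    · exact hS h
  have hTι : ∀ a, σ (T c a) = T c (ι a) := fun a => by
    rw [hT, hT, h3, map_add, hσ, add_comm]
  rw [← mul_one z] at hc
  have hherm : ∀ a b, pairing (T c) ι h1 a b = σ (pairing (T c) ι h1 b a) := fun a b => by
    rw [pairing_apply, pairing_apply, hTι, map_mul ι, h3, mul_comm]
  have hleft : ∀ a, (∀ b, pairing (T c) ι h1 a b = 0) → a = 0 := by
    intro a ha
    by_contra hne
    obtain ⟨b, hb⟩ := exists_mul_ne_zero_of_socle hi he hc hne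
    apply hb
    rw [← h3 b]
    exact ha (ι b)
  refine ⟨_, inferInstance, inferInstance, _, pairing (T c) ι h1, hdiv,
    ⟨hleft, fun b hb => hleft b fun a => by rw [hherm, hb, map_zero]⟩, hherm, fun a b => ?_⟩
  rw [rootMul_apply, rootMul_apply, pairing_apply, root_mul_mul_inversion h2, pairing_apply]

/-- An involution that moves some element of the minimal ideal of `F[X] / (p)` provides an
alternating form. -/
lemma alternatingRealizes_singleton_of_ne {f : F[X]} {e : ℕ} (hf : f.Monic) (hi : Irreducible f)
    (he : 0 < e) {ι : AdjoinRoot (f ^ e) →+* AdjoinRoot (f ^ e)}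
    (h1 : ∀ (c : F) a, ι (c • a) = RingHom.id F c • ι a)
    (h2 : AdjoinRoot.root (f ^ e) * ι (AdjoinRoot.root (f ^ e)) = 1) (h3 : ∀ a, ι (ι a) = a)
    {r : AdjoinRoot (f ^ e)} (hr : ι (AdjoinRoot.mk _ (f ^ (e - 1)) * r) ≠
      AdjoinRoot.mk _ (f ^ (e - 1)) * r) : AlternatingRealizes {f ^ e} := by
  have hdiv := isElementaryDivisors_rootMul ⟨f, e, hf, hi, he, rfl⟩
  obtain ⟨S, hS⟩ := exists_functional_ne_zero (F := F) (sub_ne_zero.2 hr.symm)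
  let T : AdjoinRoot (f ^ e) →ₗ[F] F :=
    { toFun := fun a => S (a - ι a)
      map_add' := fun a b => by simp only [map_add, map_sub]; ring
      map_smul' := fun d a => by
        simp only [h1, map_smul, map_sub, smul_eq_mul, RingHom.id_apply]; ring }
  have hT : ∀ a, T a = S (a - ι a) := fun _ => rfl
  rw [← hT] at hS
  have hskew : ∀ a b, pairing T ι h1 a b = - pairing T ι h1 b a := fun a b => by
    rw [pairing_apply, pairing_apply, hT, hT, map_mul, map_mul, h3, h3, ← map_neg]
    congr 1
    ring
  have hleft : ∀ a, (∀ b, pairing T ι h1 a b = 0) → a = 0 := by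
    intro a ha
    by_contra hne
    obtain ⟨b, hb⟩ := exists_mul_ne_zero_of_socle hi he hS hne
    apply hb
    rw [← h3 b]
    exact ha (ι b)
  refine ⟨_, inferInstance, inferInstance, _, pairing T ι h1, hdiv,
    ⟨hleft, fun b hb => hleft b fun a => by rw [hskew, hb, neg_zero]⟩, fun a => ?_, fun a b => ?_⟩
  · rw [pairing_apply, hT, map_mul, h3, mul_comm, sub_self, map_zero]
  · rw [rootMul_apply, rootMul_apply, pairing_apply, root_mul_mul_inversion h2, pairing_apply]

/-- The quadratic form `S (a * ι a)`. -/
noncomputable def normForm {p : F[X]} (S : AdjoinRoot p →ₗ[F] F) (ι : AdjoinRoot p →+* AdjoinRoot p)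
    (h1 : ∀ (c : F) a, ι (c • a) = RingHom.id F c • ι a) : QuadraticForm F (AdjoinRoot p) :=
  LinearMap.BilinMap.toQuadraticMap (pairing S ι h1)

lemma normForm_apply {p : F[X]} (S : AdjoinRoot p →ₗ[F] F) (ι : AdjoinRoot p →+* AdjoinRoot p)
    (h1 : ∀ (c : F) a, ι (c • a) = RingHom.id F c • ι a) (a : AdjoinRoot p) :
    normForm S ι h1 a = S (a * ι a) := rfl

lemma polar_normForm {p : F[X]} (S : AdjoinRoot p →ₗ[F] F) (ι : AdjoinRoot p →+* AdjoinRoot p)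
    (h1 : ∀ (c : F) a, ι (c • a) = RingHom.id F c • ι a) (h3 : ∀ a, ι (ι a) = a)
    (a b : AdjoinRoot p) :
    QuadraticMap.polar (normForm S ι h1) a b = S (a * ι b + ι (a * ι b)) := by
  rw [normForm, LinearMap.BilinMap.polar_toQuadraticMap, pairing_apply, pairing_apply, map_mul ι,
    h3, map_add, mul_comm b]

/-- An involution that does not negate the minimal ideal of `F[X] / (p)` provides a non-singular
quadratic form. -/
lemma quadraticRealizes_singleton_of_ne {f : F[X]} {e : ℕ} (hf : f.Monic) (hi : Irreducible f)
    (he : 0 < e) {ι : AdjoinRoot (f ^ e) →+* AdjoinRoot (f ^ e)}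
    (h1 : ∀ (c : F) a, ι (c • a) = RingHom.id F c • ι a)
    (h2 : AdjoinRoot.root (f ^ e) * ι (AdjoinRoot.root (f ^ e)) = 1) (h3 : ∀ a, ι (ι a) = a)
    {r : AdjoinRoot (f ^ e)} (hr : AdjoinRoot.mk _ (f ^ (e - 1)) * r +
      ι (AdjoinRoot.mk _ (f ^ (e - 1)) * r) ≠ 0) : QuadraticRealizes {f ^ e} := by
  have hdiv := isElementaryDivisors_rootMul ⟨f, e, hf, hi, he, rfl⟩
  obtain ⟨S, hS⟩ := exists_functional_ne_zero (F := F) hr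
  let T : AdjoinRoot (f ^ e) →ₗ[F] F :=
    { toFun := fun a => S (a + ι a)
      map_add' := fun a b => by simp only [map_add]; ring
      map_smul' := fun d a => by
        simp only [h1, map_smul, map_add, smul_eq_mul, RingHom.id_apply]; ring }
  have hT : ∀ a, T a = S (a + ι a) := fun _ => rfl
  rw [← hT] at hS
  refine ⟨_, inferInstance, inferInstance, _, normForm S ι h1, hdiv,
    nondegenerate_polarBilin_iff.2 fun a ha => ?_, fun a => ?_⟩
  · by_contra hne
    obtain ⟨b, hb⟩ := exists_mul_ne_zero_of_socle hi he hS hne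
    apply hb
    have := ha (ι b)
    rwa [polar_normForm S ι h1 h3, h3, ← hT] at this
  · rw [normForm_apply, rootMul_apply, root_mul_mul_inversion h2, normForm_apply]

lemma not_dvd_X_sq_sub_one {f : F[X]} (hi : Irreducible f) (hdeg : 1 < f.natDegree) :
    ¬ f ∣ X ^ 2 - 1 := by
  have h2 : (X ^ 2 - 1 : F[X]) = (X - C 1) * (X - C (-1)) := by
    rw [C_neg, C_1]; ring
  have h3 : ∀ a : F, ¬ f ∣ X - C a := fun a hd => by
    have := natDegree_le_of_dvd hd (X_sub_C_ne_zero a)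
    rw [natDegree_X_sub_C] at this
    omega
  rw [h2]
  exact fun h => (hi.prime.dvd_or_dvd h).elim (h3 _) (h3 _)

/-- If `deg f > 1`, the inversion does not act as a scalar on the minimal ideal of
`F[X] / (f ^ e)`: on this ideal `X` and `X⁻¹` act differently, as `f` does not divide
`X ^ 2 - 1`. -/
lemma exists_socle_ne_smul {f : F[X]} {e : ℕ} (hi : Irreducible f) (hdeg : 1 < f.natDegree)
    (he : 0 < e) {ι : AdjoinRoot (f ^ e) →+* AdjoinRoot (f ^ e)}
    (h2 : AdjoinRoot.root (f ^ e) * ι (AdjoinRoot.root (f ^ e)) = 1) {c : F} (hc : c ≠ 0) :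
    ∃ r, ι (AdjoinRoot.mk _ (f ^ (e - 1)) * r) ≠ c • (AdjoinRoot.mk _ (f ^ (e - 1)) * r) := by
  by_contra! h
  set z := AdjoinRoot.mk (f ^ e) (f ^ (e - 1)) with hz
  set t := AdjoinRoot.root (f ^ e) with ht
  have e1 := h 1
  have e2 := h t
  rw [mul_one] at e1
  rw [map_mul, e1] at e2
  have e3 : c • ((t * t - 1) * z) = 0 := by
    have : t * (c • z * ι t) = t * (c • (z * t)) := by rw [e2]
    rw [mul_left_comm, h2, mul_one, mul_smul_comm] at this
    rw [sub_mul, one_mul, smul_sub, this, ← smul_sub]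
    rw [show t * t * z - t * (z * t) = 0 by ring, smul_zero]
  have e4 : (t * t - 1) * z = 0 := (smul_eq_zero.1 e3).resolve_left hc
  have e5 : f ^ e ∣ (X * X - 1) * f ^ (e - 1) := by
    rw [← AdjoinRoot.mk_eq_zero, map_mul, map_sub, map_mul, AdjoinRoot.mk_X, map_one]
    exact e4
  have e6 : f ^ (e - 1) * f ∣ f ^ (e - 1) * (X * X - 1) := by
    rw [← pow_succ, Nat.sub_add_cancel he, mul_comm]
    exact e5
  refine not_dvd_X_sq_sub_one hi hdeg ?_
  rw [sq]
  exact (mul_dvd_mul_iff_left (pow_ne_zero _ hi.ne_zero)).1 e6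

/-- On the minimal ideal of `F[X] / (X - c) ^ e`, `c = ± 1`, the inversion acts as
`(-1) ^ (e - 1)`. -/
lemma inversion_socle_linear {c : F} (hc : c * c = 1) {e : ℕ} (he : 0 < e) {p : F[X]}
    (hp : p = (X - C c) ^ e) {ι : AdjoinRoot p →+* AdjoinRoot p}
    (h1 : ∀ (c : F) a, ι (c • a) = RingHom.id F c • ι a)
    (h2 : AdjoinRoot.root p * ι (AdjoinRoot.root p) = 1) :
    ι (AdjoinRoot.mk p ((X - C c) ^ (e - 1))) =
      (-1) ^ (e - 1) * AdjoinRoot.mk p ((X - C c) ^ (e - 1)) := by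
  set t := AdjoinRoot.root p with ht
  set k := AdjoinRoot.of p c with hk
  have hkk : k * k = 1 := by rw [hk, ← map_mul, hc, map_one]
  have hιk : ι k = k := by
    have := h1 c 1
    rw [map_one, RingHom.id_apply, Algebra.smul_def, mul_one] at this
    exact this
  have hmk : AdjoinRoot.mk p (X - C c) = t - k := by
    rw [map_sub, AdjoinRoot.mk_X, AdjoinRoot.mk_C]
  rw [map_pow, hmk]
  have hs : ι (t - k) = (-1) * (k * ι t) * (t - k) := by
    rw [map_sub, hιk]
    linear_combination k * h2 - ι t * hkk
  have hz : (t - k) * (t - k) ^ (e - 1) = 0 := by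
    rw [← pow_succ', Nat.sub_add_cancel he, ← hmk, ← map_pow, ← hp, AdjoinRoot.mk_self]
  have hu : (k * ι t) * (t - k) ^ (e - 1) = (t - k) ^ (e - 1) := by
    linear_combination (- ι t) * hz + (t - k) ^ (e - 1) * h2
  have hu' : ∀ m, (k * ι t) ^ m * (t - k) ^ (e - 1) = (t - k) ^ (e - 1) := by
    intro m
    induction m with
    | zero => simp
    | succ m ih => rw [pow_succ, mul_assoc, hu, ih]
  rw [map_pow, hs, mul_pow, mul_pow, mul_assoc, hu']

/-- A self-dual irreducible polynomial of degree one is `X - 1` or `X + 1`. -/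
lemma eq_X_sub_one_or_eq_X_add_one {f : F[X]} (hf : f.Monic) (h0 : f.coeff 0 ≠ 0)
    (hdeg : f.natDegree = 1) (hd : dual f = f) : f = X - 1 ∨ f = X + 1 := by
  have hfX : f = X + C (f.coeff 0) := by
    have := hf.as_sum
    rw [hdeg] at this
    simpa using this
  have h1 : (dual f).coeff 0 = (f.coeff 0)⁻¹ := by
    rw [dual, coeff_C_mul, coeff_zero_reverse, hf.leadingCoeff, mul_one]
  rw [hd] at h1
  have h2 : f.coeff 0 * f.coeff 0 = 1 := by
    nth_rewrite 2 [h1]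
    exact mul_inv_cancel₀ h0
  rcases mul_self_eq_one_iff.1 h2 with h | h
  · right
    rw [h] at hfX
    simpa using hfX
  · left
    rw [h] at hfX
    simpa [sub_eq_add_neg] using hfX

lemma dual_base_eq {f : F[X]} {e : ℕ} (hf : f.Monic) (hi : Irreducible f) (he : 0 < e)
    (h0 : f.coeff 0 ≠ 0) (hd : dual (f ^ e) = f ^ e) : dual f = f := by
  rw [dual_pow] at hd
  exact (eq_of_pow_eq_pow (monic_dual h0) (irreducible_dual h0 hf hi) hf hi he hd).1

end Cyclic

end Forms

end FormIsometry

namespace FormIsometry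

universe u

/-! ### Gauss sums of quadratic forms -/

section GaussSums

variable {F : Type*} [Field F] (ψ : AddChar F ℂ)

/-- The Gauss sum `∑ ψ (f v)` over the values of the function `f`. -/
noncomputable def gaussSumOf {V : Type*} (f : V → F) : ℂ := ∑ᶠ v, ψ (f v)

lemma gaussSumOf_eq_sum {V : Type*} [Fintype V] (f : V → F) :
    gaussSumOf ψ f = ∑ v, ψ (f v) := finsum_eq_sum_of_fintype _

lemma gaussSumOf_comp_equiv {V W : Type*} (e : V ≃ W) (f : W → F) :
    gaussSumOf ψ (fun v => f (e v)) = gaussSumOf ψ f :=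
  finsum_comp_equiv (f := fun w => ψ (f w)) e

/-- The absolute value of the Gauss sum of a non-singular quadratic form on `V`. -/
noncomputable def sqrtCard (V : Type*) : ℂ := (√(Nat.card V) : ℝ)

lemma sqrtCard_prod (V W : Type*) : sqrtCard (V × W) = sqrtCard V * sqrtCard W := by
  rw [sqrtCard, sqrtCard, sqrtCard, Nat.card_prod, Nat.cast_mul, Real.sqrt_mul (by positivity),
    Complex.ofReal_mul]

lemma sqrtCard_congr {V W : Type*} (e : V ≃ W) : sqrtCard V = sqrtCard W := by
  rw [sqrtCard, sqrtCard, Nat.card_congr e]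

lemma sqrtCard_ne_zero (V : Type*) [Finite V] [Nonempty V] : sqrtCard V ≠ 0 := by
  have : 0 < Nat.card V := Nat.card_pos
  rw [sqrtCard, Complex.ofReal_ne_zero]
  positivity

lemma gaussSumOf_prod {V W : Type*} [Finite V] [Finite W] [AddCommGroup V] [Module F V]
    [AddCommGroup W] [Module F W] (Q : QuadraticForm F V) (R : QuadraticForm F W) :
    gaussSumOf ψ (Q.prod R) = gaussSumOf ψ Q * gaussSumOf ψ R := by
  have := Fintype.ofFinite V
  have := Fintype.ofFinite W
  simp only [gaussSumOf_eq_sum, Finset.sum_mul_sum, Fintype.sum_prod_type, QuadraticMap.prod_apply,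
    AddChar.map_add_eq_mul]

variable {ψ} {V : Type*} [AddCommGroup V] [Module F V]

lemma exists_addChar_ne_one {F : Type*} [Field F] [Finite F] : ∃ ψ : AddChar F ℂ, ψ ≠ 1 := by
  obtain ⟨ψ, hψ⟩ := AddChar.exists_apply_ne_zero.2 (one_ne_zero (α := F))
  exact ⟨ψ, AddChar.ne_one_iff.2 ⟨1, hψ⟩⟩

lemma exists_apply_mul_ne_one (hψ : ψ ≠ 1) {a : F} (ha : a ≠ 0) : ∃ c, ψ (c * a) ≠ 1 := by
  obtain ⟨x, hx⟩ := (AddChar.ne_one_iff).1 hψ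
  exact ⟨x * a⁻¹, by rwa [inv_mul_cancel_right₀ ha]⟩

lemma sum_apply_linear [Fintype V] (hψ : ψ ≠ 1) (L : V →ₗ[F] F) [Decidable (L = 0)] :
    ∑ v, ψ (L v) = if L = 0 then (Fintype.card V : ℂ) else 0 := by
  classical
  have h := AddChar.sum_eq_ite (ψ.compAddMonoidHom L.toAddMonoidHom)
  simp only [AddChar.compAddMonoidHom_apply] at h
  refine h.trans (if_congr ?_ rfl rfl)
  constructor
  · intro h0
    ext v
    by_contra hv
    obtain ⟨c, hc⟩ := exists_apply_mul_ne_one hψ hv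
    apply hc
    have := DFunLike.congr_fun h0 (c • v)
    simpa using this
  · rintro rfl
    ext v
    simp

/-- The Gauss sum of a quadratic form with totally singular subspace `W` is concentrated on the
orthogonal space of `W`. -/
lemma sum_apply_eq_sum_orthogonal [Fintype V] (hψ : ψ ≠ 1) (Q : QuadraticForm F V)
    {W P : Submodule F V} (hW : ∀ w ∈ W, Q w = 0)
    (hP : ∀ v, v ∈ P ↔ ∀ w ∈ W, QuadraticMap.polar Q w v = 0) [DecidablePred (· ∈ P)] :
    ∑ v, ψ (Q v) = ∑ v, if v ∈ P then ψ (Q v) else 0 := by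
  classical
  have := Fintype.ofFinite W
  have h1 : ∀ w : W, ∑ v, ψ (Q v) = ∑ v, ψ (QuadraticMap.polar Q w v) * ψ (Q v) := fun w => by
    rw [← Equiv.sum_comp (Equiv.addLeft (w : V)) fun v => ψ (Q v)]
    refine Finset.sum_congr rfl fun v _ => ?_
    rw [← AddChar.map_add_eq_mul, QuadraticMap.polar, hW w w.2, Equiv.coe_addLeft]
    congr 1
    ring
  have h2 : (Fintype.card W : ℂ) * ∑ v, ψ (Q v) =
      Fintype.card W * ∑ v, if v ∈ P then ψ (Q v) else 0 := by
    calc (Fintype.card W : ℂ) * ∑ v, ψ (Q v) = ∑ _w : W, ∑ v, ψ (Q v) := by simp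
      _ = ∑ v, (∑ w : W, ψ (QuadraticMap.polar Q w v)) * ψ (Q v) := by
        rw [Finset.sum_congr rfl fun w _ => h1 w, Finset.sum_comm]
        simp_rw [Finset.sum_mul]
      _ = _ := by
        rw [Finset.mul_sum]
        refine Finset.sum_congr rfl fun v _ => ?_
        have h3 := sum_apply_linear hψ ((Q.polarBilin.flip v).comp W.subtype)
        simp only [LinearMap.comp_apply, Submodule.subtype_apply, LinearMap.flip_apply,
          QuadraticMap.polarBilin_apply_apply] at h3
        rw [h3, mul_ite, mul_zero, ite_mul, zero_mul]
        refine if_congr ?_ rfl rfl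
        rw [hP]
        exact ⟨fun h w hw => LinearMap.congr_fun h ⟨w, hw⟩, fun h => LinearMap.ext fun w => h w w.2⟩
  exact mul_left_cancel₀ (by exact_mod_cast Fintype.card_ne_zero) h2

/-- Expanding `|∑ ψ (Q v)| ^ 2` and substituting `u + v` for `v` leaves, by non-degeneracy of the
polar form, only the terms with `v = 0`. -/
lemma norm_sum_apply [Fintype V] [Finite F] (hψ : ψ ≠ 1) {Q : QuadraticForm F V}
    (hQ : LinearMap.Nondegenerate Q.polarBilin) : ‖∑ v, ψ (Q v)‖ = √(Nat.card V) := by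
  classical
  have h1 : (∑ v, ψ (Q v)) * (starRingEnd ℂ) (∑ v, ψ (Q v)) = Fintype.card V := by
    calc (∑ v, ψ (Q v)) * (starRingEnd ℂ) (∑ v, ψ (Q v))
        = ∑ u, ∑ v, ψ (Q (u + v)) * ψ (- Q u) := by
          rw [mul_comm, map_sum, Finset.sum_mul_sum]
          refine Finset.sum_congr rfl fun u _ => ?_
          rw [← Equiv.sum_comp (Equiv.addLeft u) fun v => (starRingEnd ℂ) (ψ (Q u)) * ψ (Q v)]
          refine Finset.sum_congr rfl fun v _ => ?_
          rw [AddChar.map_neg_eq_conj, mul_comm]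
          rfl
      _ = ∑ v, ψ (Q v) * ∑ u, ψ (QuadraticMap.polar Q v u) := by
          rw [Finset.sum_comm]
          refine Finset.sum_congr rfl fun v _ => ?_
          rw [Finset.mul_sum]
          refine Finset.sum_congr rfl fun u _ => ?_
          rw [← AddChar.map_add_eq_mul, ← AddChar.map_add_eq_mul, QuadraticMap.polar, add_comm u v]
          congr 1
          ring
      _ = ∑ v : V, if v = 0 then (Fintype.card V : ℂ) else 0 := by
          refine Finset.sum_congr rfl fun v _ => ?_
          have h3 := sum_apply_linear hψ (Q.polarBilin v)
          simp only [QuadraticMap.polarBilin_apply_apply] at h3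
          rw [h3]
          by_cases hv : v = 0
          · simp [hv]
          · have : Q.polarBilin v ≠ 0 := fun h => hv (hQ.1 v fun w => LinearMap.congr_fun h w)
            simp [hv, this]
      _ = _ := by simp
  rw [Complex.mul_conj, Complex.normSq_eq_norm_sq] at h1
  have h2 : ‖∑ v, ψ (Q v)‖ ^ 2 = Fintype.card V := by exact_mod_cast h1
  rw [Nat.card_eq_fintype_card, ← h2, Real.sqrt_sq (norm_nonneg _)]

lemma nondegenerate_polarBilin_smul {Q : QuadraticForm F V}
    (hQ : LinearMap.Nondegenerate Q.polarBilin) {c : F} (hc : c ≠ 0) :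
    LinearMap.Nondegenerate (QuadraticMap.polarBilin (c • Q)) := by
  rw [nondegenerate_polarBilin_iff] at hQ ⊢
  intro v hv
  refine hQ v fun w => ?_
  have := hv w
  rw [FunLike.coe_smul, QuadraticMap.polar_smul, smul_eq_mul] at this
  exact (mul_eq_zero.1 this).resolve_left hc

/-- The sum of the Gauss sums of all multiples of `Q`, for a maximal totally singular subspace
`W`. -/
lemma sum_sum_apply_mul [Fintype V] [Fintype F] [DecidableEq F] (hψ : ψ ≠ 1)
    (Q : QuadraticForm F V) {W P : Submodule F V} (hW : ∀ w ∈ W, Q w = 0)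
    (hP : ∀ v, v ∈ P ↔ ∀ w ∈ W, QuadraticMap.polar Q w v = 0)
    (hmax : ∀ v ∈ P, Q v = 0 → v ∈ W) (hWP : W ≤ P) :
    ∑ c ∈ Finset.univ.erase (0 : F), ∑ v, ψ (c * Q v) =
      Nat.card F * Nat.card W - Nat.card P := by
  classical
  have := Fintype.ofFinite W
  have h1 : ∀ c ∈ Finset.univ.erase (0 : F), ∑ v, ψ (c * Q v) =
      ∑ v, if v ∈ P then ψ (c * Q v) else 0 := fun c hc => by
    have hc0 : c ≠ 0 := (Finset.mem_erase.1 hc).1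
    refine sum_apply_eq_sum_orthogonal hψ (c • Q) (W := W) (P := P) (fun w hw => ?_) (fun v => ?_)
    · rw [_root_.smul_apply, hW w hw, smul_zero]
    · simp only [FunLike.coe_smul, QuadraticMap.polar_smul, smul_eq_mul, mul_eq_zero, hc0,
        false_or]
      exact hP v
  have h2 : ∑ c : F, ∑ v, (if v ∈ P then ψ (c * Q v) else 0) = (Nat.card F * Nat.card W : ℂ) := by
    rw [Finset.sum_comm]
    have h3 : ∀ v, ∑ c : F, (if v ∈ P then ψ (c * Q v) else 0) =
        if v ∈ W then (Nat.card F : ℂ) else 0 := fun v => by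
      by_cases hv : v ∈ P
      · have h4 := sum_apply_linear hψ (LinearMap.mulRight F (Q v))
        simp only [LinearMap.mulRight_apply] at h4
        simp only [hv, if_true, h4, Nat.card_eq_fintype_card]
        refine if_congr ⟨fun h => hmax v hv ?_, fun h => ?_⟩ rfl rfl
        · simpa using LinearMap.congr_fun h 1
        · ext; simp [hW v h]
      · have hv' : v ∉ W := fun h => hv (hWP h)
        simp [hv, hv']
    rw [Finset.sum_congr rfl fun v _ => h3 v, ← Finset.sum_filter, Finset.sum_const,
      nsmul_eq_mul, mul_comm, Nat.card_eq_fintype_card (α := W), Fintype.card_subtype]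
  have h5 : ∑ v, (if v ∈ P then ψ (0 * Q v) else 0) = (Nat.card P : ℂ) := by
    simp only [zero_mul, AddChar.map_zero_eq_one]
    rw [← Finset.sum_filter, Finset.sum_const, nsmul_eq_mul, mul_one,
      Nat.card_eq_fintype_card, Fintype.card_subtype]
  rw [Finset.sum_congr rfl h1, Finset.sum_erase_eq_sub (Finset.mem_univ _), h2, h5]

/-- A totally singular subspace of maximal dimension. -/
lemma exists_maximal_totallySingular [FiniteDimensional F V] (Q : QuadraticForm F V) :
    ∃ W : Submodule F V, (∀ w ∈ W, Q w = 0) ∧ ∀ W' : Submodule F V, (∀ w ∈ W', Q w = 0) →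
      Module.finrank F W' ≤ Module.finrank F W := by
  classical
  let p : ℕ → Prop := fun d => ∃ W : Submodule F V, (∀ w ∈ W, Q w = 0) ∧ Module.finrank F W = d
  have h0 : p 0 := ⟨⊥, by simp, by simp⟩
  obtain ⟨W, hW, hd⟩ := Nat.findGreatest_spec (P := p) (Nat.zero_le (Module.finrank F V)) h0
  exact ⟨W, hW, fun W' hW' => hd ▸ Nat.le_findGreatest (Submodule.finrank_le W') ⟨W', hW', rfl⟩⟩

lemma le_orthogonal_of_totallySingular {Q : QuadraticForm F V} {W : Submodule F V}
    (hW : ∀ w ∈ W, Q w = 0) {v w : V} (hv : v ∈ W) (hw : w ∈ W) : QuadraticMap.polar Q w v = 0 := by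
  rw [QuadraticMap.polar, hW _ (W.add_mem hw hv), hW _ hv, hW _ hw, sub_zero, sub_zero]

/-- A singular vector orthogonal to a maximal totally singular subspace lies in it. -/
lemma mem_of_maximal_totallySingular [FiniteDimensional F V] {Q : QuadraticForm F V}
    {W : Submodule F V} (hW : ∀ w ∈ W, Q w = 0)
    (hmax : ∀ W' : Submodule F V, (∀ w ∈ W', Q w = 0) → Module.finrank F W' ≤ Module.finrank F W)
    {v : V} (hv : ∀ w ∈ W, QuadraticMap.polar Q w v = 0) (hQv : Q v = 0) : v ∈ W := by
  have h1 : ∀ x ∈ W ⊔ Submodule.span F {v}, Q x = 0 := by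
    intro x hx
    obtain ⟨w, hw, y, hy, rfl⟩ := Submodule.mem_sup.1 hx
    obtain ⟨c, rfl⟩ := Submodule.mem_span_singleton.1 hy
    rw [QuadraticMap.map_add (⇑Q), hW w hw, QuadraticMap.map_smul, hQv,
      QuadraticMap.polar_smul_right, hv w hw]
    simp
  have h2 : W = W ⊔ Submodule.span F {v} :=
    Submodule.eq_of_le_of_finrank_le le_sup_left (hmax _ h1)
  rw [h2]
  exact Submodule.mem_sup_right (Submodule.mem_span_singleton_self v)

lemma finrank_polarBilin_orthogonal [FiniteDimensional F V] {Q : QuadraticForm F V}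
    (hQ : LinearMap.Nondegenerate Q.polarBilin) (W : Submodule F V) :
    Module.finrank F W + Module.finrank F (LinearMap.BilinForm.orthogonal Q.polarBilin W) =
      Module.finrank F V := by
  have h := LinearMap.BilinForm.finrank_orthogonal hQ W
  have := Submodule.finrank_le W
  omega

/-- The Gauss sum of a non-singular quadratic form of even dimension `2 * k` is `± q ^ k`, with
the sign given by the Witt index. For Witt index `k` the sum is concentrated on the totally singular
subspace; for a smaller index `r` the Gauss sums of the non-zero multiples of `Q`, all of absolute
value `q ^ k`, add up to `q ^ (r + 1) - q ^ (2 * k - r)`. -/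
lemma gaussSumOf_of_maximal [Finite F] [FiniteDimensional F V] (hψ : ψ ≠ 1) {Q : QuadraticForm F V}
    (hQ : LinearMap.Nondegenerate Q.polarBilin) {k : ℕ} (hk : Module.finrank F V = 2 * k)
    {W : Submodule F V} (hW : ∀ w ∈ W, Q w = 0)
    (hmax : ∀ W' : Submodule F V, (∀ w ∈ W', Q w = 0) →
      Module.finrank F W' ≤ Module.finrank F W) :
    (Module.finrank F W = k ∧ gaussSumOf ψ Q = sqrtCard V) ∨
      (Module.finrank F W + 1 = k ∧ gaussSumOf ψ Q = - sqrtCard V) := by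
  classical
  have : Finite V := Module.finite_of_finite F
  have := Fintype.ofFinite V
  have := Fintype.ofFinite F
  set q := Nat.card F with hq
  have hq1 : 1 < q := Finite.one_lt_card
  have hq1' : (1 : ℝ) < q := by exact_mod_cast hq1
  set P := LinearMap.BilinForm.orthogonal Q.polarBilin W with hPdef
  have hP : ∀ v, v ∈ P ↔ ∀ w ∈ W, QuadraticMap.polar Q w v = 0 := fun v => Iff.rfl
  have hWP : W ≤ P := fun v hv w hw => le_orthogonal_of_totallySingular hW hv hw
  have hdim := finrank_polarBilin_orthogonal hQ W
  rw [← hPdef] at hdim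
  set r := Module.finrank F W with hr
  have hrP := Submodule.finrank_mono hWP
  have hcW : Nat.card W = q ^ r := Module.natCard_eq_pow_finrank
  have hcP : Nat.card P = q ^ (2 * k - r) := by
    rw [Module.natCard_eq_pow_finrank (K := F) (V := P)]
    congr 1
    omega
  have hsq : √(Nat.card V) = (q : ℝ) ^ k := by
    rw [Module.natCard_eq_pow_finrank (K := F) (V := V), hk, pow_mul', Nat.cast_pow, Nat.cast_pow,
      Real.sqrt_sq (by positivity)]
  have hsq' : sqrtCard V = (q : ℂ) ^ k := by
    rw [sqrtCard, hsq, Complex.ofReal_pow, Complex.ofReal_natCast]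
  have hmem : ∀ v ∈ P, Q v = 0 → v ∈ W := fun v hv h0 =>
    mem_of_maximal_totallySingular hW hmax hv h0
  rw [gaussSumOf_eq_sum, hsq']
  rcases Nat.lt_or_ge r k with hrk | hrk
  · right
    have hsum := sum_sum_apply_mul hψ Q hW hP hmem hWP
    have hnorm : ∀ c ∈ Finset.univ.erase (0 : F), ‖∑ v, ψ (c * Q v)‖ = (q : ℝ) ^ k :=
      fun c hc => by
        rw [← hsq]
        exact norm_sum_apply hψ (nondegenerate_polarBilin_smul hQ (Finset.mem_erase.1 hc).1)
    have hre : ∑ c ∈ Finset.univ.erase (0 : F), (∑ v, ψ (c * Q v)).re =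
        q ^ (r + 1) - q ^ (2 * k - r) := by
      rw [← Complex.re_sum, hsum, hcW, hcP]
      have : ((Nat.card F : ℂ) * ((q ^ r : ℕ) : ℂ) - ((q ^ (2 * k - r) : ℕ) : ℂ)) =
          (((q ^ (r + 1) - q ^ (2 * k - r) : ℝ)) : ℂ) := by
        push_cast
        rw [pow_succ']
      rw [this, Complex.ofReal_re]
    have hge : ∀ c ∈ Finset.univ.erase (0 : F), -(q : ℝ) ^ k ≤ (∑ v, ψ (c * Q v)).re :=
      fun c hc => by
        rw [← hnorm c hc]
        exact (abs_le.1 (Complex.abs_re_le_norm _)).1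
    have hcard : ∑ c ∈ Finset.univ.erase (0 : F), -(q : ℝ) ^ k = -((q - 1) * q ^ k) := by
      rw [Finset.sum_const, Finset.card_erase_of_mem (Finset.mem_univ _), Finset.card_univ,
        ← Nat.card_eq_fintype_card, nsmul_eq_mul, Nat.cast_sub hq1.le]
      simp
    -- For `r < k - 1` the total would be smaller than `-(q - 1) * q ^ k`.
    have hrk' : r + 1 = k := by
      by_contra hne
      have h1 := Finset.sum_le_sum hge
      rw [hcard, hre] at h1
      have h2 : (q : ℝ) ^ (k + 1 + 1) ≤ q ^ (2 * k - r) :=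
        pow_le_pow_right₀ hq1'.le (by omega)
      have h3 : (q : ℝ) ^ (r + 1) ≤ q ^ k := pow_le_pow_right₀ hq1'.le (by omega)
      have h4 : (0 : ℝ) < q ^ k := by positivity
      have h5 : (0 : ℝ) < q ^ k * (q * (q - 1)) :=
        mul_pos h4 (mul_pos (by linarith) (by linarith))
      rw [pow_succ, pow_succ] at h2
      linarith
    refine ⟨hrk', ?_⟩
    -- For `r = k - 1` the lower bound is attained, hence by every summand.
    have heq : ∀ c ∈ Finset.univ.erase (0 : F), -(q : ℝ) ^ k = (∑ v, ψ (c * Q v)).re := by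
      refine (Finset.sum_eq_sum_iff_of_le hge).1 ?_
      rw [hcard, hre, hrk', show 2 * k - r = k + 1 by omega, pow_succ]
      ring
    have h1 := heq 1 (by simp)
    have h2 := hnorm 1 (by simp)
    simp only [one_mul] at h1 h2
    have h3 : (∑ v, ψ (Q v)).re = - ‖∑ v, ψ (Q v)‖ := by rw [h2, h1]
    have h4 : (∑ v, ψ (Q v)).im = 0 := by
      have h5 := Complex.sq_norm (∑ v, ψ (Q v))
      rw [Complex.normSq_apply, h3] at h5
      have : (∑ v, ψ (Q v)).im * (∑ v, ψ (Q v)).im = 0 := by linear_combination -h5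
      exact mul_self_eq_zero.1 this
    rw [← Complex.re_add_im (∑ v, ψ (Q v)), h4, ← h1]
    push_cast
    ring
  · left
    have hWP' : W = P := Submodule.eq_of_le_of_finrank_le hWP (by omega)
    have hrk' : r = k := by
      rw [← hWP'] at hdim
      omega
    refine ⟨hrk', ?_⟩
    rw [sum_apply_eq_sum_orthogonal hψ Q hW hP]
    have h1 : ∀ v, (if v ∈ P then ψ (Q v) else 0) = if v ∈ W then (1 : ℂ) else 0 := fun v => by
      rw [← hWP']
      by_cases hv : v ∈ W
      · simp [hv, hW v hv]
      · simp [hv]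
    rw [Finset.sum_congr rfl fun v _ => h1 v, ← Finset.sum_filter, Finset.sum_const, nsmul_eq_mul,
      mul_one, ← hrk', ← Nat.cast_pow, ← hcW, Nat.card_eq_fintype_card, Fintype.card_subtype]

/-- In odd dimension `2 * k + 1` the Gauss sums of the non-zero multiples of a non-singular
quadratic form cancel: for Witt index `r` they add up to `q ^ (r + 1) - q ^ (2 * k + 1 - r)`, and
the bound on their absolute values forces `r = k`. -/
lemma sum_gaussSumOf_smul_eq_zero [Fintype F] [DecidableEq F] [FiniteDimensional F V] (hψ : ψ ≠ 1)
    {Q : QuadraticForm F V} (hQ : LinearMap.Nondegenerate Q.polarBilin)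
    (hodd : Odd (Module.finrank F V)) :
    ∑ c ∈ Finset.univ.erase (0 : F), gaussSumOf ψ (c • Q) = 0 := by
  classical
  have : Finite V := Module.finite_of_finite F
  have := Fintype.ofFinite V
  obtain ⟨k, hk⟩ := hodd
  obtain ⟨W, hW, hmax⟩ := exists_maximal_totallySingular Q
  set q := Nat.card F with hq
  have hq1 : 1 < q := Finite.one_lt_card
  have hq1' : (2 : ℝ) ≤ q := by exact_mod_cast hq1
  set P := LinearMap.BilinForm.orthogonal Q.polarBilin W with hPdef
  have hP : ∀ v, v ∈ P ↔ ∀ w ∈ W, QuadraticMap.polar Q w v = 0 := fun v => Iff.rfl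
  have hWP : W ≤ P := fun v hv w hw => le_orthogonal_of_totallySingular hW hv hw
  have hdim := finrank_polarBilin_orthogonal hQ W
  rw [← hPdef] at hdim
  set r := Module.finrank F W with hr
  have hrP := Submodule.finrank_mono hWP
  have hcW : Nat.card W = q ^ r := Module.natCard_eq_pow_finrank
  have hcP : Nat.card P = q ^ (2 * k + 1 - r) := by
    rw [Module.natCard_eq_pow_finrank (K := F) (V := P)]
    congr 1
    omega
  have hsq : √(Nat.card V) = (q : ℝ) ^ k * √q := by
    rw [Module.natCard_eq_pow_finrank (K := F) (V := V), hk, pow_succ, pow_mul', Nat.cast_mul,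
      Nat.cast_pow, Nat.cast_pow, Real.sqrt_mul (by positivity), Real.sqrt_sq (by positivity)]
  have hsum := sum_sum_apply_mul hψ Q hW hP
    (fun v hv h0 => mem_of_maximal_totallySingular hW hmax hv h0) hWP
  rw [hcW, hcP] at hsum
  have hrk : r = k := by
    by_contra hne
    have h1 := norm_sum_le (Finset.univ.erase (0 : F)) fun c => ∑ v, ψ (c * Q v)
    rw [hsum, Finset.sum_congr rfl (g := fun _ => (q : ℝ) ^ k * √q) fun c hc => by
        rw [← hsq]
        exact norm_sum_apply hψ (nondegenerate_polarBilin_smul hQ (Finset.mem_erase.1 hc).1),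
      Finset.sum_const, Finset.card_erase_of_mem (Finset.mem_univ _), Finset.card_univ,
      ← Nat.card_eq_fintype_card, nsmul_eq_mul, Nat.cast_sub hq1.le, Nat.cast_one] at h1
    have h2 : (q : ℝ) ^ (2 * k + 1 - r) - q ^ (r + 1) ≤ (q - 1) * (q ^ k * √q) := by
      refine le_trans ?_ h1
      have : ((Nat.card F : ℂ) * ((q ^ r : ℕ) : ℂ) - ((q ^ (2 * k + 1 - r) : ℕ) : ℂ)) =
          (((q ^ (r + 1) - q ^ (2 * k + 1 - r) : ℝ)) : ℂ) := by
        push_cast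
        rw [pow_succ']
      rw [this, Complex.norm_real, Real.norm_eq_abs, abs_sub_comm]
      exact le_abs_self _
    have h3 : (q : ℝ) ^ (k + 1 + 1) ≤ q ^ (2 * k + 1 - r) :=
      pow_le_pow_right₀ (by linarith) (by omega)
    have h4 : (q : ℝ) ^ (r + 1) ≤ q ^ k := pow_le_pow_right₀ (by linarith) (by omega)
    have h5 : (0 : ℝ) < q ^ k := by positivity
    have h6 : √(q : ℝ) ≤ q := Real.sqrt_le_self_iff.2 (Or.inr (by linarith))
    rw [pow_succ, pow_succ] at h3
    have h7 : (q : ℝ) ^ k * √q ≤ q ^ k * q := mul_le_mul_of_nonneg_left h6 h5.le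
    have h8 : (q - 1 : ℝ) * (q ^ k * √q) ≤ (q - 1) * (q ^ k * q) :=
      mul_le_mul_of_nonneg_left h7 (by linarith)
    nlinarith
  have h0 : ∑ c ∈ Finset.univ.erase (0 : F), ∑ v, ψ (c * Q v) = 0 := by
    rw [hsum, hrk, show 2 * k + 1 - k = k + 1 by omega, pow_succ']
    push_cast
    ring
  rw [← h0]
  refine Finset.sum_congr rfl fun c _ => ?_
  rw [gaussSumOf_eq_sum]
  rfl

end GaussSums

/-! ### Gauss sums and types -/

section Types

variable {F : Type*} [Field F] [Finite F] {ψ : AddChar F ℂ} {n : ℕ}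

/-- The sign of the Gauss sum of a non-singular quadratic form distinguishes the two types. -/
lemma gaussSumOf_type (hψ : ψ ≠ 1) {Q : QuadraticForm F (Fin n → F)} (hQ : NonSingular Q)
    (hn : Even n) :
    (PlusType Q ∧ ¬ MinusType Q ∧ gaussSumOf ψ Q = sqrtCard (Fin n → F)) ∨
      (MinusType Q ∧ ¬ PlusType Q ∧ gaussSumOf ψ Q = - sqrtCard (Fin n → F)) := by
  obtain ⟨k, hk⟩ := hn.exists_two_nsmul
  obtain ⟨W, hW, hmax⟩ := exists_maximal_totallySingular Q
  have hw : wittIndex Q = Module.finrank F W := by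
    refine le_antisymm (csSup_le ⟨_, W, hW, rfl⟩ ?_)
      (le_csSup ⟨Module.finrank F W, ?_⟩ ⟨W, hW, rfl⟩)
    · rintro _ ⟨W', hW', rfl⟩
      exact hmax W' hW'
    · rintro _ ⟨W', hW', rfl⟩
      exact hmax W' hW'
  rw [smul_eq_mul] at hk
  rcases gaussSumOf_of_maximal hψ hQ ((Module.finrank_fin_fun F).trans hk) hW hmax with h | h
  · left
    simp only [PlusType, MinusType, hw]
    refine ⟨by omega, by omega, h.2⟩
  · right
    simp only [PlusType, MinusType, hw]
    refine ⟨by omega, by omega, h.2⟩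

end Types

end FormIsometry

namespace FormIsometry

universe u

/-! ### Powers of `X + 1` in characteristic two -/

section Linear

variable {F : Type u} [Field F]

/-- The minimal ideal of `F[X] / (X - c) ^ e` is a line. -/
lemma exists_mul_socle_eq_smul {f : F[X]} {c : F} (hf : f = X - C c) {e : ℕ} (he : 0 < e)
    (b : AdjoinRoot (f ^ e)) :
    ∃ d : F, b * AdjoinRoot.mk (f ^ e) (f ^ (e - 1)) = d • AdjoinRoot.mk (f ^ e) (f ^ (e - 1)) := by
  obtain ⟨g, rfl⟩ := AdjoinRoot.mk_surjective b
  refine ⟨g.eval c, ?_⟩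
  rw [Algebra.smul_def, AdjoinRoot.algebraMap_eq, ← AdjoinRoot.mk_C, ← map_mul, ← map_mul,
    AdjoinRoot.mk_eq_mk, ← sub_mul]
  obtain ⟨h, hh⟩ := X_sub_C_dvd_sub_C_eval (p := g) (a := c)
  refine ⟨h, ?_⟩
  rw [hh, ← hf]
  obtain ⟨k, rfl⟩ : ∃ k, e = k + 1 := ⟨e - 1, by omega⟩
  rw [Nat.add_sub_cancel]
  ring

lemma exists_eq_pow_mul_of_pow_mul_eq_zero {f : F[X]} (hf : f ≠ 0) {e j : ℕ} (hj : j ≤ e)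
    {a : AdjoinRoot (f ^ e)} (ha : AdjoinRoot.mk (f ^ e) f ^ j * a = 0) :
    ∃ b, a = AdjoinRoot.mk (f ^ e) f ^ (e - j) * b := by
  obtain ⟨g, rfl⟩ := AdjoinRoot.mk_surjective a
  rw [← map_pow, ← map_mul, AdjoinRoot.mk_eq_zero] at ha
  have h : f ^ j * f ^ (e - j) ∣ f ^ j * g := by rwa [← pow_add, Nat.add_sub_cancel' hj]
  obtain ⟨b, rfl⟩ := (mul_dvd_mul_iff_left (pow_ne_zero _ hf)).1 h
  exact ⟨AdjoinRoot.mk _ b, by rw [map_mul, map_pow]⟩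

lemma dual_X_add_one : dual (X + 1 : F[X]) = X + 1 := by
  have h : (X + 1 : F[X]).reverse = X + 1 := by
    have h0 : (X + 1 : F[X]) = X + C 1 := by rw [C_1]
    have hd : (X + 1 : F[X]).natDegree = 1 := by rw [h0, natDegree_X_add_C]
    ext i
    rw [coeff_reverse, hd]
    rcases i with _ | _ | i
    · simp [revAt_le, coeff_one]
    · simp [revAt_le, coeff_one]
    · have hr : revAt 1 (i + 1 + 1) = i + 1 + 1 := revAt_eq_self_of_lt (by omega)
      rw [hr]
  rw [dual, h]
  simp

lemma X_add_one_pow_coeff_zero_ne_zero (e : ℕ) : ((X + 1 : F[X]) ^ e).coeff 0 ≠ 0 := by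
  simp [coeff_zero_eq_eval_zero]

variable [CharP F 2]

lemma X_add_one_eq_X_sub_C : (X + 1 : F[X]) = X - C 1 := by rw [C_1, CharTwo.sub_eq_add]

lemma X_add_one_eq_X_sub_one : (X + 1 : F[X]) = X - 1 := by rw [CharTwo.sub_eq_add]

lemma irreducible_X_add_one : Irreducible (X + 1 : F[X]) := by
  rw [X_add_one_eq_X_sub_C]; exact irreducible_X_sub_C 1

lemma monic_X_add_one : (X + 1 : F[X]).Monic := by
  rw [X_add_one_eq_X_sub_C]; exact monic_X_sub_C 1

lemma adjoinRoot_two_eq_zero (p : F[X]) : (2 : AdjoinRoot p) = 0 := by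
  have h := congrArg (AdjoinRoot.of p) (CharTwo.two_eq_zero (R := F))
  rwa [map_zero, map_ofNat] at h

/-- The inversion of `F[X] / (X + 1) ^ e` in terms of `s = X + 1` and `u = X⁻¹`: it maps `s` to
`s * u`, and `u` fixes the minimal ideal, which consists of multiples of `s ^ (e - 1)`. -/
lemma exists_involution_X_add_one {e : ℕ} (he : 0 < e) {p : F[X]} (hp : p = (X + 1) ^ e) :
    ∃ (ι : AdjoinRoot p →+* AdjoinRoot p) (s u : AdjoinRoot p),
      (∀ (c : F) a, ι (c • a) = RingHom.id F c • ι a) ∧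
      AdjoinRoot.root p * ι (AdjoinRoot.root p) = 1 ∧ (∀ a, ι (ι a) = a) ∧
      s = AdjoinRoot.mk p (X + 1) ∧ AdjoinRoot.root p = 1 + s ∧ (1 + s) * u = 1 ∧ ι s = s * u ∧
      s ^ e = 0 ∧ (∀ m, s ^ (e - 1) * u ^ m = s ^ (e - 1)) ∧
      ∀ b, ∃ d : F, b * s ^ (e - 1) = d • s ^ (e - 1) := by
  subst hp
  obtain ⟨ι, h1, h2, h3⟩ := exists_involution (σ := RingHom.id F) (fun _ => rfl)
    (X_add_one_pow_coeff_zero_ne_zero e) (by rw [sdual_id, dual_pow, dual_X_add_one])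
  have h20 := adjoinRoot_two_eq_zero ((X + 1 : F[X]) ^ e)
  set s := AdjoinRoot.mk ((X + 1 : F[X]) ^ e) (X + 1) with hs
  have hroot : AdjoinRoot.root ((X + 1 : F[X]) ^ e) = 1 + s := by
    rw [hs, map_add, AdjoinRoot.mk_X, map_one]
    linear_combination -h20
  have hse : s ^ e = 0 := by rw [hs, ← map_pow, AdjoinRoot.mk_self]
  have hse' : s * s ^ (e - 1) = 0 := by rw [← pow_succ', Nat.sub_add_cancel he, hse]
  have hιs : ι (AdjoinRoot.root ((X + 1 : F[X]) ^ e)) = 1 + ι s := by rw [hroot, map_add, map_one]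
  have hu : (1 + s) * ι (AdjoinRoot.root ((X + 1 : F[X]) ^ e)) = 1 := by rw [← hroot, h2]
  set u := ι (AdjoinRoot.root ((X + 1 : F[X]) ^ e)) with hudef
  refine ⟨ι, s, u, h1, h2, h3, rfl, hroot, hu, ?_, hse, fun m => ?_, fun b => ?_⟩
  · linear_combination -hu - hιs + (u - 1) * h20
  · induction m with
    | zero => simp
    | succ m ih =>
      rw [pow_succ, ← mul_assoc, ih]
      linear_combination -u * hse' + s ^ (e - 1) * hu
  · have := exists_mul_socle_eq_smul (F := F) X_add_one_eq_X_sub_C he b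
    rwa [map_pow] at this

/-- In characteristic two, `(X + 1) ^ (2 * k)` is realized on `F[X] / (X + 1) ^ (2 * k)`: the form
`S (a * ι a)` on `F[X] / (X + 1) ^ (2 * k + 1)` vanishes on the minimal ideal, which is the radical
of its polar form. -/
lemma exists_quadraticForm_X_add_one_pow {k : ℕ} (hk : 0 < k) {p : F[X]}
    (hp : p = (X + 1) ^ (2 * k)) :
    ∃ Q : QuadraticForm F (AdjoinRoot p), LinearMap.Nondegenerate Q.polarBilin ∧
      ∀ a, Q (AdjoinRoot.root p * a) = Q a := by
  set P : F[X] := (X + 1) ^ (2 * k + 1) with hP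
  obtain ⟨ι, s, u, h1, h2, h3, hs, hroot, hu, hιs, hse, hsu, hsoc⟩ :=
    exists_involution_X_add_one (F := F) (e := 2 * k + 1) (by omega) hP
  have h20 := adjoinRoot_two_eq_zero P
  rw [Nat.add_sub_cancel] at hsu hsoc
  have hz0 : s ^ (2 * k) ≠ 0 := by
    rw [hs, ← map_pow, Ne, AdjoinRoot.mk_eq_zero, hP, pow_dvd_pow_iff
      irreducible_X_add_one.ne_zero irreducible_X_add_one.not_isUnit]
    omega
  obtain ⟨S, hS⟩ := exists_functional_ne_zero (F := F) hz0
  -- a linear section of the projection modulo the minimal ideal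
  have hpm : p.Monic := hp ▸ monic_X_add_one.pow _
  let m := AdjoinRoot.modByMonicHom hpm
  let j : AdjoinRoot p →ₗ[F] AdjoinRoot P := (AdjoinRoot.mkₐ P).toLinearMap ∘ₗ m
  have hjm : ∀ a, j a = AdjoinRoot.mk P (m a) := fun _ => rfl
  have hm : ∀ a, AdjoinRoot.mk p (m a) = a := AdjoinRoot.mk_leftInverse hpm
  have hj : ∀ g, ∃ b, j (AdjoinRoot.mk p g) = AdjoinRoot.mk P g + s ^ (2 * k) * b := fun g => by
    have h := hm (AdjoinRoot.mk p g)
    rw [AdjoinRoot.mk_eq_mk] at h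
    obtain ⟨b, hb⟩ := h
    refine ⟨AdjoinRoot.mk P b, ?_⟩
    rw [hjm, hs, ← map_pow, ← map_mul, ← map_add, ← hp, ← hb]
    congr 1
    ring
  have hιz : ι (s ^ (2 * k)) = s ^ (2 * k) := by rw [map_pow, hιs, mul_pow, hsu]
  have hzz : s ^ (2 * k) * s ^ (2 * k) = 0 := by
    obtain ⟨l, rfl⟩ : ∃ l, k = l + 1 := ⟨k - 1, by omega⟩
    linear_combination s ^ (2 * l + 1) * hse
  have hzι : ∀ b, s ^ (2 * k) * ι b = s ^ (2 * k) * b := fun b => by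
    obtain ⟨d, hd⟩ := hsoc b
    have := congrArg ι hd
    rw [map_mul, hιz, h1, hιz, RingHom.id_apply, ← hd] at this
    linear_combination this
  have hT : ∀ a, s ^ (2 * k) * a + ι (s ^ (2 * k) * a) = 0 := fun a => by
    rw [map_mul, hιz, hzι]
    linear_combination (s ^ (2 * k) * a) * h20
  have hQadd : ∀ a b, normForm S ι h1 (a + s ^ (2 * k) * b) = normForm S ι h1 a := fun a b => by
    rw [normForm_apply, normForm_apply]
    congr 1
    rw [map_add, map_mul, hιz]
    linear_combination a * hzι b + b * hzι a + (s ^ (2 * k) * a * b) * h20 + b * ι b * hzz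
  refine ⟨(normForm S ι h1).comp j, nondegenerate_polarBilin_iff.2 fun x hx => ?_, fun a => ?_⟩
  · by_contra hne
    obtain ⟨g, rfl⟩ := AdjoinRoot.mk_surjective x
    have hg : ¬ (X + 1 : F[X]) ^ (2 * k - 1 + 1) ∣ g := by
      rw [Nat.sub_add_cancel (by omega), ← hp]
      exact fun h => hne (AdjoinRoot.mk_eq_zero.2 h)
    obtain ⟨r, hr⟩ : ∃ r : AdjoinRoot P, AdjoinRoot.mk P g * r = s ^ (2 * k - 1) := by
      rw [hs, ← map_pow]
      exact exists_mul_eq_mk_pow (e := 2 * k + 1) irreducible_X_add_one hg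
    obtain ⟨h, hh⟩ := AdjoinRoot.mk_surjective (ι r)
    obtain ⟨b, hb⟩ := hj g
    obtain ⟨c, hc⟩ := hj h
    have h4 := hx (AdjoinRoot.mk p h)
    have h5 : QuadraticMap.polar ((normForm S ι h1).comp j) (AdjoinRoot.mk p g)
        (AdjoinRoot.mk p h) = QuadraticMap.polar (normForm S ι h1) (j (AdjoinRoot.mk p g))
        (j (AdjoinRoot.mk p h)) := by
      simp only [QuadraticMap.polar, QuadraticMap.comp_apply, map_add]
    rw [h5, polar_normForm S ι h1 h3, hb, hc, hh] at h4
    apply hS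
    rw [← h4]
    congr 1
    -- the product is `s ^ (2 * k - 1)` up to the minimal ideal
    have h6 : ∃ d, (AdjoinRoot.mk P g + s ^ (2 * k) * b) * ι (ι r + s ^ (2 * k) * c) =
        s ^ (2 * k - 1) + s ^ (2 * k) * d := by
      refine ⟨b * r + AdjoinRoot.mk P g * ι c + s ^ (2 * k) * b * ι c, ?_⟩
      rw [map_add, map_mul, hιz, h3]
      linear_combination hr
    obtain ⟨d, hd⟩ := h6
    rw [hd, map_add]
    have h7 : ∀ i, s ^ (2 * k - 1) * u ^ i = s ^ (2 * k - 1) + i • s ^ (2 * k) := by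
      intro i
      have h8 : s ^ (2 * k) = s * s ^ (2 * k - 1) := by
        rw [← pow_succ', Nat.sub_add_cancel (by omega)]
      induction i with
      | zero => simp
      | succ i ih =>
        rw [pow_succ, ← mul_assoc, ih, succ_nsmul, nsmul_eq_mul]
        have h9 := hsu 1
        linear_combination (i - 1 : AdjoinRoot P) * h9 + s ^ (2 * k - 1) * hu + u * h8
          - s ^ (2 * k) * h20
    have h10 : ι (s ^ (2 * k - 1)) = s ^ (2 * k - 1) + s ^ (2 * k) := by
      rw [map_pow, hιs, mul_pow, h7, nsmul_eq_mul]
      obtain ⟨l, hl⟩ : ∃ l, 2 * k - 1 = 2 * l + 1 := ⟨k - 1, by omega⟩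
      rw [hl]
      push_cast
      linear_combination (l * s ^ (2 * k)) * h20
    rw [h10]
    linear_combination -hT d - s ^ (2 * k - 1) * h20
  · obtain ⟨g, rfl⟩ := AdjoinRoot.mk_surjective a
    obtain ⟨b, hb⟩ := hj g
    obtain ⟨c, hc⟩ := hj (X * g)
    rw [← AdjoinRoot.mk_X, ← map_mul, QuadraticMap.comp_apply, QuadraticMap.comp_apply, hb, hc,
      hQadd, hQadd, map_mul, AdjoinRoot.mk_X, normForm_apply, root_mul_mul_inversion h2,
      normForm_apply]

end Linear

end FormIsometry

namespace FormIsometry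

universe u

/-! ### Families of forms whose Gauss sums cancel -/

section Cancel

variable {F : Type u} [Field F]

/-- There is an isometry with elementary divisors `s` which preserves a non-empty family of
non-singular quadratic forms whose Gauss sums add up to zero; in even dimension such a family
contains forms of both types. -/
def GaussSumsCancel (ψ : AddChar F ℂ) (s : Multiset F[X]) : Prop :=
  ∃ (V : Type u) (_ : AddCommGroup V) (_ : Module F V) (φ : V →ₗ[F] V) (I : Finset F)
    (Q : F → QuadraticForm F V), IsElementaryDivisors φ s ∧ I.Nonempty ∧
      (∀ c ∈ I, LinearMap.Nondegenerate (Q c).polarBilin ∧ ∀ v, Q c (φ v) = Q c v) ∧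
      ∑ c ∈ I, gaussSumOf ψ (Q c) = 0

lemma IsElementaryDivisors.finiteDimensional {V : Type*} [AddCommGroup V] [Module F V]
    {φ : V →ₗ[F] V} {s : Multiset F[X]} (hs : IsElementaryDivisors φ s) :
    FiniteDimensional F V := by
  obtain ⟨W, _, _, _, ψ, hψ⟩ := exists_model s fun p hp => hs.isMonicPrimePow hp
  obtain ⟨E, -⟩ := hs.exists_equiv hψ
  exact LinearEquiv.finiteDimensional E.symm

lemma IsElementaryDivisors.finrank_eq {V : Type*} [AddCommGroup V] [Module F V]
    {φ : V →ₗ[F] V} {s : Multiset F[X]} (hs : IsElementaryDivisors φ s) :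
    Module.finrank F V = s.prod.natDegree := by
  have := hs.finiteDimensional
  rw [← hs.charpoly_eq, LinearMap.charpoly_natDegree]

/-- In odd dimension the non-zero multiples of a form are a family with cancelling Gauss sums. -/
lemma QuadraticRealizes.gaussSumsCancel [Finite F] {ψ : AddChar F ℂ} (hψ : ψ ≠ 1)
    {s : Multiset F[X]} (hs : QuadraticRealizes s) (hodd : Odd s.prod.natDegree) :
    GaussSumsCancel ψ s := by
  classical
  have := Fintype.ofFinite F
  obtain ⟨V, _, _, φ, Q, h1, h2, h3⟩ := hs
  have := h1.finiteDimensional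
  rw [← h1.finrank_eq] at hodd
  refine ⟨V, inferInstance, inferInstance, φ, Finset.univ.erase 0, fun c => c • Q, h1,
    ⟨1, by simp⟩, fun c hc => ⟨nondegenerate_polarBilin_smul h2 (Finset.mem_erase.1 hc).1,
    fun v => ?_⟩, sum_gaussSumOf_smul_eq_zero hψ h2 hodd⟩
  rw [_root_.smul_apply, _root_.smul_apply, h3]

/-- In characteristic two, the Gauss sums of the forms `Q + c • R` cancel if these forms share a
totally singular subspace and its orthogonal space `P`, and `Q` is additive and not zero on the
zeros of `R` in `P`. -/
lemma sum_gaussSumOf_add_smul_eq_zero [CharP F 2] [Fintype F] {ψ : AddChar F ℂ} (hψ : ψ ≠ 1)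
    {V : Type*} [AddCommGroup V] [Module F V] [Finite V] {Q R : QuadraticForm F V}
    {W P P₀ : Submodule F V} (hW : ∀ c : F, ∀ w ∈ W, (Q + c • R) w = 0)
    (hP : ∀ (c : F) (v), v ∈ P ↔ ∀ w ∈ W, QuadraticMap.polar (Q + c • R) w v = 0)
    (h0 : ∀ v ∈ P, (R v = 0 ↔ v ∈ P₀)) (hle : P₀ ≤ P)
    (hadd : ∀ u ∈ P₀, ∀ v ∈ P₀, QuadraticMap.polar Q u v = 0) {v₀ : V} (hv₀ : v₀ ∈ P₀)
    (hQ : Q v₀ ≠ 0) : ∑ c : F, gaussSumOf ψ (Q + c • R) = 0 := by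
  classical
  have := Fintype.ofFinite V
  have h1 : ∀ c : F, gaussSumOf ψ (Q + c • R) =
      ∑ v, if v ∈ P then ψ (Q v) * ψ (c * R v) else 0 := fun c => by
    rw [gaussSumOf_eq_sum, sum_apply_eq_sum_orthogonal hψ _ (hW c) (hP c)]
    refine Finset.sum_congr rfl fun v _ => ?_
    rw [← AddChar.map_add_eq_mul]
    rfl
  have h2 : ∀ v, ∑ c : F, (if v ∈ P then ψ (Q v) * ψ (c * R v) else 0) =
      Fintype.card F * if v ∈ P₀ then ψ (Q v) else 0 := fun v => by
    by_cases hv : v ∈ P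
    · have h4 := sum_apply_linear hψ (LinearMap.mulRight F (R v))
      simp only [LinearMap.mulRight_apply] at h4
      simp only [hv, if_true, ← Finset.mul_sum, h4]
      have h5 : LinearMap.mulRight F (R v) = 0 ↔ v ∈ P₀ := by
        rw [← h0 v hv]
        refine ⟨fun h => by simpa using LinearMap.congr_fun h 1, fun h => ?_⟩
        ext
        simp [h]
      by_cases hv0 : v ∈ P₀
      · simp [h5, hv0, mul_comm]
      · simp [h5, hv0]
    · have hv' : v ∉ P₀ := fun h => hv (hle h)
      simp [hv, hv']
  have h3 : ∑ v, (if v ∈ P₀ then ψ (Q v) else 0) = 0 := by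
    obtain ⟨x, hx⟩ := exists_apply_mul_ne_one hψ hQ
    obtain ⟨y, rfl⟩ := FiniteField.isSquare_of_char_two (ringChar.eq F 2) x
    have hw : y • v₀ ∈ P₀ := P₀.smul_mem y hv₀
    rw [← smul_eq_mul (y * y), ← QuadraticMap.map_smul] at hx
    have h4 : ∑ v, (if v ∈ P₀ then ψ (Q v) else 0) =
        ψ (Q (y • v₀)) * ∑ v, (if v ∈ P₀ then ψ (Q v) else 0) := by
      rw [Finset.mul_sum]
      nth_rewrite 1 [← Equiv.sum_comp (Equiv.addLeft (y • v₀))]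
      refine Finset.sum_congr rfl fun v _ => ?_
      rw [Equiv.coe_addLeft, mul_ite, mul_zero]
      by_cases hv : v ∈ P₀
      · rw [if_pos (P₀.add_mem hw hv), if_pos hv, QuadraticMap.map_add (⇑Q), hadd _ hw _ hv,
          add_zero, AddChar.map_add_eq_mul]
      · rw [if_neg hv, if_neg]
        exact fun h => hv (by simpa using P₀.sub_mem h hw)
    have h5 : (1 - ψ (Q (y • v₀))) * ∑ v, (if v ∈ P₀ then ψ (Q v) else 0) = 0 := by
      linear_combination h4
    exact (mul_eq_zero.1 h5).resolve_left (sub_ne_zero.2 hx.symm)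
  rw [Finset.sum_congr rfl fun c _ => h1 c, Finset.sum_comm, Finset.sum_congr rfl fun v _ => h2 v,
    ← Finset.mul_sum, h3, mul_zero]

/-- With respect to a form preserved by the class of `X`, the adjoint of multiplication by `r` is
multiplication by `ι r`. -/
lemma form_smul_left {p : F[X]} {V : Type*} [AddCommGroup V] [Module F V]
    [Module (AdjoinRoot p) V] [IsScalarTower F (AdjoinRoot p) V] {β : V →ₗ[F] V →ₗ[F] F}
    (hβ : ∀ u v, β (AdjoinRoot.root p • u) (AdjoinRoot.root p • v) = β u v)
    {ι : AdjoinRoot p →+* AdjoinRoot p} (h1 : ∀ (c : F) a, ι (c • a) = RingHom.id F c • ι a)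
    (h2 : AdjoinRoot.root p * ι (AdjoinRoot.root p) = 1) (r : AdjoinRoot p) (u v : V) :
    β (r • u) v = β u (ι r • v) := by
  obtain ⟨g, rfl⟩ := AdjoinRoot.mk_surjective r
  induction g using Polynomial.induction_on generalizing v with
  | C c =>
    have h : AdjoinRoot.mk p (C c) = c • 1 := by
      rw [AdjoinRoot.mk_C, Algebra.smul_def, mul_one]; rfl
    rw [h, h1, map_one, smul_assoc, smul_assoc, one_smul, one_smul, map_smul, map_smul]
    rfl
  | add g h hg hh => simp only [map_add, add_smul, LinearMap.add_apply, hg, hh]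
  | monomial n c ih =>
    have hm : AdjoinRoot.mk p (C c * X ^ (n + 1)) =
        AdjoinRoot.root p * AdjoinRoot.mk p (C c * X ^ n) := by
      rw [← AdjoinRoot.mk_X, ← map_mul]
      congr 1
      ring
    rw [hm, map_mul ι, mul_comm (ι _) (ι _), mul_smul, mul_smul, ← ih]
    nth_rewrite 1 [← one_smul (AdjoinRoot p) v]
    rw [← h2, mul_smul, hβ]

variable [Finite F] [CharP F 2]

/-- On `F[X] / (X + 1) ^ (2 * k)` the forms `Q (v) + c Q ((X + 1) v)` have cancelling Gauss
sums. -/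
lemma gaussSumsCancel_X_add_one_pow_even {ψ : AddChar F ℂ} (hψ : ψ ≠ 1) {k : ℕ} (hk : 0 < k) :
    GaussSumsCancel ψ {(X + 1 : F[X]) ^ (2 * k)} := by
  classical
  have := Fintype.ofFinite F
  set p : F[X] := (X + 1) ^ (2 * k) with hp
  have hpm : p.Monic := monic_X_add_one.pow _
  have hdiv : IsElementaryDivisors (rootMul p) {p} := isElementaryDivisors_rootMul
    ⟨X + 1, 2 * k, monic_X_add_one, irreducible_X_add_one, by omega, rfl⟩
  have := hdiv.finiteDimensional
  have : Finite (AdjoinRoot p) := Module.finite_of_finite F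
  obtain ⟨Q, hQ, hQr⟩ := exists_quadraticForm_X_add_one_pow (F := F) hk hp
  obtain ⟨ι, s, u, h1, h2, h3, hs, hroot, hu, hιs, hse, hsu, hsoc⟩ :=
    exists_involution_X_add_one (F := F) (e := 2 * k) (by omega) hp
  set B := QuadraticMap.polar Q with hBdef
  have hBr : ∀ a b, Q.polarBilin (AdjoinRoot.root p • a) (AdjoinRoot.root p • b) =
      Q.polarBilin a b := fun a b => by
    simp only [QuadraticMap.polarBilin_apply_apply, QuadraticMap.polar, smul_eq_mul, ← mul_add, hQr]
  have hB : ∀ r a b, B (r * a) b = B a (ι r * b) := fun r a b => form_smul_left hBr h1 h2 r a b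
  have hB0 : ∀ a, B a 0 = 0 := fun a => QuadraticMap.polar_zero_right Q a
  have hBs : ∀ (d : F) a b, B a (d • b) = d * B a b := fun d a b =>
    QuadraticMap.polar_smul_right Q d a b
  have hnd : ∀ a, (∀ b, B b a = 0) → a = 0 := hQ.2
  have hz0 : s ^ (2 * k - 1) ≠ 0 := by
    rw [hs, ← map_pow, Ne, AdjoinRoot.mk_eq_zero, hp, pow_dvd_pow_iff
      irreducible_X_add_one.ne_zero irreducible_X_add_one.not_isUnit]
    omega
  have hBz : B 1 (s ^ (2 * k - 1)) ≠ 0 := fun h0 => hz0 (hnd _ fun b => by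
    obtain ⟨d, hd⟩ := hsoc (ι b)
    rw [← mul_one b, hB, hd, hBs, h0, mul_zero])
  have hQs : ∀ a, Q (s * a) = - B a (s * a) := fun a => by
    have := hQr a
    rw [hroot, add_mul, one_mul, QuadraticMap.map_add (⇑Q)] at this
    linear_combination this
  have hιsp : ∀ i, ι (s ^ i) = s ^ i * u ^ i := fun i => by rw [map_pow, hιs, mul_pow]
  have huu : IsUnit u := IsUnit.of_mul_eq_one (1 + s) (by rw [mul_comm, hu])
  let R : QuadraticForm F (AdjoinRoot p) := Q.comp (LinearMap.mulLeft F s)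
  have hR : ∀ a, R a = Q (s * a) := fun _ => rfl
  have hm : ∀ c : F, IsUnit (1 + c • (ι s * s)) := fun c => by
    refine IsNilpotent.isUnit_one_add ⟨2 * k, ?_⟩
    rw [_root_.smul_pow, mul_pow, hse, mul_zero, smul_zero]
  have hpol : ∀ (c : F) a b, QuadraticMap.polar (Q + c • R) a b =
      B a ((1 + c • (ι s * s)) * b) := fun c a b => by
    have hR' : QuadraticMap.polar R a b = B (s * a) (s * b) := by
      simp only [hBdef, QuadraticMap.polar, hR, mul_add]
    rw [FunLike.coe_add, QuadraticMap.polar_add, FunLike.coe_smul, QuadraticMap.polar_smul,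
      hR', hB, smul_eq_mul, ← hBs, add_mul, one_mul, smul_mul_assoc, ← mul_assoc]
    exact (QuadraticMap.polar_add_right Q a b _).symm
  refine ⟨AdjoinRoot p, inferInstance, inferInstance, rootMul p, Finset.univ, fun c => Q + c • R,
    hdiv, Finset.univ_nonempty, fun c _ => ⟨nondegenerate_polarBilin_iff.2 fun v hv => ?_,
    fun v => ?_⟩, ?_⟩
  · have h := hnd ((1 + c • (ι s * s)) * v) fun b => by
      rw [← hpol, QuadraticMap.polar_comm, hv]
    exact (hm c).mul_right_eq_zero.1 h
  · change Q (AdjoinRoot.root p * v) + c • Q (s * (AdjoinRoot.root p * v)) = Q v + c • Q (s * v)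
    rw [mul_left_comm, hQr, hQr]
  · -- All forms vanish on the multiples of `s ^ (k + 1)`, whose orthogonal space consists of the
    -- multiples of `s ^ (k - 1)`; on the latter, `R` vanishes at the multiples of `s ^ k`.
    refine sum_gaussSumOf_add_smul_eq_zero hψ
      (W := LinearMap.range (LinearMap.mulLeft F (s ^ (k + 1))))
      (P := LinearMap.ker (LinearMap.mulLeft F (s ^ (k + 1))))
      (P₀ := LinearMap.ker (LinearMap.mulLeft F (s ^ k))) (v₀ := s ^ k) ?_ ?_ ?_ ?_ ?_ ?_ ?_
    · rintro c _ ⟨b, rfl⟩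
      have h0 : ∀ b, Q (s ^ (k + 1) * b) = 0 := fun b => by
        rw [pow_succ', mul_assoc, hQs, hB, hιsp]
        rw [show s ^ k * u ^ k * (s * (s ^ k * b)) = u ^ k * s * b * s ^ (2 * k) by ring, hse,
          mul_zero, hB0, neg_zero]
      change Q (s ^ (k + 1) * b) + c • Q (s * (s ^ (k + 1) * b)) = 0
      rw [mul_left_comm, h0, h0, smul_zero, add_zero]
    · intro c v
      rw [LinearMap.mem_ker, LinearMap.mulLeft_apply]
      constructor
      · rintro hv _ ⟨b, rfl⟩
        rw [hpol, LinearMap.mulLeft_apply, hB, hιsp]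
        rw [show s ^ (k + 1) * u ^ (k + 1) * ((1 + c • (ι s * s)) * v) =
          u ^ (k + 1) * (1 + c • (ι s * s)) * (s ^ (k + 1) * v) by ring, hv, mul_zero, hB0]
      · intro hv
        have h := hnd (ι (s ^ (k + 1)) * ((1 + c • (ι s * s)) * v)) fun b => by
          rw [← hB, ← hpol]
          exact hv _ ⟨b, rfl⟩
        rw [hιsp, show s ^ (k + 1) * u ^ (k + 1) * ((1 + c • (ι s * s)) * v) =
          u ^ (k + 1) * ((1 + c • (ι s * s)) * (s ^ (k + 1) * v)) by ring] at h
        exact (hm c).mul_right_eq_zero.1 ((huu.pow _).mul_right_eq_zero.1 h)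
    · intro v hv
      rw [LinearMap.mem_ker, LinearMap.mulLeft_apply] at hv ⊢
      obtain ⟨w, hw⟩ : ∃ w, v = s ^ (k - 1) * w := by
        rw [hs] at hv ⊢
        obtain ⟨w, hw⟩ := exists_eq_pow_mul_of_pow_mul_eq_zero irreducible_X_add_one.ne_zero
          (by omega : k + 1 ≤ 2 * k) hv
        exact ⟨w, by rwa [show 2 * k - (k + 1) = k - 1 by omega] at hw⟩
      obtain ⟨d, hd⟩ := hsoc w
      have hkv : s ^ k * v = d • s ^ (2 * k - 1) := by
        rw [hw, ← hd, ← mul_assoc, ← pow_add, show k + (k - 1) = 2 * k - 1 by omega, mul_comm]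
      have hRv : R v = - (d * (d * B 1 (s ^ (2 * k - 1)))) := by
        have h4 : ι (s ^ (k - 1)) * (s * (s ^ (k - 1) * w)) = d • s ^ (2 * k - 1) := by
          rw [hιsp, ← hd, show s ^ (k - 1) * u ^ (k - 1) * (s * (s ^ (k - 1) * w)) =
            w * (s ^ (k - 1 + 1 + (k - 1)) * u ^ (k - 1)) by ring,
            show k - 1 + 1 + (k - 1) = 2 * k - 1 by omega, hsu]
        have h5 : ι w * s ^ (2 * k - 1) = d • s ^ (2 * k - 1) := by
          have := congrArg ι hd
          rwa [map_mul, hιsp, hsu, h1, hιsp, hsu] at this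
        rw [hR, hQs, hw, hB, h4, hBs]
        nth_rewrite 1 [← mul_one w]
        rw [hB, h5, hBs]
      rw [hRv, hkv, neg_eq_zero, mul_eq_zero, mul_eq_zero, smul_eq_zero]
      tauto
    · intro v hv
      rw [LinearMap.mem_ker, LinearMap.mulLeft_apply] at hv ⊢
      rw [pow_succ', mul_assoc, hv, mul_zero]
    · intro a ha b hb
      rw [LinearMap.mem_ker, LinearMap.mulLeft_apply] at ha hb
      obtain ⟨a', ha'⟩ : ∃ w, a = s ^ k * w := by
        rw [hs] at ha ⊢
        obtain ⟨w, hw⟩ := exists_eq_pow_mul_of_pow_mul_eq_zero irreducible_X_add_one.ne_zero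
          (by omega : k ≤ 2 * k) ha
        exact ⟨w, by rwa [show 2 * k - k = k by omega] at hw⟩
      rw [ha']
      refine (hB _ _ _).trans ?_
      rw [hιsp, mul_right_comm, hb, zero_mul, hB0]
    · rw [LinearMap.mem_ker, LinearMap.mulLeft_apply, ← pow_add, ← two_mul, hse]
    · obtain ⟨l, rfl⟩ : ∃ l, k = l + 1 := ⟨k - 1, by omega⟩
      rw [pow_succ', hQs, ← mul_one (s ^ l), hB, hιsp, mul_one,
        show s ^ l * u ^ l * (s * s ^ l) = s ^ (2 * l + 1) * u ^ l by ring,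
        show 2 * l + 1 = 2 * (l + 1) - 1 by omega, hsu]
      exact neg_ne_zero.2 hBz

/-- On the square of `F[X] / (X + 1) ^ (2 * k + 1)` the forms `S (a * ι b + b * ι b + c a * ι a)`
have cancelling Gauss sums. -/
lemma gaussSumsCancel_X_add_one_pow_odd_pair {ψ : AddChar F ℂ} (hψ : ψ ≠ 1) (k : ℕ) :
    GaussSumsCancel ψ {(X + 1 : F[X]) ^ (2 * k + 1), (X + 1) ^ (2 * k + 1)} := by
  classical
  have := Fintype.ofFinite F
  set p : F[X] := (X + 1) ^ (2 * k + 1) with hp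
  have hdiv : IsElementaryDivisors (rootMul p) {p} := isElementaryDivisors_rootMul
    ⟨X + 1, 2 * k + 1, monic_X_add_one, irreducible_X_add_one, by omega, rfl⟩
  have := hdiv.finiteDimensional
  have : Finite (AdjoinRoot p) := Module.finite_of_finite F
  obtain ⟨ι, s, u, h1, h2, h3, hs, hroot, hu, hιs, hse, hsu, hsoc⟩ :=
    exists_involution_X_add_one (F := F) (e := 2 * k + 1) (by omega) hp
  have h20 := adjoinRoot_two_eq_zero p
  rw [Nat.add_sub_cancel] at hsu hsoc
  have hz0 : s ^ (2 * k) ≠ 0 := by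
    rw [hs, ← map_pow, Ne, AdjoinRoot.mk_eq_zero, hp, pow_dvd_pow_iff
      irreducible_X_add_one.ne_zero irreducible_X_add_one.not_isUnit]
    omega
  obtain ⟨S, hS⟩ := exists_functional_ne_zero (F := F) hz0
  have hιsp : ∀ i, ι (s ^ i) = s ^ i * u ^ i := fun i => by rw [map_pow, hιs, mul_pow]
  have huu : IsUnit u := IsUnit.of_mul_eq_one (1 + s) (by rw [mul_comm, hu])
  have hιz : ι (s ^ (2 * k)) = s ^ (2 * k) := by rw [hιsp, hsu]
  have hιd : ∀ b (d : F), b * s ^ (2 * k) = d • s ^ (2 * k) →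
      ι b * s ^ (2 * k) = d • s ^ (2 * k) := fun b d hd => by
    have := congrArg ι hd
    rwa [map_mul, hιz, h1, hιz] at this
  -- `a + ι a` vanishes on the minimal ideal
  have hT : ∀ a, S (s ^ (2 * k) * a) + S (ι (s ^ (2 * k) * a)) = 0 := fun a => by
    obtain ⟨d, hd⟩ := hsoc a
    have hd' := hιd a d hd
    rw [map_mul ι, hιz, mul_comm _ a, hd, mul_comm _ (ι a), hd', ← map_add, ← two_smul F,
      CharTwo.two_eq_zero, zero_smul, map_zero]
  let β : (AdjoinRoot p × AdjoinRoot p) →ₗ[F] (AdjoinRoot p × AdjoinRoot p) →ₗ[F] F :=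
    LinearMap.mk₂ F (fun x y => S (x.1 * ι y.2) + S (x.2 * ι y.2))
    (fun x y z => by simp only [Prod.fst_add, Prod.snd_add, add_mul, map_add]; ring)
    (fun c x y => by simp only [Prod.smul_fst, Prod.smul_snd, smul_mul_assoc, map_smul, smul_add])
    (fun x y z => by simp only [Prod.snd_add, mul_add, map_add]; ring)
    (fun c x y => by
      simp only [Prod.smul_snd, h1, RingHom.id_apply, mul_smul_comm, map_smul, smul_add])
  let γ : (AdjoinRoot p × AdjoinRoot p) →ₗ[F] (AdjoinRoot p × AdjoinRoot p) →ₗ[F] F :=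
    LinearMap.mk₂ F (fun x y => S (x.1 * ι y.1))
    (fun x y z => by simp only [Prod.fst_add, add_mul, map_add])
    (fun c x y => by simp only [Prod.smul_fst, smul_mul_assoc, map_smul])
    (fun x y z => by simp only [Prod.fst_add, mul_add, map_add])
    (fun c x y => by simp only [Prod.smul_fst, h1, RingHom.id_apply, mul_smul_comm, map_smul])
  let Q : QuadraticForm F (AdjoinRoot p × AdjoinRoot p) := LinearMap.BilinMap.toQuadraticMap β
  let R : QuadraticForm F (AdjoinRoot p × AdjoinRoot p) := LinearMap.BilinMap.toQuadraticMap γ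
  have hQ : ∀ x, Q x = S (x.1 * ι x.2) + S (x.2 * ι x.2) := fun _ => rfl
  have hR : ∀ x, R x = S (x.1 * ι x.1) := fun _ => rfl
  have hQc : ∀ (c : F) (x), (Q + c • R) x = S (x.1 * ι x.2) + S (x.2 * ι x.2) +
      c * S (x.1 * ι x.1) := fun _ _ => rfl
  have hQpol : ∀ x y, QuadraticMap.polar Q x y =
      S (x.1 * ι y.2) + S (x.2 * ι y.2) + (S (y.1 * ι x.2) + S (y.2 * ι x.2)) := fun x y => by
    rw [LinearMap.BilinMap.polar_toQuadraticMap]; rfl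
  have hpol : ∀ (c : F) (x y), QuadraticMap.polar (Q + c • R) x y =
      S (x.1 * ι y.2) + S (x.2 * ι y.2) + (S (y.1 * ι x.2) + S (y.2 * ι x.2)) +
        c * (S (x.1 * ι y.1) + S (y.1 * ι x.1)) := fun c x y => by
    have hR' : QuadraticMap.polar R x y = S (x.1 * ι y.1) + S (y.1 * ι x.1) := by
      rw [LinearMap.BilinMap.polar_toQuadraticMap]; rfl
    rw [FunLike.coe_add, QuadraticMap.polar_add, FunLike.coe_smul, QuadraticMap.polar_smul,
      hR', hQpol, smul_eq_mul]
  have hpres : ∀ (c : F) (x : AdjoinRoot p × AdjoinRoot p),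
      (Q + c • R) (AdjoinRoot.root p • x) = (Q + c • R) x := fun c x => by
    simp only [hQc, Prod.smul_fst, Prod.smul_snd, smul_eq_mul, root_mul_mul_inversion h2]
  have hadj : ∀ (c : F) r (x y : AdjoinRoot p × AdjoinRoot p),
      QuadraticMap.polar (Q + c • R) (r • x) y =
      QuadraticMap.polar (Q + c • R) x (ι r • y) := fun c r x y =>
    form_smul_left (β := (Q + c • R).polarBilin) (fun a b => by
      simp only [QuadraticMap.polarBilin_apply_apply, QuadraticMap.polar, ← smul_add, hpres])
      h1 h2 r x y
  have hnd : ∀ (c : F) (x : AdjoinRoot p × AdjoinRoot p),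
      (∀ y, QuadraticMap.polar (Q + c • R) x y = 0) → x = 0 := by
    intro c x hx
    -- The radical is a submodule, so that a non-zero one contains a non-zero vector killed by `s`.
    have key : ∀ i, s ^ i • x = 0 := fun i => by
      by_contra hne
      let P : ℕ → Prop := fun i => s ^ i • x = 0
      have hex : ∃ i, P i := ⟨2 * k + 1, by simp only [P, hse, zero_smul]⟩
      obtain ⟨m, hm⟩ : ∃ m, Nat.find hex = m + 1 := Nat.exists_eq_succ_of_ne_zero fun h0 => by
        have h := Nat.find_spec hex
        rw [h0] at h
        simp only [P, pow_zero, one_smul] at h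
        exact hne (by rw [h, smul_zero])
      have hm1 : s ^ (m + 1) • x = 0 := hm ▸ Nat.find_spec hex
      have hm0 : s ^ m • x ≠ 0 := Nat.find_min hex (by omega : m < Nat.find hex)
      have hline : ∀ a, s * a = 0 → ∃ d : F, a = d • s ^ (2 * k) := fun a ha => by
        obtain ⟨b, hb⟩ : ∃ b, a = s ^ (2 * k) * b := by
          rw [hs] at ha ⊢
          exact exists_eq_pow_mul_of_pow_mul_eq_zero irreducible_X_add_one.ne_zero
            (by omega : 1 ≤ 2 * k + 1) (by rwa [pow_one])
        obtain ⟨d, hd⟩ := hsoc b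
        exact ⟨d, by rw [hb, mul_comm, hd]⟩
      have hsm : s • s ^ m • x = 0 := by rwa [smul_smul, ← pow_succ']
      obtain ⟨d, hd⟩ := hline (s ^ m • x).1 (congrArg Prod.fst hsm)
      obtain ⟨d', hd'⟩ := hline (s ^ m • x).2 (congrArg Prod.snd hsm)
      have h0 : ∀ y, QuadraticMap.polar (Q + c • R) (s ^ m • x) y = 0 := fun y => by
        rw [hadj, hx]
      have e1 := h0 (1, 0)
      have e2 := h0 (0, 1)
      have hT1 := hT 1
      rw [mul_one, hιz] at hT1
      simp only [hpol, hd, hd', map_zero, mul_zero, map_one, mul_one, zero_mul, one_mul, h1,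
        RingHom.id_apply, hιz, map_smul, smul_eq_mul, zero_add, add_zero] at e1 e2
      have hd0 : d' = 0 := by
        have : d' * S (s ^ (2 * k)) = 0 := by linear_combination e1 - c * d * hT1
        exact (mul_eq_zero.1 this).resolve_right hS
      have hd1 : d = 0 := by
        have : d * S (s ^ (2 * k)) = 0 := by linear_combination e2 - d' * hT1
        exact (mul_eq_zero.1 this).resolve_right hS
      exact hm0 (Prod.ext (by rw [hd, hd1, zero_smul]; rfl) (by rw [hd', hd0, zero_smul]; rfl))
    simpa using key 0
  have hann : ∀ i, i ≤ 2 * k + 1 → ∀ a, s ^ i * a = 0 → ∃ b, a = s ^ (2 * k + 1 - i) * b :=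
    fun i hi a ha => by
      rw [hs] at ha ⊢
      exact exists_eq_pow_mul_of_pow_mul_eq_zero irreducible_X_add_one.ne_zero hi ha
  have hann1 : ∀ a, s ^ (k + 1) * a = 0 → ∃ b, a = s ^ k * b := fun a ha => by
    have := hann (k + 1) (by omega) a ha
    rwa [show 2 * k + 1 - (k + 1) = k by omega] at this
  have hann0 : ∀ a, s ^ k * a = 0 → ∃ b, a = s ^ (k + 1) * b := fun a ha => by
    have := hann k (by omega) a ha
    rwa [show 2 * k + 1 - k = k + 1 by omega] at this
  have hprod : ∀ a b, s ^ k * a * ι (s ^ k * b) = s ^ (2 * k) * (a * ι b) := fun a b => by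
    rw [map_mul, hιsp, show s ^ k * a * (s ^ k * u ^ k * ι b) = s ^ (2 * k) * u ^ k * (a * ι b) by
      ring, hsu]
  have hprod0 : ∀ a b, s ^ (k + 1) * a * ι (s ^ k * b) = 0 := fun a b => by
    rw [pow_succ', mul_assoc, mul_assoc, ← mul_assoc (s ^ k), hprod, ← mul_assoc, ← pow_succ',
      hse, zero_mul]
  have hprod0' : ∀ a b, s ^ k * a * ι (s ^ (k + 1) * b) = 0 := fun a b => by
    have := congrArg ι (hprod0 b a)
    rwa [map_mul, h3, map_zero, mul_comm] at this
  refine ⟨AdjoinRoot p × AdjoinRoot p, inferInstance, inferInstance,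
    (rootMul p).prodMap (rootMul p), Finset.univ, fun c => Q + c • R,
    hdiv.add hdiv, Finset.univ_nonempty,
    fun c _ => ⟨nondegenerate_polarBilin_iff.2 (hnd c), hpres c⟩, ?_⟩
  let mul := fun r r' : AdjoinRoot p => (LinearMap.mulLeft F r).prodMap (LinearMap.mulLeft F r')
  have hmem : ∀ r r' x, x ∈ LinearMap.ker (mul r r') ↔ r * x.1 = 0 ∧ r' * x.2 = 0 :=
    fun r r' x => by
      rw [LinearMap.mem_ker]
      exact Prod.ext_iff
  -- All forms vanish on the multiples of `s ^ (k + 1)`, whose orthogonal space consists of the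
  -- multiples of `s ^ k`; on the latter, `R` vanishes where the first component is a multiple of
  -- `s ^ (k + 1)`.
  refine sum_gaussSumOf_add_smul_eq_zero hψ
    (W := LinearMap.range (mul (s ^ (k + 1)) (s ^ (k + 1))))
    (P := LinearMap.ker (mul (s ^ (k + 1)) (s ^ (k + 1))))
    (P₀ := LinearMap.ker (mul (s ^ k) (s ^ (k + 1)))) (v₀ := (0, s ^ k)) ?_ ?_ ?_ ?_ ?_ ?_ ?_
  · rintro c _ ⟨b, rfl⟩
    have h0 : ∀ a b, s ^ (k + 1) * a * ι (s ^ (k + 1) * b) = 0 := fun a b => by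
      nth_rewrite 2 [pow_succ]
      rw [mul_assoc (s ^ k), hprod0]
    change S (s ^ (k + 1) * b.1 * ι (s ^ (k + 1) * b.2)) +
      S (s ^ (k + 1) * b.2 * ι (s ^ (k + 1) * b.2)) +
      c * S (s ^ (k + 1) * b.1 * ι (s ^ (k + 1) * b.1)) = 0
    simp only [h0, map_zero, mul_zero, add_zero]
  · intro c v
    have hι0 : ι (s ^ (k + 1)) • v = 0 ↔ s ^ (k + 1) • v = 0 := by
      rw [hιsp, mul_comm, mul_smul, (huu.pow _).smul_eq_zero]
    have hker : v ∈ LinearMap.ker (mul (s ^ (k + 1)) (s ^ (k + 1))) ↔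
        s ^ (k + 1) • v = 0 := LinearMap.mem_ker
    rw [hker, ← hι0]
    constructor
    · rintro hv _ ⟨b, rfl⟩
      change QuadraticMap.polar (Q + c • R) (s ^ (k + 1) • b) v = 0
      rw [hadj, hv]
      exact QuadraticMap.polar_zero_right _ _
    · intro hv
      refine hnd c _ fun b => ?_
      rw [QuadraticMap.polar_comm, ← hadj]
      exact hv _ ⟨b, rfl⟩
  · intro v hv
    rw [hmem] at hv ⊢
    obtain ⟨b, hb⟩ := hann1 _ hv.1
    obtain ⟨d, hd⟩ := hsoc b
    have e1 : s ^ k * v.1 = d • s ^ (2 * k) := by rw [hb, ← hd]; ring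
    have e2 : R v = d * (d * S (s ^ (2 * k))) := by
      rw [hR, hb, hprod, ← mul_assoc, mul_comm _ b, hd, smul_mul_assoc, mul_comm, hιd b d hd,
        map_smul, map_smul, smul_eq_mul, smul_eq_mul]
    rw [e1, e2, mul_eq_zero, mul_eq_zero, smul_eq_zero]
    tauto
  · intro v hv
    rw [hmem] at hv ⊢
    exact ⟨by rw [pow_succ', mul_assoc, hv.1, mul_zero], hv.2⟩
  · intro x hx y hy
    rw [hmem] at hx hy
    obtain ⟨a, ha⟩ := hann0 _ hx.1
    obtain ⟨b, hb⟩ := hann1 _ hx.2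
    obtain ⟨a', ha'⟩ := hann0 _ hy.1
    obtain ⟨b', hb'⟩ := hann1 _ hy.2
    have h4 := hT (b * ι b')
    rw [hQpol, ha, hb, ha', hb', hprod0, hprod0, hprod, hprod, map_zero, zero_add, zero_add, ← h4]
    congr 2
    rw [map_mul, map_mul, hιz, h3, mul_comm b']
  · rw [hmem]
    refine ⟨mul_zero _, ?_⟩
    change s ^ (k + 1) * s ^ k = 0
    rw [← pow_add, show k + 1 + k = 2 * k + 1 by omega, hse]
  · have := hprod 1 1
    rw [mul_one, map_one, mul_one, mul_one] at this
    rw [hQ]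
    change S (0 * _) + S (s ^ k * ι (s ^ k)) ≠ 0
    rwa [zero_mul, map_zero, zero_add, this]

end Cancel

end FormIsometry

namespace FormIsometry

universe u

/-! ### Parity of multiplicities -/

section Parity

variable {F V : Type u} [Field F] [AddCommGroup V] [Module F V]

/-- The rank of an alternating form is even: a maximal totally isotropic subspace is its own
orthogonal space. -/
lemma even_finrank_add_finrank_ker [FiniteDimensional F V] {β : V →ₗ[F] V →ₗ[F] F}
    (hβ : ∀ v, β v v = 0) :
    Even (Module.finrank F V + Module.finrank F (LinearMap.ker β)) := by
  classical
  have hneg : ∀ u v, β u v = - β v u := fun u v => by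
    have h := hβ (u + v)
    simp only [map_add, LinearMap.add_apply, hβ, zero_add, add_zero] at h
    linear_combination h
  let p : ℕ → Prop := fun d =>
    ∃ W : Submodule F V, (∀ u ∈ W, ∀ v ∈ W, β u v = 0) ∧ Module.finrank F W = d
  have h0 : p 0 := ⟨⊥, by simp, by simp⟩
  obtain ⟨W, hW, hd⟩ := Nat.findGreatest_spec (P := p) (Nat.zero_le (Module.finrank F V)) h0
  have hmax : ∀ v, (∀ w ∈ W, β w v = 0) → v ∈ W := by
    intro v hv
    have h1 : ∀ x ∈ W ⊔ Submodule.span F {v}, ∀ y ∈ W ⊔ Submodule.span F {v}, β x y = 0 := by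
      intro x hx y hy
      obtain ⟨w, hw, x', hx', rfl⟩ := Submodule.mem_sup.1 hx
      obtain ⟨w', hw', y', hy', rfl⟩ := Submodule.mem_sup.1 hy
      obtain ⟨c, rfl⟩ := Submodule.mem_span_singleton.1 hx'
      obtain ⟨d, rfl⟩ := Submodule.mem_span_singleton.1 hy'
      have : β v w' = 0 := by rw [hneg, hv w' hw', neg_zero]
      simp [hW w hw w' hw', hv w hw, this, hβ]
    have h2 : W = W ⊔ Submodule.span F {v} :=
      Submodule.eq_of_le_of_finrank_le le_sup_left
        (hd ▸ Nat.le_findGreatest (Submodule.finrank_le _) ⟨_, h1, rfl⟩)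
    rw [h2]
    exact Submodule.mem_sup_right (Submodule.mem_span_singleton_self v)
  have horth : LinearMap.BilinForm.orthogonal β W = W := by
    ext v
    exact ⟨fun h => hmax v h, fun hv w hw => hW w hw v hv⟩
  have hker : W ⊓ LinearMap.ker β = LinearMap.ker β := by
    refine inf_eq_right.2 fun v hv => hmax v fun w _ => ?_
    rw [hneg, LinearMap.mem_ker.1 hv, LinearMap.zero_apply, neg_zero]
  have h := LinearMap.BilinForm.finrank_add_finrank_orthogonal' (B := β) W
  rw [horth, hker] at h
  exact ⟨_, h.symm⟩

variable {φ : V →ₗ[F] V}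

/-- For `c = ± 1` the map `φ - c` is adjoint to a multiple of itself up to a power of `φ`. -/
lemma form_aeval_linear_pow {β : V →ₗ[F] V →ₗ[F] F} (hβ : ∀ u v, β (φ u) (φ v) = β u v) {c : F}
    (hc : c * c = 1) (j : ℕ) (x y : V) :
    β (aeval φ ((X - C c) ^ j) x) ((φ ^ j) y) = (-c) ^ j * β x (aeval φ ((X - C c) ^ j) y) := by
  have hN : ∀ x, aeval φ (X - C c) x = φ x - c • x := fun x => by
    simp [Module.algebraMap_end_apply]
  have h1 : ∀ x y, β (aeval φ (X - C c) x) (φ y) = -c * β x (aeval φ (X - C c) y) := fun x y => by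
    rw [hN, hN]
    simp only [map_sub, LinearMap.sub_apply, map_smul, LinearMap.smul_apply, hβ, smul_eq_mul]
    linear_combination -β x y * hc
  induction j generalizing x y with
  | zero => simp
  | succ j ih =>
    have h2 : aeval φ (X - C c) ((φ ^ j) y) = (φ ^ j) (aeval φ (X - C c) y) := by
      have : φ ^ j = aeval φ (X ^ j : F[X]) := by simp
      rw [this, ← Module.End.mul_apply, ← Module.End.mul_apply, ← map_mul, ← map_mul, mul_comm]
    have h3 : aeval φ ((X - C c) ^ (j + 1)) y =
        aeval φ ((X - C c) ^ j) (aeval φ (X - C c) y) := by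
      rw [pow_succ, map_mul, Module.End.mul_apply]
    rw [h3, pow_succ' (X - C c), map_mul, Module.End.mul_apply, pow_succ' φ, Module.End.mul_apply,
      h1, h2, ih, pow_succ]
    ring

variable [FiniteDimensional F V]

open Classical in
/-- The alternating form `β (u, v)` on the image of `(φ - c) ^ j` has even rank, and its rank is
that of `(φ - c) ^ (2 * j)`; the multiplicity is a second difference of such ranks, up to an even
number. -/
lemma count_even_of_alternating (hφ : Function.Surjective φ)
    {β : V →ₗ[F] V →ₗ[F] F} (hβ : ∀ u v, β (φ u) (φ v) = β u v)
    (hnd : LinearMap.Nondegenerate β) (halt : ∀ v, β v v = 0) {c : F} (hc : c * c = 1)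
    {s : Multiset F[X]} (hs : IsElementaryDivisors φ s) (k : ℕ) :
    Even (s.count ((X - C c) ^ (2 * k + 1))) := by
  have key : ∀ j, Even (Module.finrank F V + nul φ ((X - C c) ^ (2 * j))) := fun j => by
    set N := aeval φ ((X - C c) ^ j) with hN
    have h := even_finrank_add_finrank_ker (β := β.compl₁₂ N N) fun v => halt _
    have hker : LinearMap.ker (β.compl₁₂ N N) =
        LinearMap.ker (aeval φ ((X - C c) ^ (2 * j))) := by
      ext u
      rw [LinearMap.mem_ker, LinearMap.mem_ker, two_mul, pow_add, map_mul, Module.End.mul_apply]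
      have h1 : ∀ v, β (N (N u)) ((φ ^ j) v) = (-c) ^ j * β (N u) (N v) := fun v =>
        form_aeval_linear_pow hβ hc j _ _
      have hcj : (-c) ^ j ≠ 0 := pow_ne_zero _ (neg_ne_zero.2 (left_ne_zero_of_mul_eq_one hc))
      constructor
      · intro hu
        refine hnd.1 _ fun v => ?_
        obtain ⟨w, rfl⟩ : ∃ w, (φ ^ j) w = v := by
          rw [Module.End.coe_pow]
          exact hφ.iterate j v
        rw [h1]
        have := LinearMap.congr_fun hu w
        rw [LinearMap.compl₁₂_apply, LinearMap.zero_apply] at this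
        rw [this, mul_zero]
      · intro hu
        ext v
        have := h1 v
        rw [hu, map_zero, LinearMap.zero_apply] at this
        exact (mul_eq_zero.1 this.symm).resolve_left hcj
    rwa [hker] at h
  have h := hs.two_mul_nul (monic_X_sub_C c) (irreducible_X_sub_C c) isCoprime_one_left (2 * k)
  have h1 := key k
  have h2 := key (k + 1)
  rw [show 2 * (k + 1) = 2 * k + 2 by ring] at h2
  simp only [mul_one, natDegree_X_sub_C, one_mul] at h
  rw [Nat.even_iff] at *
  omega

open Classical in
/-- The form `β (u, φ v) - β (φ u, v)` on the image of `(φ - c) ^ j` is alternating, and its rank is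
that of `(φ - c) ^ (2 * j + 1) * (φ + c)`; the multiplicity is a second difference of such ranks, up
to an even number. -/
lemma count_even_of_symmetric (h2 : (2 : F) ≠ 0) (hφ : Function.Surjective φ)
    {β : V →ₗ[F] V →ₗ[F] F} (hβ : ∀ u v, β (φ u) (φ v) = β u v)
    (hnd : LinearMap.Nondegenerate β) (hsymm : ∀ u v, β u v = β v u) {c : F} (hc : c * c = 1)
    {s : Multiset F[X]} (hs : IsElementaryDivisors φ s) (k : ℕ) :
    Even (s.count ((X - C c) ^ (2 * k + 2))) := by
  have hfac : ∀ j, (X - C c) ^ (2 * j + 1) * (X + C c) = (X ^ 2 - 1) * (X - C c) ^ j *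
      (X - C c) ^ j := fun j => by
    have : (C c * C c : F[X]) = 1 := by rw [← C_mul, hc, C_1]
    linear_combination -(X - C c) ^ (2 * j) * this
  have key : ∀ j, Even (Module.finrank F V + nul φ ((X - C c) ^ (2 * j + 1) * (X + C c))) :=
      fun j => by
    set N := aeval φ ((X - C c) ^ j) with hN
    have hcomm : ∀ v, N (φ v) = φ (N v) := fun v => by
      have h : aeval φ ((X - C c) ^ j * X) v = aeval φ (X * (X - C c) ^ j) v := by rw [mul_comm]
      simpa only [map_mul, aeval_X, Module.End.mul_apply] using h
    have h := even_finrank_add_finrank_ker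
      (β := β.compl₁₂ N (φ ∘ₗ N) - β.compl₁₂ (φ ∘ₗ N) N) fun v => by
        simp [hsymm (φ (N v))]
    have hker : LinearMap.ker (β.compl₁₂ N (φ ∘ₗ N) - β.compl₁₂ (φ ∘ₗ N) N) =
        LinearMap.ker (aeval φ ((X - C c) ^ (2 * j + 1) * (X + C c))) := by
      ext u
      have h3 : ∀ x, aeval φ (X ^ 2 - 1 : F[X]) x = φ (φ x) - x := fun x => by
        simp [pow_two]
      have h4 : aeval φ ((X - C c) ^ (2 * j + 1) * (X + C c)) u = N (φ (φ (N u)) - N u) := by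
        rw [hfac, mul_comm, map_mul, map_mul, Module.End.mul_apply, Module.End.mul_apply, h3]
      rw [LinearMap.mem_ker, LinearMap.mem_ker, h4]
      have h1 : ∀ v, β (N (φ (φ (N u)) - N u)) ((φ ^ j) (φ v)) =
          (-c) ^ j * (β (φ (N u)) (N v) - β (N u) (φ (N v))) := fun v => by
        rw [form_aeval_linear_pow hβ hc j, hcomm, map_sub, LinearMap.sub_apply, hβ]
      have hcj : (-c) ^ j ≠ 0 := pow_ne_zero _ (neg_ne_zero.2 (left_ne_zero_of_mul_eq_one hc))
      constructor
      · intro hu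
        refine hnd.1 _ fun v => ?_
        obtain ⟨w, rfl⟩ : ∃ w, (φ ^ j) w = v := by
          rw [Module.End.coe_pow]
          exact hφ.iterate j v
        obtain ⟨w, rfl⟩ := hφ w
        have := LinearMap.congr_fun hu w
        simp only [LinearMap.sub_apply, LinearMap.compl₁₂_apply, LinearMap.comp_apply,
          LinearMap.zero_apply] at this
        rw [h1, ← neg_sub, this, neg_zero, mul_zero]
      · intro hu
        ext v
        have := h1 v
        rw [hu, map_zero, LinearMap.zero_apply] at this
        have h5 := (mul_eq_zero.1 this.symm).resolve_left hcj
        simp only [LinearMap.sub_apply, LinearMap.compl₁₂_apply, LinearMap.comp_apply,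
          LinearMap.zero_apply]
        rw [← neg_sub, h5, neg_zero]
    rwa [hker] at h
  have hcop : IsCoprime (X + C c) (X - C c) := by
    have := isCoprime_X_sub_C_of_isUnit_sub (a := -c) (b := c)
      (isUnit_iff_ne_zero.2 fun h => by
        have : 2 * c = 0 := by linear_combination -h
        exact (mul_ne_zero h2 (left_ne_zero_of_mul_eq_one hc)) this)
    rwa [C_neg, sub_neg_eq_add] at this
  have h := hs.two_mul_nul (monic_X_sub_C c) (irreducible_X_sub_C c) hcop (2 * k + 1)
  have h1 := key k
  have h3 := key (k + 1)
  rw [show 2 * (k + 1) + 1 = 2 * k + 1 + 2 by ring] at h3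
  rw [show 2 * k + 1 + 1 = 2 * k + 2 by ring] at h
  simp only [natDegree_X_sub_C, one_mul] at h
  rw [Nat.even_iff] at *
  omega

end Parity

end FormIsometry

namespace FormIsometry

universe u

/-! ### Realization of multisets of elementary divisors -/

section Realization

variable {F : Type u} [Field F]

open Classical in
/-- The multiplicities in `s` are invariant under the duality of polynomials; all members of `s`
are powers of monic irreducible polynomials other than `X`. -/
def IsDualInvariant (σ : F →+* F) (s : Multiset F[X]) : Prop :=
  (∀ p ∈ s, IsMonicPrimePow p ∧ p.coeff 0 ≠ 0) ∧
    ∀ p, IsMonicPrimePow p ∧ p.coeff 0 ≠ 0 → s.count (sdual σ p) = s.count p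

open Classical in
lemma IsDualInvariant.of_isSelfDual {σ : F →+* F} (hσ : ∀ x, σ (σ x) = x) {V : Type*}
    [AddCommGroup V] [Module F V] {φ : V →ₗ[F] V} (hφ : Function.Injective φ)
    (hd : IsSelfDual σ φ) {s : Multiset F[X]} (hs : IsElementaryDivisors φ s) :
    IsDualInvariant σ s :=
  ⟨fun _ hp => ⟨hs.isMonicPrimePow hp, hs.coeff_zero_ne_zero hφ hp⟩,
    fun _ hp => hd.count_sdual hσ hs hp.1 hp.2⟩

open Classical in
lemma IsDualInvariant.of_add {σ : F →+* F} {s t : Multiset F[X]} (hs : IsDualInvariant σ s)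
    (hst : IsDualInvariant σ (s + t)) : IsDualInvariant σ t := by
  refine ⟨fun p hp => hst.1 p (Multiset.mem_add.2 (Or.inr hp)), fun p hp => ?_⟩
  have h1 := hs.2 p hp
  have h2 := hst.2 p hp
  rw [Multiset.count_add, Multiset.count_add] at h2
  omega

open Classical in
lemma isDualInvariant_singleton {p : F[X]} (hp : IsMonicPrimePow p) (h0 : p.coeff 0 ≠ 0)
    (hd : dual p = p) : IsDualInvariant (RingHom.id F) {p} := by
  refine ⟨fun q hq => ?_, fun q hq => ?_⟩
  · rw [Multiset.mem_singleton.1 hq]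
    exact ⟨hp, h0⟩
  · rw [Multiset.count_singleton, Multiset.count_singleton, sdual_id]
    refine if_congr ⟨fun h => ?_, fun h => by rw [h, hd]⟩ rfl rfl
    rw [← dual_dual hq.2 hq.1.monic, h, hd]

open Classical in
lemma IsDualInvariant.add {σ : F →+* F} {s t : Multiset F[X]} (hs : IsDualInvariant σ s)
    (ht : IsDualInvariant σ t) : IsDualInvariant σ (s + t) := by
  refine ⟨fun p hp => (Multiset.mem_add.1 hp).elim (hs.1 p) (ht.1 p), fun p hp => ?_⟩
  rw [Multiset.count_add, Multiset.count_add, hs.2 p hp, ht.2 p hp]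

lemma IsDualInvariant.hermitianRealizes {σ : F →+* F} (hσ : ∀ x, σ (σ x) = x)
    (hne : ∃ x, σ x ≠ x) {s : Multiset F[X]} (hs : IsDualInvariant σ s) :
    HermitianRealizes σ s := by
  classical
  refine multiset_induction_of_involution (sdual σ) (fun p => IsMonicPrimePow p ∧ p.coeff 0 ≠ 0)
    (fun _ => True) (HermitianRealizes σ) (fun p hp => sdual_sdual hσ hp.2 hp.1.monic) (.zero σ)
    (fun _ _ h h' => h.add h') (fun p hp => hermitianRealizes_pair hσ hp.1 hp.2)
    (fun p hp hd _ => hermitianRealizes_singleton hσ hne hp.1 hp.2 hd) s hs.1 ?_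
    (fun _ _ _ h => absurd trivial h)
  convert hs.2

lemma dual_X_sub_one : dual (X - 1 : F[X]) = X - 1 := by
  have h : (X - 1 : F[X]) = X + C (-1) := by rw [C_neg, C_1, sub_eq_add_neg]
  have hr : (X + C (-1) : F[X]).reverse = 1 - X := by
    have hd : (X + C (-1) : F[X]).natDegree = 1 := natDegree_X_add_C _
    ext i
    rw [coeff_reverse, hd]
    rcases i with _ | _ | i
    · simp [revAt_le, coeff_one]
    · simp [revAt_le, coeff_one]
    · have hr : revAt 1 (i + 1 + 1) = i + 1 + 1 := revAt_eq_self_of_lt (by omega)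
      rw [hr]
      simp [coeff_one, coeff_X]
  rw [dual, h, hr, ← h]
  simp

lemma X_sub_one_eq : (X - 1 : F[X]) = X - C 1 := by rw [C_1]

lemma X_add_one_eq : (X + 1 : F[X]) = X - C (-1) := by rw [C_neg, C_1, sub_neg_eq_add]

/-- The irreducible polynomials `X - 1` and `X + 1` are the self-dual polynomials of degree one. -/
lemma eq_X_sub_C_of_eq {f : F[X]} (hf : f = X - 1 ∨ f = X + 1) :
    ∃ c : F, c * c = 1 ∧ f = X - C c ∧ dual f = f ∧ f.Monic ∧ Irreducible f := by
  rcases hf with rfl | rfl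
  · exact ⟨1, one_mul 1, X_sub_one_eq, dual_X_sub_one, X_sub_one_eq (F := F) ▸ monic_X_sub_C 1,
      X_sub_one_eq (F := F) ▸ irreducible_X_sub_C 1⟩
  · exact ⟨-1, by ring, X_add_one_eq, dual_X_add_one, X_add_one_eq (F := F) ▸ monic_X_sub_C (-1),
      X_add_one_eq (F := F) ▸ irreducible_X_sub_C (-1)⟩

lemma coeff_zero_pow_ne_zero_of_eq {f : F[X]} (hf : f = X - 1 ∨ f = X + 1) (e : ℕ) :
    (f ^ e).coeff 0 ≠ 0 := by
  rcases hf with rfl | rfl <;> simp [coeff_zero_eq_eval_zero]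

lemma isDualInvariant_singleton_pow {f : F[X]} (hf : f = X - 1 ∨ f = X + 1) {e : ℕ} (he : 0 < e) :
    IsDualInvariant (RingHom.id F) {f ^ e} := by
  obtain ⟨c, -, -, hd, hm, hi⟩ := eq_X_sub_C_of_eq hf
  exact isDualInvariant_singleton ⟨f, e, hm, hi, he, rfl⟩ (coeff_zero_pow_ne_zero_of_eq hf e)
    (by rw [dual_pow, hd])

lemma two_ne_zero_of_not_charP (h : ¬ CharP F 2) : (2 : F) ≠ 0 := fun h2 =>
  h (CharTwo.of_one_ne_zero_of_two_eq_zero one_ne_zero h2)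

/-- An even power of `X - 1` or `X + 1` belongs to a cyclic isometry of an alternating form. In odd
characteristic the inversion negates the minimal ideal; in characteristic two the polar form of a
quadratic form is used. -/
lemma alternatingRealizes_singleton_even [Finite F] {f : F[X]} (hf : f = X - 1 ∨ f = X + 1) {e : ℕ}
    (he : 0 < e) (heven : Even e) : AlternatingRealizes {f ^ e} := by
  obtain ⟨c, hc, hfc, hd, hm, hi⟩ := eq_X_sub_C_of_eq hf
  by_cases h2 : CharP F 2
  · obtain ⟨k, rfl⟩ := heven.exists_two_nsmul
    have hf1 : f = X + 1 := hf.elim (fun h => by rw [h, X_add_one_eq_X_sub_one]) id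
    rw [hf1, smul_eq_mul]
    obtain ⟨Q, hQ, hQr⟩ := exists_quadraticForm_X_add_one_pow (F := F) (k := k)
      (by rw [smul_eq_mul] at he; omega) rfl
    exact QuadraticRealizes.alternatingRealizes ⟨_, inferInstance, inferInstance, _, Q,
      isElementaryDivisors_rootMul ⟨X + 1, 2 * k, monic_X_add_one, irreducible_X_add_one,
        by simpa using he, rfl⟩, hQ, hQr⟩
  · obtain ⟨ι, h1, h2', h3⟩ := exists_involution (σ := RingHom.id F) (fun _ => rfl)
      (coeff_zero_pow_ne_zero_of_eq hf e) (by rw [sdual_id, dual_pow, hd])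
    refine alternatingRealizes_singleton_of_ne hm hi he h1 h2' h3 (r := 1) ?_
    have h4 := inversion_socle_linear hc he (by rw [hfc]) h1 h2'
    rw [← hfc, (Nat.Even.sub_odd he heven odd_one).neg_one_pow] at h4
    rw [mul_one, h4, neg_one_mul]
    intro h5
    have h6 : (2 : F) • AdjoinRoot.mk (f ^ e) (f ^ (e - 1)) = 0 := by
      rw [two_smul]
      nth_rewrite 1 [← h5]
      exact neg_add_cancel _
    exact (smul_ne_zero (two_ne_zero_of_not_charP h2) (socle_ne_zero hi he)) h6

/-- In odd characteristic an odd power of `X - 1` or `X + 1` belongs to a cyclic isometry of a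
quadratic form, as the inversion fixes the minimal ideal. -/
lemma quadraticRealizes_singleton_odd (h2 : ¬ CharP F 2) {f : F[X]}
    (hf : f = X - 1 ∨ f = X + 1) {e : ℕ} (hodd : Odd e) : QuadraticRealizes {f ^ e} := by
  obtain ⟨c, hc, hfc, hd, hm, hi⟩ := eq_X_sub_C_of_eq hf
  obtain ⟨ι, h1, h2', h3⟩ := exists_involution (σ := RingHom.id F) (fun _ => rfl)
    (coeff_zero_pow_ne_zero_of_eq hf e) (by rw [sdual_id, dual_pow, hd])
  refine quadraticRealizes_singleton_of_ne hm hi hodd.pos h1 h2' h3 (r := 1) ?_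
  have h4 := inversion_socle_linear hc hodd.pos (by rw [hfc]) h1 h2'
  rw [← hfc, (Nat.Odd.sub_odd hodd odd_one).neg_one_pow] at h4
  rw [mul_one, h4, one_mul, ← two_smul F]
  exact smul_ne_zero (two_ne_zero_of_not_charP h2) (socle_ne_zero hi hodd.pos)

/-- A self-dual irreducible polynomial is `X - 1`, `X + 1`, or of degree greater than one. -/
lemma eq_or_one_lt_natDegree {f : F[X]} {e : ℕ} (hf : f.Monic) (hi : Irreducible f) (he : 0 < e)
    (h0 : (f ^ e).coeff 0 ≠ 0) (hd : sdual (RingHom.id F) (f ^ e) = f ^ e) :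
    (f = X - 1 ∨ f = X + 1) ∨ 1 < f.natDegree := by
  have hf0 := coeff_zero_ne_zero_of_dvd h0 (dvd_pow_self f he.ne')
  rw [sdual_id] at hd
  have hpos := hi.natDegree_pos
  rcases Nat.eq_or_lt_of_le (show 1 ≤ f.natDegree from hpos) with h | h
  · exact Or.inl (eq_X_sub_one_or_eq_X_add_one hf hf0 h.symm (dual_base_eq hf hi he hf0 hd))
  · exact Or.inr h

open Classical in
lemma IsDualInvariant.alternatingRealizes [Finite F] {s : Multiset F[X]}
    (hs : IsDualInvariant (RingHom.id F) s)
    (heven : ∀ k, Even (s.count ((X - 1) ^ (2 * k + 1))) ∧ Even (s.count ((X + 1) ^ (2 * k + 1)))) :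
    AlternatingRealizes s := by
  refine multiset_induction_of_involution (sdual (RingHom.id F))
    (fun p => IsMonicPrimePow p ∧ p.coeff 0 ≠ 0)
    (fun p => ¬ ∃ k, p = (X - 1) ^ (2 * k + 1) ∨ p = (X + 1) ^ (2 * k + 1)) AlternatingRealizes
    (fun p hp => sdual_sdual (fun _ => rfl) hp.2 hp.1.monic) .zero (fun _ _ h h' => h.add h')
    (fun p hp => by rw [sdual_id]; exact alternatingRealizes_pair hp.1 hp.2) ?_ s hs.1
    hs.2 (fun p _ _ h => ?_)
  · rintro p ⟨⟨f, e, hf, hi, he, rfl⟩, h0⟩ hd hC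
    rcases eq_or_one_lt_natDegree hf hi he h0 hd with hf1 | hdeg
    · refine alternatingRealizes_singleton_even hf1 he (Nat.not_odd_iff_even.1 ?_)
      rintro ⟨k, rfl⟩
      exact hC ⟨k, hf1.imp (fun h => by rw [h]) (fun h => by rw [h])⟩
    · obtain ⟨ι, h1, h2, h3⟩ := exists_involution (σ := RingHom.id F) (fun _ => rfl) h0 hd
      obtain ⟨r, hr⟩ := exists_socle_ne_smul hi hdeg he h2 (one_ne_zero (α := F))
      exact alternatingRealizes_singleton_of_ne hf hi he h1 h2 h3 (r := r) (by rwa [one_smul] at hr)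
  · obtain ⟨k, rfl | rfl⟩ := not_not.1 h
    · exact (heven k).1
    · exact (heven k).2

lemma quadraticRealizes_singleton_of_one_lt_natDegree {f : F[X]} {e : ℕ} (hf : f.Monic)
    (hi : Irreducible f) (he : 0 < e) (hdeg : 1 < f.natDegree) (h0 : (f ^ e).coeff 0 ≠ 0)
    (hd : sdual (RingHom.id F) (f ^ e) = f ^ e) : QuadraticRealizes {f ^ e} := by
  obtain ⟨ι, h1, h2, h3⟩ := exists_involution (σ := RingHom.id F) (fun _ => rfl) h0 hd
  obtain ⟨r, hr⟩ := exists_socle_ne_smul hi hdeg he h2 (neg_ne_zero.2 (one_ne_zero (α := F)))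
  refine quadraticRealizes_singleton_of_ne hf hi he h1 h2 h3 (r := r) fun h => hr ?_
  rw [neg_smul, one_smul]
  exact eq_neg_of_add_eq_zero_right h

open Classical in
lemma IsDualInvariant.quadraticRealizes_of_odd (h2 : ¬ CharP F 2) {s : Multiset F[X]}
    (hs : IsDualInvariant (RingHom.id F) s)
    (heven : ∀ k, 1 ≤ k → Even (s.count ((X - 1) ^ (2 * k))) ∧ Even (s.count ((X + 1) ^ (2 * k)))) :
    QuadraticRealizes s := by
  refine multiset_induction_of_involution (sdual (RingHom.id F))
    (fun p => IsMonicPrimePow p ∧ p.coeff 0 ≠ 0)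
    (fun p => ¬ ∃ k, 1 ≤ k ∧ (p = (X - 1) ^ (2 * k) ∨ p = (X + 1) ^ (2 * k))) QuadraticRealizes
    (fun p hp => sdual_sdual (fun _ => rfl) hp.2 hp.1.monic) .zero (fun _ _ h h' => h.add h')
    (fun p hp => by rw [sdual_id]; exact quadraticRealizes_pair hp.1 hp.2) ?_ s hs.1
    hs.2 (fun p _ _ h => ?_)
  · rintro p ⟨⟨f, e, hf, hi, he, rfl⟩, h0⟩ hd hC
    rcases eq_or_one_lt_natDegree hf hi he h0 hd with hf1 | hdeg
    · refine quadraticRealizes_singleton_odd h2 hf1 (Nat.not_even_iff_odd.1 fun h => ?_)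
      obtain ⟨k, rfl⟩ := h.exists_two_nsmul
      rw [smul_eq_mul] at hC he
      exact hC ⟨k, by omega, hf1.imp (fun h => by rw [h]) (fun h => by rw [h])⟩
    · exact quadraticRealizes_singleton_of_one_lt_natDegree hf hi he hdeg h0 hd
  · obtain ⟨k, hk, rfl | rfl⟩ := not_not.1 h
    · exact (heven k hk).1
    · exact (heven k hk).2

open Classical in
lemma IsDualInvariant.quadraticRealizes_of_even [Finite F] [CharP F 2] {s : Multiset F[X]}
    (hs : IsDualInvariant (RingHom.id F) s)
    (heven : ∀ k, Even (s.count ((X + 1) ^ (2 * k + 1)))) : QuadraticRealizes s := by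
  refine multiset_induction_of_involution (sdual (RingHom.id F))
    (fun p => IsMonicPrimePow p ∧ p.coeff 0 ≠ 0)
    (fun p => ¬ ∃ k, p = (X + 1) ^ (2 * k + 1)) QuadraticRealizes
    (fun p hp => sdual_sdual (fun _ => rfl) hp.2 hp.1.monic) .zero (fun _ _ h h' => h.add h')
    (fun p hp => by rw [sdual_id]; exact quadraticRealizes_pair hp.1 hp.2) ?_ s hs.1
    hs.2 (fun p _ _ h => ?_)
  · rintro p ⟨⟨f, e, hf, hi, he, rfl⟩, h0⟩ hd hC
    rcases eq_or_one_lt_natDegree hf hi he h0 hd with hf1 | hdeg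
    · obtain rfl : f = X + 1 := hf1.elim (fun h => by rw [h, X_add_one_eq_X_sub_one]) id
      have heven' : Even e := Nat.not_odd_iff_even.1 fun ⟨k, hk⟩ => hC ⟨k, by rw [hk]⟩
      obtain ⟨k, rfl⟩ := heven'.exists_two_nsmul
      rw [smul_eq_mul] at he ⊢
      obtain ⟨Q, hQ, hQr⟩ := exists_quadraticForm_X_add_one_pow (F := F) (k := k) (by omega) rfl
      exact ⟨_, inferInstance, inferInstance, _, Q, isElementaryDivisors_rootMul
        ⟨X + 1, 2 * k, monic_X_add_one, irreducible_X_add_one, he, rfl⟩, hQ, hQr⟩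
    · exact quadraticRealizes_singleton_of_one_lt_natDegree hf hi he hdeg h0 hd
  · obtain ⟨k, rfl⟩ := not_not.1 h
    exact heven k

end Realization

/-! ### Forms preserved by a matrix -/

section Transfer

variable {F : Type u} [Field F] {n : ℕ}

lemma nondegenerate_polarBilin_comp_equiv {V W : Type*} [AddCommGroup V] [Module F V]
    [AddCommGroup W] [Module F W] {Q : QuadraticForm F W}
    (hQ : LinearMap.Nondegenerate Q.polarBilin) (E : V ≃ₗ[F] W) :
    LinearMap.Nondegenerate (QuadraticMap.polarBilin (Q.comp E.toLinearMap)) := by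
  rw [nondegenerate_polarBilin_iff] at hQ ⊢
  intro v hv
  refine E.map_eq_zero_iff.1 (hQ _ fun w => ?_)
  have := hv (E.symm w)
  simpa [QuadraticMap.polar] using this

/-- The hermitian case for any non-trivial involution `σ`: there is no parity condition, because
every self-dual elementary divisor belongs to a cyclic isometry. -/
lemma exists_hermitian_iff [Finite F] {σ : F →+* F} (hσ : ∀ x, σ (σ x) = x) (hne : ∃ x, σ x ≠ x)
    (X : GL (Fin n) F) :
    (∃ β : (Fin n → F) →ₗ[F] (Fin n → F) →ₛₗ[σ] F,
      LinearMap.Nondegenerate β ∧ IsHermitian β ∧ Preserves X β) ↔ IsConj X (adj σ X)⁻¹ := by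
  rw [isConj_adj_inv_iff hσ]
  constructor
  · rintro ⟨β, hβ, -, hX⟩
    exact isSelfDual_of_form (vecMulLinear_surjective X) hσ hX hβ.1
  · intro h
    have hs := elementaryDivisors_spec (Matrix.vecMulLinear X.1)
    obtain ⟨V, _, _, φ, β, h1, h2, h3, h4⟩ :=
      (IsDualInvariant.of_isSelfDual hσ (vecMulLinear_injective X) h hs).hermitianRealizes hσ hne
    obtain ⟨E, hE⟩ := hs.exists_equiv h1
    refine ⟨LinearMap.mk₂'ₛₗ (RingHom.id F) σ (fun u v => β (E u) (E v)) (fun u v w => by simp)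
      (fun c u v => by simp) (fun u v w => by simp) (fun c u v => by simp),
      ⟨fun u hu => ?_, fun u hu => ?_⟩,
      fun u v => h3 (E u) (E v), fun u v => ?_⟩
    · refine E.map_eq_zero_iff.1 (h2.1 _ fun w => ?_)
      simpa using hu (E.symm w)
    · refine E.map_eq_zero_iff.1 (h2.2 _ fun w => ?_)
      simpa using hu (E.symm w)
    · change β (E (Matrix.vecMulLinear X.1 u)) (E (Matrix.vecMulLinear X.1 v)) = β (E u) (E v)
      rw [hE, hE, h4]

/-- The alternating case, in every characteristic; for characteristic two both parity conditions
coincide. -/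
lemma exists_alternating_iff [Finite F] (X : GL (Fin n) F) :
    (∃ β : (Fin n → F) →ₗ[F] (Fin n → F) →ₗ[F] F,
        LinearMap.Nondegenerate β ∧ LinearMap.IsAlt β ∧ Preserves X β) ↔
      IsConj X X⁻¹ ∧
        ∀ k : ℕ, Even (mult X ((.X - 1) ^ (2 * k + 1))) ∧
          Even (mult X ((.X + 1) ^ (2 * k + 1))) := by
  rw [isConj_inv_iff]
  have hs := elementaryDivisors_spec (Matrix.vecMulLinear X.1)
  constructor
  · rintro ⟨β, hβ, halt, hX⟩
    refine ⟨isSelfDual_of_form (vecMulLinear_surjective X) (fun _ => rfl) hX hβ.1, fun k => ?_⟩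
    have h := fun c hc => count_even_of_alternating (c := c) (vecMulLinear_surjective X) hX hβ
      halt hc hs k
    rw [X_sub_one_eq, X_add_one_eq]
    exact ⟨h 1 (one_mul 1), h (-1) (by ring)⟩
  · rintro ⟨h, heven⟩
    obtain ⟨V, _, _, φ, β, h1, h2, h3, h4⟩ := (IsDualInvariant.of_isSelfDual (fun _ => rfl)
      (vecMulLinear_injective X) h hs).alternatingRealizes heven
    obtain ⟨E, hE⟩ := hs.exists_equiv h1
    refine ⟨β.compl₁₂ E.toLinearMap E.toLinearMap, ⟨fun u hu => ?_, fun u hu => ?_⟩,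
      fun u => h3 _, fun u v => ?_⟩
    · refine E.map_eq_zero_iff.1 (h2.1 _ fun w => ?_)
      simpa using hu (E.symm w)
    · refine E.map_eq_zero_iff.1 (h2.2 _ fun w => ?_)
      simpa using hu (E.symm w)
    · change β (E (Matrix.vecMulLinear X.1 u)) (E (Matrix.vecMulLinear X.1 v)) = β (E u) (E v)
      rw [hE, hE, h4]

lemma exists_quadratic_of_realizes {X : GL (Fin n) F} (h : QuadraticRealizes (elemDiv X)) :
    ∃ Q : QuadraticForm F (Fin n → F), NonSingular Q ∧ PreservesQuad X Q := by
  obtain ⟨V, _, _, φ, Q, h1, h2, h3⟩ := h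
  obtain ⟨E, hE⟩ := (elementaryDivisors_spec (Matrix.vecMulLinear X.1)).exists_equiv h1
  refine ⟨Q.comp E.toLinearMap, nondegenerate_polarBilin_comp_equiv h2 E, fun v => ?_⟩
  change Q (E (Matrix.vecMulLinear X.1 v)) = Q (E v)
  rw [hE, h3]

lemma preserves_polarBilin {X : GL (Fin n) F} {Q : QuadraticForm F (Fin n → F)}
    (hQ : PreservesQuad X Q) : Preserves X Q.polarBilin := fun u v => by
  simp only [QuadraticMap.polarBilin_apply_apply, QuadraticMap.polar]
  rw [← Matrix.add_vecMul, hQ, hQ, hQ]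

lemma isSelfDual_of_quadratic {X : GL (Fin n) F} {Q : QuadraticForm F (Fin n → F)}
    (hns : NonSingular Q) (hQ : PreservesQuad X Q) :
    IsSelfDual (RingHom.id F) (Matrix.vecMulLinear X.1) :=
  isSelfDual_of_form (vecMulLinear_surjective X) (fun _ => rfl) (preserves_polarBilin hQ) hns.1

lemma even_mult_of_quadratic_odd (h2 : (2 : F) ≠ 0) {X : GL (Fin n) F}
    {Q : QuadraticForm F (Fin n → F)} (hns : NonSingular Q) (hQ : PreservesQuad X Q) {k : ℕ}
    (hk : 1 ≤ k) : Even (mult X ((.X - 1) ^ (2 * k))) ∧ Even (mult X ((.X + 1) ^ (2 * k))) := by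
  have hs := elementaryDivisors_spec (Matrix.vecMulLinear X.1)
  have h := fun c hc => count_even_of_symmetric (c := c) h2 (vecMulLinear_surjective X)
    (preserves_polarBilin hQ) hns (fun u v => QuadraticMap.polar_comm Q u v) hc hs (k - 1)
  rw [show 2 * (k - 1) + 2 = 2 * k by omega] at h
  rw [X_sub_one_eq, X_add_one_eq]
  exact ⟨h 1 (one_mul 1), h (-1) (by ring)⟩

lemma polar_self_eq_zero [CharP F 2] {V : Type*} [AddCommGroup V] [Module F V]
    (Q : QuadraticForm F V) (v : V) : Q.polarBilin v v = 0 := by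
  rw [QuadraticMap.polarBilin_apply_apply, QuadraticMap.polar_self, two_smul,
    CharTwo.add_self_eq_zero]

/-- In characteristic two the polar form is a preserved alternating form. -/
lemma even_mult_of_quadratic_even [Finite F] [CharP F 2] {X : GL (Fin n) F}
    {Q : QuadraticForm F (Fin n → F)} (hns : NonSingular Q) (hQ : PreservesQuad X Q) (k : ℕ) :
    Even (mult X ((.X + 1) ^ (2 * k + 1))) :=
  (((exists_alternating_iff X).1 ⟨Q.polarBilin, hns, polar_self_eq_zero Q,
    preserves_polarBilin hQ⟩).2 k).2

lemma even_of_nonSingular_of_charTwo [CharP F 2] {Q : QuadraticForm F (Fin n → F)}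
    (hns : NonSingular Q) : Even n := by
  have h := even_finrank_add_finrank_ker (β := Q.polarBilin) (polar_self_eq_zero Q)
  have hker : LinearMap.ker Q.polarBilin = ⊥ :=
    LinearMap.ker_eq_bot'.2 fun v hv => hns.1 v fun w => LinearMap.congr_fun hv w
  rwa [hker, finrank_bot, add_zero, Module.finrank_fin_fun] at h

/-- Both types occur among the forms preserved by `X` if part of its elementary divisors belongs to
a family of forms with cancelling Gauss sums. -/
lemma exists_plusType_and_minusType [Finite F] {ψ : AddChar F ℂ} (hψ : ψ ≠ 1) (hn : Even n)
    {X : GL (Fin n) F} {s t : Multiset F[X]} (h : elemDiv X = s + t) (hs : GaussSumsCancel ψ s)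
    (ht : QuadraticRealizes t) :
    (∃ Q : QuadraticForm F (Fin n → F), NonSingular Q ∧ PreservesQuad X Q ∧ PlusType Q) ∧
      ∃ Q : QuadraticForm F (Fin n → F), NonSingular Q ∧ PreservesQuad X Q ∧ MinusType Q := by
  obtain ⟨V, _, _, φ, I, Q, h1, hI, hQ, hsum⟩ := hs
  obtain ⟨W, _, _, φ', R, k1, k2, k3⟩ := ht
  have := h1.finiteDimensional
  have := k1.finiteDimensional
  have : Finite V := Module.finite_of_finite F
  have : Finite W := Module.finite_of_finite F
  have hX := elementaryDivisors_spec (Matrix.vecMulLinear X.1)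
  obtain ⟨E, hE⟩ := hX.exists_equiv (show IsElementaryDivisors (φ.prodMap φ')
    (elementaryDivisors (Matrix.vecMulLinear X.1)) by
      rw [show elementaryDivisors (Matrix.vecMulLinear X.1) = s + t from h]
      exact h1.add k1)
  let T : F → QuadraticForm F (Fin n → F) := fun c => ((Q c).prod R).comp E.toLinearMap
  have hT : ∀ c ∈ I, NonSingular (T c) ∧ PreservesQuad X (T c) := fun c hc => by
    refine ⟨nondegenerate_polarBilin_comp_equiv
      (nondegenerate_polarBilin_prod (hQ c hc).1 k2) E, fun v => ?_⟩
    change ((Q c).prod R) (E (Matrix.vecMulLinear X.1 v)) = ((Q c).prod R) (E v)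
    rw [hE]
    simp [(hQ c hc).2, k3]
  have hG : ∀ c, gaussSumOf ψ (T c) = gaussSumOf ψ (Q c) * gaussSumOf ψ R := fun c => by
    rw [← gaussSumOf_prod]
    exact gaussSumOf_comp_equiv ψ E.toEquiv ((Q c).prod R)
  have hsum' : ∑ c ∈ I, gaussSumOf ψ (T c) = 0 := by
    rw [Finset.sum_congr rfl fun c _ => hG c, ← Finset.sum_mul, hsum, zero_mul]
  have hcard : (I.card : ℂ) * sqrtCard (Fin n → F) ≠ 0 :=
    mul_ne_zero (by exact_mod_cast (Finset.card_pos.2 hI).ne') (sqrtCard_ne_zero _)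
  constructor
  · by_contra hno
    have h2 : ∀ c ∈ I, gaussSumOf ψ (T c) = - sqrtCard (Fin n → F) := fun c hc => by
      rcases gaussSumOf_type hψ (hT c hc).1 hn with h3 | h3
      · exact absurd ⟨T c, (hT c hc).1, (hT c hc).2, h3.1⟩ hno
      · exact h3.2.2
    rw [Finset.sum_congr rfl h2, Finset.sum_const, nsmul_eq_mul, mul_neg, neg_eq_zero] at hsum'
    exact hcard hsum'
  · by_contra hno
    have h2 : ∀ c ∈ I, gaussSumOf ψ (T c) = sqrtCard (Fin n → F) := fun c hc => by
      rcases gaussSumOf_type hψ (hT c hc).1 hn with h3 | h3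
      · exact h3.2.2
      · exact absurd ⟨T c, (hT c hc).1, (hT c hc).2, h3.1⟩ hno
    rw [Finset.sum_congr rfl h2, Finset.sum_const, nsmul_eq_mul] at hsum'
    exact hcard hsum'

open Classical in
/-- In odd characteristic an elementary divisor `(X - 1) ^ e` or `(X + 1) ^ e` with odd `e` makes
both types occur. -/
lemma exists_both_types_of_odd [Finite F] (h2 : ¬ CharP F 2) (hn : Even n) {X : GL (Fin n) F}
    (hd : IsDualInvariant (RingHom.id F) (elemDiv X))
    (heven : ∀ k : ℕ, 1 ≤ k → Even (mult X ((.X - 1) ^ (2 * k))) ∧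
      Even (mult X ((.X + 1) ^ (2 * k))))
    {f : F[X]} (hf : f = .X - 1 ∨ f = .X + 1) {e : ℕ} (he : Odd e) (hmem : f ^ e ∈ elemDiv X) :
    (∃ Q : QuadraticForm F (Fin n → F), NonSingular Q ∧ PreservesQuad X Q ∧ PlusType Q) ∧
      ∃ Q : QuadraticForm F (Fin n → F), NonSingular Q ∧ PreservesQuad X Q ∧ MinusType Q := by
  obtain ⟨ψ, hψ⟩ := exists_addChar_ne_one (F := F)
  obtain ⟨c, hc, hfc, hdf, hm, hi⟩ := eq_X_sub_C_of_eq hf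
  obtain ⟨t, ht⟩ := Multiset.exists_cons_of_mem hmem
  rw [← Multiset.singleton_add] at ht
  have hinv := isDualInvariant_singleton_pow hf he.pos
  rw [ht] at hd
  refine exists_plusType_and_minusType hψ hn ht
    ((quadraticRealizes_singleton_odd h2 hf he).gaussSumsCancel hψ ?_)
    ((hinv.of_add hd).quadraticRealizes_of_odd h2 fun k hk => ?_)
  · rwa [Multiset.prod_singleton, natDegree_pow, hfc, natDegree_X_sub_C, mul_one]
  · have hne : ∀ g : F[X], g = .X - 1 ∨ g = .X + 1 → g ^ (2 * k) ≠ f ^ e := fun g hg h => by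
      obtain ⟨-, -, -, -, hgm, hgi⟩ := eq_X_sub_C_of_eq hg
      have := (eq_of_pow_eq_pow hgm hgi hm hi (by omega) h).2
      obtain ⟨l, hl⟩ := he
      omega
    have h3 := heven k hk
    simp only [mult, ht, Multiset.count_add, Multiset.count_singleton] at h3
    rwa [if_neg (hne _ (Or.inl rfl)), if_neg (hne _ (Or.inr rfl)), zero_add, zero_add] at h3

open Classical in
/-- In characteristic two an elementary divisor `(X + 1) ^ e` makes both types occur. -/
lemma exists_both_types_of_even [Finite F] [CharP F 2] (hn : Even n) {X : GL (Fin n) F}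
    (hd : IsDualInvariant (RingHom.id F) (elemDiv X))
    (heven : ∀ k : ℕ, Even (mult X ((.X + 1) ^ (2 * k + 1))))
    {e : ℕ} (he : 0 < e) (hmem : (.X + 1 : F[X]) ^ e ∈ elemDiv X) :
    (∃ Q : QuadraticForm F (Fin n → F), NonSingular Q ∧ PreservesQuad X Q ∧ PlusType Q) ∧
      ∃ Q : QuadraticForm F (Fin n → F), NonSingular Q ∧ PreservesQuad X Q ∧ MinusType Q := by
  obtain ⟨ψ, hψ⟩ := exists_addChar_ne_one (F := F)
  have hinv : IsDualInvariant (RingHom.id F) {(.X + 1 : F[X]) ^ e} :=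
    isDualInvariant_singleton_pow (Or.inr rfl) he
  have hpow : ∀ i j : ℕ, 0 < i → (.X + 1 : F[X]) ^ i = (.X + 1) ^ j → i = j := fun i j hi h =>
    (eq_of_pow_eq_pow monic_X_add_one irreducible_X_add_one monic_X_add_one
      irreducible_X_add_one hi h).2
  rcases Nat.even_or_odd' e with ⟨k, rfl | rfl⟩
  · obtain ⟨t, ht⟩ := Multiset.exists_cons_of_mem hmem
    rw [← Multiset.singleton_add] at ht
    rw [ht] at hd
    refine exists_plusType_and_minusType hψ hn ht
      (gaussSumsCancel_X_add_one_pow_even hψ (by omega))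
      ((hinv.of_add hd).quadraticRealizes_of_even fun l => ?_)
    have h3 := heven l
    simp only [mult, ht, Multiset.count_add, Multiset.count_singleton] at h3
    rwa [if_neg fun h => by have := hpow _ _ (by omega) h; omega, zero_add] at h3
  · have hle : {(.X + 1 : F[X]) ^ (2 * k + 1), (.X + 1) ^ (2 * k + 1)} ≤ elemDiv X := by
      refine (Multiset.le_count_iff_replicate_le (n := 2)).1 ?_
      obtain ⟨l, hl⟩ := heven k
      have := Multiset.count_pos.2 hmem
      rw [mult] at hl
      omega
    obtain ⟨t, ht⟩ := Multiset.le_iff_exists_add.1 hle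
    rw [ht] at hd
    refine exists_plusType_and_minusType hψ hn ht (gaussSumsCancel_X_add_one_pow_odd_pair hψ k)
      (((hinv.add hinv).of_add hd).quadraticRealizes_of_even fun l => ?_)
    have h3 := heven l
    simp only [mult, ht, Multiset.count_add, Multiset.insert_eq_cons, Multiset.count_cons,
      Multiset.count_singleton] at h3
    split_ifs at h3 with h
    · rw [Nat.even_iff] at h3 ⊢
      omega
    · simpa using h3

end Transfer

end FormIsometry

namespace FormIsometry

universe u

/-! ### Characteristic polynomials and self-dual factors -/

section Charpoly

variable {F : Type u} [Field F]

open Classical in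
/-- The number of irreducible factors of `g` in `Phi3`, with multiplicity. -/
noncomputable def omega3 (g : F[X]) : ℕ :=
  ((UniqueFactorizationMonoid.normalizedFactors g).filter (· ∈ Phi3 F)).card

lemma omega3_mul {g h : F[X]} (hg : g ≠ 0) (hh : h ≠ 0) :
    omega3 (g * h) = omega3 g + omega3 h := by
  classical
  rw [omega3, UniqueFactorizationMonoid.normalizedFactors_mul hg hh, Multiset.filter_add,
    Multiset.card_add, omega3, omega3]

lemma omega3_one : omega3 (1 : F[X]) = 0 := by
  classical
  rw [omega3, UniqueFactorizationMonoid.normalizedFactors_one]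
  rfl

open Classical in
lemma omega3_of_irreducible {f : F[X]} (hf : f.Monic) (hi : Irreducible f) :
    omega3 f = if f ∈ Phi3 F then 1 else 0 := by
  rw [omega3, UniqueFactorizationMonoid.normalizedFactors_irreducible hi, hf.normalize_eq_self,
    Multiset.filter_singleton]
  split_ifs <;> rfl

lemma omega3_pow {f : F[X]} (hf : f ≠ 0) (e : ℕ) : omega3 (f ^ e) = e * omega3 f := by
  induction e with
  | zero => rw [pow_zero, omega3_one, zero_mul]
  | succ e ih => rw [pow_succ, omega3_mul (pow_ne_zero _ hf) hf, ih]; ring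

lemma omega3_prod {s : Multiset F[X]} (hs : ∀ p ∈ s, IsMonicPrimePow p) :
    omega3 s.prod = (s.map omega3).sum := by
  induction s using Multiset.induction with
  | empty => rw [Multiset.prod_zero, omega3_one]; rfl
  | cons p s ih =>
    have hs' : ∀ q ∈ s, IsMonicPrimePow q := fun q hq => hs q (Multiset.mem_cons_of_mem hq)
    rw [Multiset.prod_cons, Multiset.map_cons, Multiset.sum_cons, ← ih hs',
      omega3_mul (hs p (Multiset.mem_cons_self p s)).monic.ne_zero]
    exact Multiset.prod_ne_zero fun h => (hs' 0 h).monic.ne_zero rfl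

lemma dual_mem_Phi3_iff {f : F[X]} (hf : f.Monic) (h0 : f.coeff 0 ≠ 0) :
    dual f ∈ Phi3 F ↔ f ∈ Phi3 F := by
  have key : ∀ g : F[X], g.Monic → g.coeff 0 ≠ 0 → g ∈ Phi3 F → dual g ∈ Phi3 F :=
    fun g _ _ hg => by rw [← hg.2.2.1]; exact hg
  refine ⟨fun h => ?_, key f hf h0⟩
  rw [← dual_dual h0 hf]
  exact key _ (monic_dual h0) (dual_coeff_zero h0) h

/-- The irreducible factors of `X ^ 2 - 1` are linear, hence not in `Phi3`. -/
lemma omega3_eq_zero_of_dvd {f : F[X]} {e N : ℕ} (hf : f.Monic) (hi : Irreducible f) (he : 0 < e)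
    (h : f ^ e ∣ (X ^ 2 - 1) ^ N) : omega3 (f ^ e) = 0 := by
  classical
  rw [omega3_pow hf.ne_zero, omega3_of_irreducible hf hi, if_neg, mul_zero]
  rintro ⟨-, -, -, hdeg⟩
  exact not_dvd_X_sq_sub_one hi hdeg (hi.prime.dvd_of_dvd_pow ((dvd_pow_self f he.ne').trans h))

variable {V : Type u} [AddCommGroup V] [Module F V]

/-- The characteristic polynomial is multiplicative over an invariant subspace and the
corresponding quotient. -/
lemma charpoly_eq_mul [FiniteDimensional F V] (W : Submodule F V) (φ : V →ₗ[F] V)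
    (h : W ≤ W.comap φ) :
    φ.charpoly = (φ.restrict h).charpoly * (W.mapQ W φ h).charpoly := by
  let bW := Module.Free.chooseBasis F W
  let bQ := Module.Free.chooseBasis F (V ⧸ W)
  let b := Module.Basis.sumQuot bW bQ
  suffices hM : LinearMap.toMatrix b b φ = Matrix.fromBlocks
      (LinearMap.toMatrix bW bW (φ.restrict h))
      (Matrix.of fun i l => (b.repr (φ (b (Sum.inr l)))) (Sum.inl i)) 0
      (LinearMap.toMatrix bQ bQ (W.mapQ W φ h)) by
    rw [← LinearMap.charpoly_toMatrix φ b, hM, Matrix.charpoly_fromBlocks_zero₂₁,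
      LinearMap.charpoly_toMatrix, LinearMap.charpoly_toMatrix]
  ext i j
  rcases i with i | i <;> rcases j with j | j
  · simp only [b, Module.Basis.sumQuot_inl, Matrix.fromBlocks_apply₁₁, LinearMap.toMatrix_apply]
    exact Module.Basis.sumQuot_repr_inl_of_mem _ _ _ _ _
  · simp [b, LinearMap.toMatrix_apply]
  · have h0 : W.mkQ (φ (bW j)) = 0 := by
      rw [← LinearMap.mem_ker, Submodule.ker_mkQ]
      exact h (bW j).2
    simp [LinearMap.toMatrix_apply, b, h0]
  · simp only [LinearMap.toMatrix_apply, Module.Basis.sumQuot_repr_inr,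
      Matrix.fromBlocks_apply₂₂, b]
    rw [← Module.Basis.sumQuot_inr bW bQ j, W.mapQ_apply]
    simp

/-- Every elementary divisor divides every annihilating polynomial. -/
lemma IsElementaryDivisors.dvd_of_aeval_eq_zero {φ : V →ₗ[F] V} {s : Multiset F[X]}
    (hs : IsElementaryDivisors φ s) {g : F[X]} (hg : aeval φ g = 0) {p : F[X]} (hp : p ∈ s) :
    p ∣ g := by
  classical
  obtain ⟨r, p', hp', rfl, E, hE⟩ := isElementaryDivisors_iff.1 hs
  obtain ⟨i, -, rfl⟩ := Multiset.mem_map.1 hp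
  have h := map_aeval_eq_mk_mul ((LinearMap.proj i).comp E.toLinearMap) (fun v => hE v i) g
    (E.symm (Pi.single i 1))
  rw [hg] at h
  simp only [LinearMap.zero_apply, map_zero, LinearMap.comp_apply, LinearEquiv.coe_coe,
    LinearEquiv.apply_symm_apply, LinearMap.proj_apply, Pi.single_eq_same, mul_one] at h
  exact AdjoinRoot.mk_eq_zero.1 h.symm

lemma charpoly_eq_of_aeval_eq_zero [FiniteDimensional F V] {φ : V →ₗ[F] V} {f : F[X]}
    (hf : f.Monic) (hi : Irreducible f) (h : aeval φ f = 0)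
    (hdim : Module.finrank F V = f.natDegree) : φ.charpoly = f := by
  have hs := elementaryDivisors_spec φ
  have h1 : ∀ p ∈ elementaryDivisors φ, p = f := fun p hp => by
    obtain ⟨g, e, hg, hgi, he, rfl⟩ := hs.isMonicPrimePow hp
    refine eq_of_monic_of_associated (hg.pow e) hf ?_
    refine (hi.dvd_iff.1 (hs.dvd_of_aeval_eq_zero h hp)).resolve_left (fun hu => ?_) |>.symm
    exact hgi.not_isUnit ((isUnit_pow_iff he.ne').1 hu)
  have h2 := Multiset.eq_replicate_of_mem h1
  have h3 := hs.charpoly_eq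
  rw [h2, Multiset.prod_replicate] at h3
  have h4 := LinearMap.charpoly_natDegree φ
  rw [h3, natDegree_pow, hdim] at h4
  have hpos := hi.natDegree_pos
  have : (elementaryDivisors φ).card = 1 := Nat.eq_of_mul_eq_mul_right hpos (by rw [h4, one_mul])
  rw [h3, this, pow_one]

lemma omega3_charpoly_eq_zero [FiniteDimensional F V] {φ : V →ₗ[F] V} {N : ℕ}
    (h : aeval φ ((X ^ 2 - 1 : F[X]) ^ N) = 0) : omega3 φ.charpoly = 0 := by
  have hs := elementaryDivisors_spec φ
  rw [hs.charpoly_eq, omega3_prod fun p hp => hs.isMonicPrimePow hp]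
  refine Multiset.sum_eq_zero fun x hx => ?_
  obtain ⟨p, hp, rfl⟩ := Multiset.mem_map.1 hx
  have hd := hs.dvd_of_aeval_eq_zero h hp
  obtain ⟨g, e, hg, hgi, he, rfl⟩ := hs.isMonicPrimePow hp
  exact omega3_eq_zero_of_dvd hg hgi he hd

lemma isCoprime_multiset_prod {s : Multiset F[X]} {h : F[X]} (hs : ∀ p ∈ s, IsCoprime p h) :
    IsCoprime s.prod h :=
  Multiset.prod_induction (IsCoprime · h) _ (fun _ _ ha hb => ha.mul_left hb)
    isCoprime_one_left hs

lemma isCoprime_charpoly_of_aeval_eq_zero [FiniteDimensional F V] {φ : V →ₗ[F] V} {g h : F[X]}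
    (hg : aeval φ g = 0) (hgh : IsCoprime g h) : IsCoprime φ.charpoly h := by
  have hs := elementaryDivisors_spec φ
  rw [hs.charpoly_eq]
  exact isCoprime_multiset_prod fun p hp =>
    hgh.of_isCoprime_of_dvd_left (hs.dvd_of_aeval_eq_zero hg hp)

end Charpoly

/-! ### The norm form of a finite field with an involution -/

section NormForm

variable {K : Type*} [Field K] [Finite K]

/-- The norm `a * ι a` of a non-trivial involution of a finite field takes every non-zero fixed
value: by Hilbert's Theorem 90 its kernel is the range of `a / ι a`, so that its range has the same
order as the kernel of `a / ι a`, which contains it. -/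
lemma exists_norm_eq {ι : K →+* K} (hι : ∀ a, ι (ι a) = a) (hne : ∃ a, ι a ≠ a) {b : K}
    (hb0 : b ≠ 0) (hb : ι b = b) : ∃ a, a * ι a = b := by
  let I : Kˣ →* Kˣ := Units.map ι.toMonoidHom
  have hI : ∀ a : Kˣ, ((I a : Kˣ) : K) = ι a := fun _ => rfl
  let N : Kˣ →* Kˣ := MonoidHom.id Kˣ * I
  have hN : ∀ a : Kˣ, N a = a * I a := fun _ => rfl
  let D : Kˣ →* Kˣ := MonoidHom.id Kˣ / I
  have hD : ∀ a : Kˣ, D a = a / I a := fun _ => rfl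
  have hII : ∀ a, I (I a) = a := fun a => Units.ext (hι a)
  have h1 : N.ker = D.range := by
    ext x
    rw [MonoidHom.mem_ker, MonoidHom.mem_range]
    constructor
    · intro hx
      have hx' : (x : K) * ι x = 1 := congrArg Units.val hx
      obtain ⟨y, hy⟩ : ∃ y : K, y + x * ι y ≠ 0 := by
        by_contra! h
        have e1 := h 1
        rw [map_one, mul_one] at e1
        obtain ⟨a, ha⟩ := hne
        have e2 := h a
        exact ha (by linear_combination e2 - ι a * e1 - 2 * (e2 - ι a * e1))
      refine ⟨Units.mk0 _ hy, ?_⟩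
      rw [hD, div_eq_iff_eq_mul]
      ext
      rw [Units.val_mul, hI, Units.val_mk0, map_add, map_mul, hι]
      linear_combination -y * hx'
    · rintro ⟨y, rfl⟩
      rw [hN, hD, _root_.map_div, hII, div_mul_div_cancel, div_self']
  have h2 : N.range ≤ D.ker := by
    rintro _ ⟨y, rfl⟩
    rw [MonoidHom.mem_ker, hD, hN, map_mul, hII, mul_comm, div_self']
  have h3 : N.range = D.ker := by
    refine Subgroup.eq_of_le_of_card_ge h2 (le_of_eq ?_)
    have e1 := N.ker.card_mul_index
    have e2 := D.ker.card_mul_index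
    rw [Subgroup.index_ker] at e1 e2
    rw [h1] at e1
    have hpos : 0 < Nat.card D.range := Nat.card_pos
    exact Nat.eq_of_mul_eq_mul_right hpos (by rw [e2, ← e1, mul_comm])
  have h4 : Units.mk0 b hb0 ∈ N.range := by
    rw [h3, MonoidHom.mem_ker, hD, div_eq_one]
    exact Units.ext hb.symm
  obtain ⟨a, ha⟩ := h4
  exact ⟨a, congrArg Units.val ha⟩

/-- Summation over the norms: every non-zero norm is taken equally often. -/
lemma exists_sum_norm_eq [Fintype K] [DecidableEq K] {ι : K →+* K} (hι : ∀ a, ι (ι a) = a)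
    (hne : ∃ a, ι a ≠ a) : ∃ m : ℕ, 0 < m ∧ ∀ g : K → ℂ,
      ∑ a, g (a * ι a) = g 0 + m * ((∑ b, if ι b = b then g b else 0) - g 0) := by
  let U := Finset.univ.filter fun a : K => a * ι a = 1
  refine ⟨U.card, Finset.card_pos.2 ⟨1, by simp [U]⟩, fun g => ?_⟩
  have hfib : ∀ b : K, b ≠ 0 → ι b = b →
      (Finset.univ.filter fun a : K => a * ι a = b).card = U.card := fun b hb0 hb => by
    obtain ⟨a₀, ha₀⟩ := exists_norm_eq hι hne hb0 hb
    have ha0 : a₀ ≠ 0 := by rintro rfl; exact hb0 (by rw [← ha₀, zero_mul])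
    have hιa0 : ι a₀ ≠ 0 := by rwa [Ne, map_eq_zero]
    symm
    refine Finset.card_bij (fun u _ => u * a₀) (fun u hu => ?_) (fun u _ v _ h => ?_)
      fun a ha => ⟨a / a₀, ?_, div_mul_cancel₀ a ha0⟩
    · simp only [U, Finset.mem_filter, Finset.mem_univ, true_and] at hu ⊢
      rw [map_mul, ← ha₀]
      linear_combination (a₀ * ι a₀) * hu
    · exact mul_right_cancel₀ ha0 h
    · simp only [U, Finset.mem_filter, Finset.mem_univ, true_and] at ha ⊢
      rw [map_div₀, div_mul_div_comm, ha, ha₀, div_self hb0]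
  have h1 : ∑ a, g (a * ι a) =
      ∑ b, ((Finset.univ.filter fun a : K => a * ι a = b).card : ℂ) * g b := by
    rw [← Finset.sum_fiberwise (s := Finset.univ) (g := fun a : K => a * ι a)]
    refine Finset.sum_congr rfl fun b _ => ?_
    rw [Finset.sum_congr rfl (g := fun _ => g b) fun a ha => by rw [(Finset.mem_filter.1 ha).2],
      Finset.sum_const, nsmul_eq_mul]
  have h2 : ∀ b, ((Finset.univ.filter fun a : K => a * ι a = b).card : ℂ) * g b =
      (if b = 0 then g 0 else 0) + (U.card : ℂ) *
        ((if ι b = b then g b else 0) - if b = 0 then g 0 else 0) := fun b => by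
    by_cases hb0 : b = 0
    · have : (Finset.univ.filter fun a : K => a * ι a = 0) = {0} := by
        ext a
        simp
      rw [hb0, this]
      simp
    · by_cases hb : ι b = b
      · rw [hfib b hb0 hb]
        simp [hb0, hb]
      · have : (Finset.univ.filter fun a : K => a * ι a = b) = ∅ := by
          refine Finset.filter_eq_empty_iff.2 fun a _ h => hb ?_
          rw [← h, map_mul, hι, mul_comm]
        rw [this]
        simp [hb0, hb]
  rw [h1, Finset.sum_congr rfl fun b _ => h2 b, Finset.sum_add_distrib, ← Finset.mul_sum,
    Finset.sum_sub_distrib]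
  simp

end NormForm

end FormIsometry

namespace FormIsometry

universe u

/-! ### The Gauss sum of an invariant form on a field -/

section FieldCase

variable {F : Type u} [Field F] [Finite F] {ψ : AddChar F ℂ}

/-- A quadratic form on the field `F[X] / (f)` that is preserved by multiplication by `X` is
`T (s * a * ι a)` with `s + ι s = 1`. As the norm `a * ι a` takes all non-zero values fixed by `ι`
equally often, its Gauss sum is `1 - m` for a positive integer `m`, and hence the negative of its
absolute value. -/
lemma gaussSumOf_adjoinRoot (hψ : ψ ≠ 1) {f : F[X]} (hf : f.Monic) (hi : Irreducible f)
    (h0 : f.coeff 0 ≠ 0) (hd : dual f = f) (hdeg : 1 < f.natDegree)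
    {Q : QuadraticForm F (AdjoinRoot f)} (hQ : LinearMap.Nondegenerate Q.polarBilin)
    (hr : ∀ a, Q (AdjoinRoot.root f * a) = Q a) :
    gaussSumOf ψ Q = - sqrtCard (AdjoinRoot f) := by
  classical
  have : Fact (Irreducible f) := ⟨hi⟩
  have := hf.finite_adjoinRoot
  have : Finite (AdjoinRoot f) := Module.finite_of_finite F
  have := Fintype.ofFinite (AdjoinRoot f)
  obtain ⟨ι, h1, h2, h3⟩ := exists_involution (σ := RingHom.id F) (fun _ => rfl) h0
    ((sdual_id f).trans hd)
  set t := AdjoinRoot.root f with ht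
  have hsq : t * t - 1 ≠ 0 := fun h => by
    refine not_dvd_X_sq_sub_one hi hdeg (AdjoinRoot.mk_eq_zero.1 ?_)
    rw [map_sub, map_pow, AdjoinRoot.mk_X, map_one, sq]
    exact h
  have hne : ι t ≠ t := fun h => hsq (by rw [h] at h2; rw [h2, sub_self])
  have ht1 : t - 1 ≠ 0 := fun h => hsq (by linear_combination (t + 1) * h)
  -- The polar form is `T (a * ι b)`.
  have hB : ∀ u v, Q.polarBilin (t • u) (t • v) = Q.polarBilin u v := fun u v => by
    simp only [QuadraticMap.polarBilin_apply_apply, QuadraticMap.polar, smul_eq_mul]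
    rw [← mul_add, hr, hr, hr]
  let T : AdjoinRoot f →ₗ[F] F := Q.polarBilin.flip 1
  have hT : ∀ a b, QuadraticMap.polar Q a b = T (a * ι b) := fun a b => by
    have h := form_smul_left hB h1 h2 (ι b) a 1
    rw [h3, smul_eq_mul, smul_eq_mul, mul_one] at h
    rw [mul_comm]
    exact h.symm
  have hTι : ∀ a, T (ι a) = T a := fun a => by
    rw [← one_mul (ι a), ← hT, QuadraticMap.polar_comm, hT, map_one, mul_one]
  obtain ⟨s, hs⟩ : ∃ s, s + ι s = 1 := by
    obtain ⟨z, hz⟩ : ∃ z, z + ι z ≠ 0 := by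
      by_contra! h
      have e1 := h 1
      rw [map_one] at e1
      exact hne (by linear_combination h t - t * e1)
    refine ⟨z / (z + ι z), ?_⟩
    rw [map_div₀, map_add, h3, add_comm (ι z) z, ← add_div, div_self hz]
  let Q' := normForm (T.comp (LinearMap.mulLeft F s)) ι h1
  have hQ' : ∀ a, Q' a = T (s * (a * ι a)) := fun a => normForm_apply _ _ _ _
  have hpolar : ∀ a b, QuadraticMap.polar Q' a b = QuadraticMap.polar Q a b := fun a b => by
    rw [polar_normForm _ _ _ h3, hT, LinearMap.comp_apply, LinearMap.mulLeft_apply, mul_add,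
      map_add, ← hTι (s * ι (a * ι b)), map_mul ι, h3, ← map_add]
    congr 1
    linear_combination (a * ι b) * hs
  -- The two forms have the same polar form, so that their difference is additive; it is also
  -- invariant under multiplication by `t`, hence zero on `(t - 1) * a`.
  have hQQ : ∀ a, Q a = T (s * (a * ι a)) := fun a => by
    have hadd : ∀ a b, Q (a + b) - Q' (a + b) = (Q a - Q' a) + (Q b - Q' b) := fun a b => by
      rw [QuadraticMap.map_add (⇑Q), QuadraticMap.map_add (⇑Q'), hpolar]
      ring
    have hr' : ∀ a, Q' (t * a) = Q' a := fun a => by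
      rw [hQ', hQ', root_mul_mul_inversion h2]
    have hz : ∀ a, Q ((t - 1) * a) - Q' ((t - 1) * a) = 0 := fun a => by
      have h := hadd ((t - 1) * a) a
      rw [show (t - 1) * a + a = t * a by ring, hr, hr'] at h
      linear_combination -h
    have h := hz ((t - 1)⁻¹ * a)
    rw [mul_inv_cancel_left₀ ht1] at h
    rw [← hQ']
    exact sub_eq_zero.1 h
  have hG : gaussSumOf ψ Q = ∑ a, ψ (T (s * (a * ι a))) := by
    rw [gaussSumOf_eq_sum]
    exact Finset.sum_congr rfl fun a _ => by rw [hQQ]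
  have hnorm : ‖gaussSumOf ψ Q‖ = √(Nat.card (AdjoinRoot f)) := by
    rw [gaussSumOf_eq_sum]
    exact norm_sum_apply hψ hQ
  have hcard : 1 < Nat.card (AdjoinRoot f) := Finite.one_lt_card
  obtain ⟨m, hm, hsum⟩ := exists_sum_norm_eq h3 ⟨t, hne⟩
  -- The fixed field of the involution.
  let P : Submodule F (AdjoinRoot f) :=
    { carrier := {b | ι b = b}
      add_mem' := fun {a b} ha hb => by
        change ι (a + b) = a + b
        rw [map_add, show ι a = a from ha, show ι b = b from hb]
      zero_mem' := map_zero ι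
      smul_mem' := fun c a ha => by
        change ι (c • a) = c • a
        rw [h1, show ι a = a from ha]; rfl }
  let L : P →ₗ[F] F := (T.comp (LinearMap.mulLeft F s)).comp P.subtype
  have hLsum : ∑ b, (if ι b = b then ψ (T (s * b)) else 0) = ∑ b : P, ψ (L b) := by
    rw [← Finset.sum_filter]
    exact Finset.sum_subtype _ (p := fun b => b ∈ P)
      (fun b => by simp only [Finset.mem_filter, Finset.mem_univ, true_and]; rfl)
      (fun b => ψ (T (s * b)))
  have hL : L ≠ 0 := fun hL => by
    have h4 : gaussSumOf ψ Q = Nat.card (AdjoinRoot f) := by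
      rw [hG, Finset.sum_congr rfl (g := fun _ => 1) fun a _ => ?_]
      · rw [Finset.sum_const, Finset.card_univ, nsmul_eq_mul, mul_one, Nat.card_eq_fintype_card]
      · have h5 : T (s * (a * ι a)) = L ⟨a * ι a, by
            change ι (a * ι a) = _
            rw [map_mul, h3, mul_comm]⟩ := rfl
        rw [h5, hL, LinearMap.zero_apply, AddChar.map_zero_eq_one]
    rw [h4, Complex.norm_natCast] at hnorm
    have h6 : (1 : ℝ) < Nat.card (AdjoinRoot f) := by exact_mod_cast hcard
    have h7 : √(Nat.card (AdjoinRoot f) : ℝ) < Nat.card (AdjoinRoot f) :=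
      (Real.sqrt_lt' (by linarith)).2 (by nlinarith)
    linarith
  have hG2 : gaussSumOf ψ Q = -((m - 1 : ℝ) : ℂ) := by
    rw [hG, hsum fun b => ψ (T (s * b)), hLsum, sum_apply_linear hψ, if_neg hL, mul_zero, map_zero,
      AddChar.map_zero_eq_one]
    push_cast
    ring
  have hm1 : (0 : ℝ) ≤ m - 1 := by
    have : (1 : ℝ) ≤ m := by exact_mod_cast hm
    linarith
  rw [hG2, norm_neg, Complex.norm_real, Real.norm_of_nonneg hm1] at hnorm
  rw [hG2, hnorm, sqrtCard]

end FieldCase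

/-! ### Passing to the orthogonal complement of a totally singular subspace -/

section Reduction

variable {F : Type u} [Field F] {V : Type u} [AddCommGroup V] [Module F V]

lemma polar_map_map {V : Type*} [AddCommGroup V] [Module F V] {Q : QuadraticForm F V}
    {φ : V →ₗ[F] V} (hφ : ∀ v, Q (φ v) = Q v) (u v : V) :
    QuadraticMap.polar Q (φ u) (φ v) = QuadraticMap.polar Q u v := by
  rw [QuadraticMap.polar, QuadraticMap.polar, ← map_add, hφ, hφ, hφ]

lemma injective_of_isometry {Q : QuadraticForm F V} (hQ : LinearMap.Nondegenerate Q.polarBilin)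
    {φ : V →ₗ[F] V} (hφ : ∀ v, Q (φ v) = Q v) : Function.Injective φ := by
  refine (injective_iff_map_eq_zero φ).2 fun v hv => nondegenerate_polarBilin_iff.1 hQ v fun w => ?_
  rw [← polar_map_map hφ, hv, QuadraticMap.polar_zero_left]

variable [FiniteDimensional F V]

lemma exists_mem_map_eq {φ : V →ₗ[F] V} (hφ : Function.Injective φ) {S : Submodule F V}
    (hS : S ≤ S.comap φ) {v : V} (hv : v ∈ S) : ∃ w ∈ S, φ w = v := by
  have h : Function.Injective (φ.restrict hS) := fun a b hab =>
    Subtype.ext (hφ (congrArg Subtype.val hab))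
  obtain ⟨w, hw⟩ := LinearMap.injective_iff_surjective.1 h ⟨v, hv⟩
  exact ⟨w, w.2, congrArg Subtype.val hw⟩

lemma orthogonal_le_comap {Q : QuadraticForm F V} (hQ : LinearMap.Nondegenerate Q.polarBilin)
    {φ : V →ₗ[F] V} (hφ : ∀ v, Q (φ v) = Q v) {S : Submodule F V} (hS : S ≤ S.comap φ) :
    LinearMap.BilinForm.orthogonal Q.polarBilin S ≤
      (LinearMap.BilinForm.orthogonal Q.polarBilin S).comap φ := by
  intro v hv w hw
  obtain ⟨w, hw', rfl⟩ := exists_mem_map_eq (injective_of_isometry hQ hφ) hS hw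
  exact (polar_map_map hφ w v).trans (hv w hw')

omit [FiniteDimensional F V] in
/-- If `g` annihilates the invariant subspace `S`, then its reverse annihilates the quotient by the
orthogonal complement of `S`, which is dual to `S`. -/
lemma aeval_reverse_mapQ_orthogonal {Q : QuadraticForm F V} {φ : V →ₗ[F] V}
    (hφ : ∀ v, Q (φ v) = Q v) {S : Submodule F V}
    (hP : LinearMap.BilinForm.orthogonal Q.polarBilin S ≤
      (LinearMap.BilinForm.orthogonal Q.polarBilin S).comap φ) {g : F[X]}
    (hg : ∀ w ∈ S, aeval φ g w = 0) :
    aeval ((LinearMap.BilinForm.orthogonal Q.polarBilin S).mapQ _ φ hP) g.reverse = 0 := by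
  refine LinearMap.ext fun x => ?_
  obtain ⟨v, rfl⟩ := Submodule.mkQ_surjective _ x
  rw [LinearMap.zero_apply, ← map_aeval_of_intertwines (φ := φ) (Submodule.mkQ _) (fun _ => rfl),
    ← LinearMap.mem_ker, Submodule.ker_mkQ]
  intro w hw
  have h := form_aeval_pow (σ := RingHom.id F) (β := Q.polarBilin) (fun _ => rfl)
    (fun u v => polar_map_map hφ u v) g w v
  rw [hg w hw, Polynomial.map_id, map_zero, LinearMap.zero_apply] at h
  exact h.symm

omit [FiniteDimensional F V] in
lemma aeval_restrict_eq_zero {φ : V →ₗ[F] V} {S : Submodule F V} (hS : S ≤ S.comap φ) {g : F[X]}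
    (hg : ∀ w ∈ S, aeval φ g w = 0) : aeval (φ.restrict hS) g = 0 := by
  ext w
  rw [LinearMap.zero_apply, Submodule.coe_zero, ← Submodule.subtype_apply,
    map_aeval_of_intertwines S.subtype (fun _ => rfl)]
  exact hg w w.2

lemma charpoly_of_intertwines {W : Type u} [AddCommGroup W] [Module F W] [FiniteDimensional F W]
    {φ : V →ₗ[F] V} {χ : W →ₗ[F] W} (E : V ≃ₗ[F] W) (hE : ∀ v, E (φ v) = χ (E v)) :
    χ.charpoly = φ.charpoly := by
  rw [← LinearEquiv.charpoly_conj E φ]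
  congr 1
  ext w
  rw [LinearEquiv.conj_apply_apply, hE, LinearEquiv.apply_symm_apply]

/-- A totally singular invariant subspace `S` can be split off: `Q` induces a non-singular form on
the quotient of its orthogonal complement by `S`, and the Gauss sum changes by the factor `|S|`. -/
lemma exists_reduction [Finite F] {ψ : AddChar F ℂ} (hψ : ψ ≠ 1) {Q : QuadraticForm F V}
    (hQ : LinearMap.Nondegenerate Q.polarBilin) {φ : V →ₗ[F] V} (hφ : ∀ v, Q (φ v) = Q v)
    {S : Submodule F V} (hS : S ≤ S.comap φ) (hQS : ∀ w ∈ S, Q w = 0) :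
    ∃ (W : Type u) (_ : AddCommGroup W) (_ : Module F W) (_ : FiniteDimensional F W)
      (R : QuadraticForm F W) (χ : W →ₗ[F] W),
      LinearMap.Nondegenerate R.polarBilin ∧ (∀ w, R (χ w) = R w) ∧
      Module.finrank F W + 2 * Module.finrank F S = Module.finrank F V ∧
      gaussSumOf ψ Q * sqrtCard W = gaussSumOf ψ R * sqrtCard V ∧
      φ.charpoly = (φ.restrict hS).charpoly * χ.charpoly *
        ((LinearMap.BilinForm.orthogonal Q.polarBilin S).mapQ _ φ
          (orthogonal_le_comap hQ hφ hS)).charpoly := by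
  classical
  have hP := orthogonal_le_comap hQ hφ hS
  have hdim := finrank_polarBilin_orthogonal hQ S
  have hPP : LinearMap.BilinForm.orthogonal Q.polarBilin
      (LinearMap.BilinForm.orthogonal Q.polarBilin S) = S :=
    LinearMap.BilinForm.orthogonal_orthogonal hQ
      (fun u v h => by
        rw [QuadraticMap.polarBilin_apply_apply] at h ⊢
        rwa [QuadraticMap.polar_comm]) S
  have hmem : ∀ v, v ∈ LinearMap.BilinForm.orthogonal Q.polarBilin S ↔
      ∀ w ∈ S, QuadraticMap.polar Q w v = 0 := fun _ => Iff.rfl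
  have hPP' : ∀ v, (∀ w ∈ LinearMap.BilinForm.orthogonal Q.polarBilin S,
      QuadraticMap.polar Q w v = 0) → v ∈ S := fun v hv => by
    rw [← hPP]
    exact hv
  set P := LinearMap.BilinForm.orthogonal Q.polarBilin S with hPdef
  have hSP : S ≤ P := fun v hv w hw => le_orthogonal_of_totallySingular hQS hv hw
  let S' : Submodule F P := S.comap P.subtype
  have hS' : S' ≤ S'.comap (φ.restrict hP) := fun x hx => hS hx
  have eS : S' ≃ₗ[F] S := Submodule.comapSubtypeEquivOfLe hSP
  obtain ⟨l, hl⟩ := LinearMap.exists_rightInverse_of_surjective S'.mkQ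
    (LinearMap.range_eq_top.2 (Submodule.mkQ_surjective _))
  have hl' : ∀ w, S'.mkQ (l w) = w := fun w => LinearMap.congr_fun hl w
  have hsub : ∀ x : P, l (S'.mkQ x) - x ∈ S' := fun x =>
    (Submodule.Quotient.eq S').1 (hl' _)
  have hQadd : ∀ x y : P, y ∈ S' → Q (x + y) = Q x := fun x y hy => by
    rw [QuadraticMap.map_add (⇑Q), QuadraticMap.polar_comm, (hmem x).1 x.2 y hy, hQS y hy, add_zero,
      add_zero]
  let R : QuadraticForm F (P ⧸ S') := (Q.comp P.subtype).comp l
  have hR : ∀ x : P, R (S'.mkQ x) = Q x := fun x => by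
    rw [← hQadd x _ (hsub x)]
    change Q (l (S'.mkQ x) : V) = Q (x + ((l (S'.mkQ x) : V) - x))
    rw [add_sub_cancel]
  have hRpolar : ∀ x y : P, QuadraticMap.polar R (S'.mkQ x) (S'.mkQ y) = QuadraticMap.polar Q x y :=
    fun x y => by
      rw [QuadraticMap.polar, QuadraticMap.polar, ← map_add, hR, hR, hR]
      rfl
  refine ⟨P ⧸ S', inferInstance, inferInstance, inferInstance, R, S'.mapQ S' (φ.restrict hP) hS',
    nondegenerate_polarBilin_iff.2 fun w hw => ?_, fun w => ?_, ?_, ?_, ?_⟩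
  · obtain ⟨x, rfl⟩ := Submodule.mkQ_surjective _ w
    rw [← LinearMap.mem_ker, Submodule.ker_mkQ]
    refine hPP' _ fun y hy => ?_
    rw [QuadraticMap.polar_comm]
    exact (hRpolar x ⟨y, hy⟩).symm.trans (hw _)
  · obtain ⟨x, rfl⟩ := Submodule.mkQ_surjective _ w
    rw [hR, Submodule.mkQ_apply, Submodule.mapQ_apply, ← Submodule.mkQ_apply, hR]
    exact hφ x
  · have h1 := Submodule.finrank_quotient_add_finrank S'
    rw [eS.finrank_eq] at h1
    omega
  · have : Finite V := Module.finite_of_finite F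
    have := Fintype.ofFinite V
    have := Fintype.ofFinite S'
    have := Fintype.ofFinite P
    have : Finite (P ⧸ S') := Module.finite_of_finite F
    have := Fintype.ofFinite (P ⧸ S')
    -- The Gauss sum is concentrated on the orthogonal complement, where `Q` is constant on the
    -- cosets of `S`.
    have h1 : gaussSumOf ψ Q = Nat.card S * gaussSumOf ψ R := by
      have hbij : Function.Bijective fun z : (P ⧸ S') × S' => l z.1 + z.2 := by
        have hmk : ∀ (w : P ⧸ S') (y : S'), S'.mkQ (l w + y) = w := fun w y => by
          rw [map_add, hl', (LinearMap.mem_ker.1 (by rw [Submodule.ker_mkQ]; exact y.2) :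
            S'.mkQ y = 0), add_zero]
        refine ⟨fun z z' h => ?_, fun x => ⟨(S'.mkQ x, -⟨_, hsub x⟩), ?_⟩⟩
        · have h2 : z.1 = z'.1 := by
            rw [← hmk z.1 z.2, ← hmk z'.1 z'.2]
            exact congrArg _ h
          refine Prod.ext h2 (Subtype.ext ?_)
          have h3 : l z.1 + (z.2 : P) = l z'.1 + z'.2 := h
          rw [h2] at h3
          exact add_left_cancel h3
        · simp
      rw [gaussSumOf_eq_sum, gaussSumOf_eq_sum, sum_apply_eq_sum_orthogonal hψ Q hQS hmem,
        ← Finset.sum_filter, Finset.sum_subtype (p := fun v => v ∈ P) _ (fun v => by simp)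
          (fun v => ψ (Q v)), ← hbij.sum_comp (fun x : P => ψ (Q x)), Fintype.sum_prod_type,
        Finset.mul_sum]
      refine Finset.sum_congr rfl fun w _ => ?_
      rw [Finset.sum_congr rfl (g := fun _ => ψ (R w)) fun y _ => ?_, Finset.sum_const,
        Finset.card_univ, nsmul_eq_mul, ← Nat.card_eq_fintype_card, Nat.card_congr eS.toEquiv]
      congr 1
      exact hQadd (l w) y y.2
    have h2 : sqrtCard V = Nat.card S * sqrtCard (P ⧸ S') := by
      have hfr : Module.finrank F V = 2 * Module.finrank F S + Module.finrank F (P ⧸ S') := by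
        have h1 := Submodule.finrank_quotient_add_finrank S'
        rw [eS.finrank_eq] at h1
        omega
      rw [sqrtCard, sqrtCard, Module.natCard_eq_pow_finrank (K := F) (V := V), hfr, pow_add,
        pow_mul', ← Module.natCard_eq_pow_finrank, ← Module.natCard_eq_pow_finrank, Nat.cast_mul,
        Nat.cast_pow, Real.sqrt_mul (by positivity), Real.sqrt_sq (by positivity)]
      push_cast
      rfl
    rw [h1, h2]
    ring
  · rw [charpoly_eq_mul P φ hP, charpoly_eq_mul S' (φ.restrict hP) hS',
      charpoly_of_intertwines (χ := φ.restrict hS) (Submodule.comapSubtypeEquivOfLe hSP)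
        (φ := (φ.restrict hP).restrict hS') fun _ => rfl]

end Reduction

end FormIsometry

namespace FormIsometry

universe u

/-! ### The sign of the Gauss sum of an isometry without eigenvalue `1` or `-1` -/

section Sign

variable {F : Type u} [Field F]

section Cyclic

variable {V : Type*} [AddCommGroup V] [Module F V]

lemma eq_zero_of_isCoprime {φ : V →ₗ[F] V} {g h : F[X]} (hgh : IsCoprime g h) {v : V}
    (hg : aeval φ g v = 0) (hh : aeval φ h v = 0) : v = 0 := by
  obtain ⟨a, b, hab⟩ := hgh
  have h1 : aeval φ (a * g + b * h) v = v := by rw [hab, map_one, Module.End.one_apply]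
  rw [← h1, map_add, map_mul, map_mul, LinearMap.add_apply, Module.End.mul_apply,
    Module.End.mul_apply, hg, hh, map_zero, map_zero, add_zero]

/-- A vector annihilated by an irreducible polynomial `f` generates a copy of `F[X] / (f)`. -/
lemma exists_cyclic {φ : V →ₗ[F] V} {f : F[X]} (hi : Irreducible f) {v : V} (hv : v ≠ 0)
    (hfv : aeval φ f v = 0) :
    ∃ θ : AdjoinRoot f →ₗ[F] V, Function.Injective θ ∧
      (∀ a, θ (AdjoinRoot.root f * a) = φ (θ a)) ∧ ∀ a, aeval φ f (θ a) = 0 := by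
  let N : F[X] →ₗ[F] V := (LinearMap.applyₗ v).comp (aeval φ).toLinearMap
  have hN : ∀ g, N g = aeval φ g v := fun _ => rfl
  let mk : F[X] →ₗ[F] AdjoinRoot f := (AdjoinRoot.mkₐ f).toLinearMap
  have hmk : ∀ g, mk g = AdjoinRoot.mk f g := fun _ => rfl
  obtain ⟨l, hl⟩ := LinearMap.exists_rightInverse_of_surjective mk
    (LinearMap.range_eq_top.2 AdjoinRoot.mk_surjective)
  have hθ : ∀ g, (N.comp l) (AdjoinRoot.mk f g) = N g := fun g => by
    have h1 : AdjoinRoot.mk f (l (AdjoinRoot.mk f g) - g) = 0 := by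
      rw [map_sub, ← hmk, ← hmk]
      exact sub_eq_zero.2 (LinearMap.congr_fun hl (mk g))
    obtain ⟨r, hr⟩ := AdjoinRoot.mk_eq_zero.1 h1
    rw [LinearMap.comp_apply, ← sub_eq_zero, ← map_sub, hr, hN, mul_comm, map_mul,
      Module.End.mul_apply, hfv, map_zero]
  refine ⟨N.comp l, (injective_iff_map_eq_zero _).2 fun a ha => ?_, fun a => ?_, fun a => ?_⟩
  · obtain ⟨g, rfl⟩ := AdjoinRoot.mk_surjective a
    rw [hθ, hN] at ha
    rw [AdjoinRoot.mk_eq_zero]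
    by_contra hd
    exact hv (eq_zero_of_isCoprime ((hi.coprime_iff_not_dvd).2 hd) hfv ha)
  · obtain ⟨g, rfl⟩ := AdjoinRoot.mk_surjective a
    rw [← AdjoinRoot.mk_X, ← map_mul, hθ, hθ, hN, hN, map_mul, Module.End.mul_apply, aeval_X]
  · obtain ⟨g, rfl⟩ := AdjoinRoot.mk_surjective a
    rw [hθ, hN, ← Module.End.mul_apply, ← map_mul, mul_comm, map_mul, Module.End.mul_apply, hfv,
      map_zero]

end Cyclic

lemma charpoly_rootMul {f : F[X]} (hf : f.Monic) (hi : Irreducible f) :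
    haveI := hf.finite_adjoinRoot
    (rootMul f).charpoly = f := by
  have := hf.finite_adjoinRoot
  refine charpoly_eq_of_aeval_eq_zero hf hi (LinearMap.ext fun a => ?_) (finrank_adjoinRoot f)
  have h := map_aeval_eq_mk_mul (φ := rootMul f) LinearMap.id (fun _ => rfl) f a
  rw [AdjoinRoot.mk_self, zero_mul] at h
  exact h

/-- On a field `F[X] / (f)` the polar form of an invariant quadratic form is zero or
non-degenerate, and in the latter case `f` is self-dual. -/
lemma polar_eq_zero_or_nondegenerate {f : F[X]} (hf : f.Monic) (hi : Irreducible f)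
    (h0 : f.coeff 0 ≠ 0) {Q : QuadraticForm F (AdjoinRoot f)}
    (hr : ∀ a, Q (AdjoinRoot.root f * a) = Q a) :
    (∀ a b, QuadraticMap.polar Q a b = 0) ∨
      (LinearMap.Nondegenerate Q.polarBilin ∧ dual f = f) := by
  have : Fact (Irreducible f) := ⟨hi⟩
  have := hf.finite_adjoinRoot
  refine or_iff_not_imp_left.2 fun hne => ?_
  have hp : ∀ a b, QuadraticMap.polar Q (AdjoinRoot.root f * a) (AdjoinRoot.root f * b) =
      QuadraticMap.polar Q a b := fun a b => polar_map_map (φ := rootMul f) hr a b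
  obtain ⟨u, hu⟩ := exists_root_mul_eq_one h0
  -- The radical of the polar form is an ideal of the field.
  have hrad : ∀ a, (∀ b, QuadraticMap.polar Q a b = 0) →
      ∀ r b, QuadraticMap.polar Q (r * a) b = 0 := fun a ha r => by
      obtain ⟨g, rfl⟩ := AdjoinRoot.mk_surjective r
      induction g using Polynomial.induction_on with
      | C c =>
        intro b
        have h : AdjoinRoot.mk f (C c) * a = c • a := by
          rw [Algebra.smul_def]; rfl
        rw [h, QuadraticMap.polar_smul_left, ha, smul_zero]
      | add g h hg hh =>
        intro b
        rw [map_add, add_mul, QuadraticMap.polar_add_left, hg, hh, add_zero]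
      | monomial n c h =>
        intro b
        have h1 : AdjoinRoot.mk f (C c * X ^ (n + 1)) * a =
            AdjoinRoot.root f * (AdjoinRoot.mk f (C c * X ^ n) * a) := by
          rw [pow_succ, ← mul_assoc, map_mul _ _ X, AdjoinRoot.mk_X]
          ring
        have h2 : b = AdjoinRoot.root f * (u * b) := by rw [← mul_assoc, hu, one_mul]
        rw [h1, h2, hp]
        exact h _
  have hnd : ∀ a, (∀ b, QuadraticMap.polar Q a b = 0) → a = 0 := fun a ha => by
    by_contra ha0
    refine hne fun x y => ?_
    rw [← div_mul_cancel₀ x ha0]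
    exact hrad a ha _ _
  refine ⟨nondegenerate_polarBilin_iff.2 hnd, ?_⟩
  have h1 : aeval (rootMul f) f = 0 := by
    rw [← LinearMap.aeval_self_charpoly (rootMul f), charpoly_rootMul hf hi]
  have h2 : AdjoinRoot.mk f f.reverse = 0 := by
    refine hnd _ fun b => ?_
    have h := form_aeval_pow (σ := RingHom.id F) (φ := rootMul f) (β := Q.polarBilin) (fun _ => rfl)
      hp f b 1
    rw [h1, LinearMap.zero_apply, map_zero, LinearMap.zero_apply, Polynomial.map_id] at h
    have h3 := map_aeval_eq_mk_mul (φ := rootMul f) LinearMap.id (fun _ => rfl) f.reverse 1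
    rw [LinearMap.id_apply, LinearMap.id_apply, mul_one] at h3
    rw [QuadraticMap.polar_comm, ← h3]
    exact h.symm
  refine eq_of_monic_of_dvd_of_natDegree_le hf (monic_dual h0) ?_ (natDegree_dual h0).le
  rw [dual]
  exact (AdjoinRoot.mk_eq_zero.1 h2).mul_left _

/-- The sign of the Gauss sum of a non-singular form preserved by `φ` is given by the number of
factors of the characteristic polynomial in `Phi3`, if `φ` has no eigenvalue `1` or `-1`: a
simple submodule is totally singular and is split off together with its dual, or it is an
orthogonal summand which is a field as in `gaussSumOf_adjoinRoot`. -/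
theorem gaussSumOf_eq_of_isCoprime_charpoly [Finite F] {ψ : AddChar F ℂ} (hψ : ψ ≠ 1) {V : Type u}
    [AddCommGroup V] [Module F V] [FiniteDimensional F V] {Q : QuadraticForm F V}
    (hQ : LinearMap.Nondegenerate Q.polarBilin) {φ : V →ₗ[F] V} (hφ : ∀ v, Q (φ v) = Q v)
    (hcop : IsCoprime φ.charpoly (X ^ 2 - 1)) :
    gaussSumOf ψ Q = (-1) ^ omega3 φ.charpoly * sqrtCard V := by
  classical
  obtain ⟨n, hn⟩ : ∃ n, Module.finrank F V = n := ⟨_, rfl⟩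
  induction n using Nat.strong_induction_on generalizing V with
  | _ n ih =>
  have : Finite V := Module.finite_of_finite F
  rcases Nat.eq_zero_or_pos n with rfl | hpos
  · have : Subsingleton V := Module.finrank_zero_iff.1 hn
    have := Fintype.ofFinite V
    have h1 : φ.charpoly = 1 :=
      (LinearMap.charpoly_monic φ).natDegree_eq_zero.1 ((LinearMap.charpoly_natDegree φ).trans hn)
    rw [h1, omega3_one, pow_zero, one_mul, gaussSumOf_eq_sum, sqrtCard, Nat.card_unique,
      Fintype.sum_subsingleton _ 0, QuadraticMap.map_zero, AddChar.map_zero_eq_one, Nat.cast_one,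
      Real.sqrt_one, Complex.ofReal_one]
  have : Nontrivial V := Module.nontrivial_of_finrank_pos (R := F) (by omega)
  have hinj := injective_of_isometry hQ hφ
  obtain ⟨f, hf, hi, hfm⟩ := exists_monic_irreducible_factor _ (minpoly.not_isUnit F φ)
  obtain ⟨v, hv, hfv⟩ : ∃ v, v ≠ 0 ∧ aeval φ f v = 0 := by
    by_contra! h
    obtain ⟨g, hg⟩ := hfm
    have hm0 : minpoly F φ ≠ 0 := minpoly.ne_zero (Algebra.IsIntegral.isIntegral φ)
    have h1 : aeval φ g = 0 := LinearMap.ext fun v => by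
      by_contra hne
      refine h _ hne ?_
      rw [← Module.End.mul_apply, ← map_mul, ← hg, minpoly.aeval, LinearMap.zero_apply]
    have h2 := minpoly.dvd F φ h1
    rw [hg] at h2 hm0
    have h3 : f ∣ 1 := by
      rw [← mul_dvd_mul_iff_right (right_ne_zero_of_mul hm0), one_mul]
      exact h2
    exact hi.not_isUnit (isUnit_of_dvd_one h3)
  have hfc : IsCoprime f (X ^ 2 - 1) :=
    hcop.of_isCoprime_of_dvd_left (hfm.trans (LinearMap.minpoly_dvd_charpoly φ))
  have h0 : f.coeff 0 ≠ 0 := fun h0 => hv <| hinj <| by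
    have hX : f = X := (eq_of_monic_of_associated monic_X hf
      (irreducible_X.associated_of_dvd hi (X_dvd_iff.2 h0))).symm
    rw [hX, aeval_X] at hfv
    rw [hfv, map_zero]
  obtain ⟨θ, hθi, hθ, hθf⟩ := exists_cyclic hi hv hfv
  have : Fact (Irreducible f) := ⟨hi⟩
  have := hf.finite_adjoinRoot
  have hr : ∀ a, (Q.comp θ) (AdjoinRoot.root f * a) = (Q.comp θ) a := fun a => by
    rw [QuadraticMap.comp_apply, hθ, hφ, QuadraticMap.comp_apply]
  have hpolar : ∀ a b, QuadraticMap.polar (Q.comp θ) a b = QuadraticMap.polar Q (θ a) (θ b) :=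
    fun a b => by
      simp only [QuadraticMap.polar, QuadraticMap.comp_apply, map_add]
  have hS : LinearMap.range θ ≤ (LinearMap.range θ).comap φ := by
    rintro _ ⟨a, rfl⟩
    exact ⟨_, hθ a⟩
  have hSdim : Module.finrank F (LinearMap.range θ) = f.natDegree := by
    rw [LinearMap.finrank_range_of_inj hθi, finrank_adjoinRoot]
  have hfpos := hi.natDegree_pos
  have hdim := finrank_polarBilin_orthogonal hQ (LinearMap.range θ)
  have hSf : ∀ w ∈ LinearMap.range θ, aeval φ f w = 0 := by
    rintro _ ⟨a, rfl⟩
    exact hθf a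
  rcases polar_eq_zero_or_nondegenerate hf hi h0 hr with hz | ⟨hnd, hd⟩
  · -- The polar form vanishes on the submodule, so that `Q` is additive there; being invariant
    -- under `φ`, it then vanishes on the image of `φ - 1`, which is the whole submodule.
    have hQθ : ∀ a, Q (θ a) = 0 := fun a => by
      have ht : AdjoinRoot.root f - 1 ≠ 0 := fun h => by
        have h1 : AdjoinRoot.mk f (X ^ 2 - 1) = 0 := by
          rw [map_sub, map_pow, AdjoinRoot.mk_X, map_one]
          linear_combination (AdjoinRoot.root f + 1) * h
        have h2 := hfc.isUnit_of_dvd' dvd_rfl (AdjoinRoot.mk_eq_zero.1 h1)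
        exact hi.not_isUnit h2
      have h1 := QuadraticMap.map_add (⇑(Q.comp θ)) ((AdjoinRoot.root f - 1) *
        ((AdjoinRoot.root f - 1)⁻¹ * a)) ((AdjoinRoot.root f - 1)⁻¹ * a)
      rw [hz, add_zero, ← add_one_mul, sub_add_cancel, hr, mul_inv_cancel_left₀ ht] at h1
      exact left_eq_add.1 (by rw [add_comm]; exact h1)
    have hQS : ∀ w ∈ LinearMap.range θ, Q w = 0 := by
      rintro _ ⟨a, rfl⟩
      exact hQθ a
    obtain ⟨W, _, _, _, R, χ, hR, hχ, hW, hG, hchar⟩ := exists_reduction hψ hQ hφ hS hQS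
    have hA := charpoly_eq_of_aeval_eq_zero hf hi (aeval_restrict_eq_zero hS hSf) hSdim
    have hB := charpoly_eq_of_aeval_eq_zero (monic_dual h0) (irreducible_dual h0 hf hi)
      (φ := (LinearMap.BilinForm.orthogonal Q.polarBilin (LinearMap.range θ)).mapQ _ φ
          (orthogonal_le_comap hQ hφ hS))
      (by rw [dual, map_mul, aeval_reverse_mapQ_orthogonal hφ _ hSf, mul_zero])
      (by
        have := Submodule.finrank_quotient_add_finrank
          (LinearMap.BilinForm.orthogonal Q.polarBilin (LinearMap.range θ))
        rw [natDegree_dual h0]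
        omega)
    rw [hA, hB] at hchar
    have hW0 : sqrtCard W ≠ 0 := by
      have : Finite W := Module.finite_of_finite F
      exact sqrtCard_ne_zero W
    have hχm := (LinearMap.charpoly_monic χ).ne_zero
    have hodual : omega3 (dual f) = omega3 f := by
      rw [omega3_of_irreducible hf hi,
        omega3_of_irreducible (monic_dual h0) (irreducible_dual h0 hf hi),
        if_congr (dual_mem_Phi3_iff hf h0) rfl rfl]
    have h1 := ih (Module.finrank F W) (by omega) hR hχ (hcop.of_isCoprime_of_dvd_left (by
      rw [hchar, mul_right_comm]
      exact dvd_mul_left _ _)) rfl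
    rw [hchar, omega3_mul (mul_ne_zero hf.ne_zero hχm) (monic_dual h0).ne_zero,
      omega3_mul hf.ne_zero hχm, hodual, add_right_comm, pow_add, ← two_mul, pow_mul, neg_one_sq,
      one_pow, one_mul]
    refine mul_right_cancel₀ hW0 ?_
    rw [hG, h1]
    ring
  · have hdeg : 1 < f.natDegree := by
      by_contra hle
      have hpm := eq_X_sub_one_or_eq_X_add_one hf h0 (by omega) hd
      have hdvd : f ∣ X ^ 2 - 1 := by
        rcases hpm with rfl | rfl
        · exact ⟨X + 1, by ring⟩
        · exact ⟨X - 1, by ring⟩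
      exact hi.not_isUnit (hfc.isUnit_of_dvd' dvd_rfl hdvd)
    -- The submodule is an orthogonal summand.
    have hK := gaussSumOf_adjoinRoot hψ hf hi h0 hd hdeg hnd hr
    have hP := orthogonal_le_comap hQ hφ hS
    have hmem : ∀ v, v ∈ LinearMap.BilinForm.orthogonal Q.polarBilin (LinearMap.range θ) ↔
      ∀ w ∈ LinearMap.range θ, QuadraticMap.polar Q w v = 0 := fun _ => Iff.rfl
    set P := LinearMap.BilinForm.orthogonal Q.polarBilin (LinearMap.range θ) with hPdef
    have hperp : ∀ a (x : P), QuadraticMap.polar Q (θ a) x = 0 := fun a x =>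
      (hmem x).1 x.2 _ ⟨a, rfl⟩
    have hQE : ∀ a (x : P), Q (θ a + x) = Q (θ a) + Q x := fun a x => by
      rw [QuadraticMap.map_add (⇑Q), hperp, add_zero]
    have hEi : Function.Injective (θ.coprod P.subtype) := by
      refine (injective_iff_map_eq_zero _).2 fun z hz => ?_
      rw [LinearMap.coprod_apply, Submodule.subtype_apply] at hz
      have h1 : z.1 = 0 := by
        refine nondegenerate_polarBilin_iff.1 hnd _ fun b => ?_
        rw [hpolar, eq_neg_of_add_eq_zero_left hz, QuadraticMap.polar_neg_left,
          QuadraticMap.polar_comm, hperp, neg_zero]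
      rw [h1, map_zero, zero_add] at hz
      exact Prod.ext h1 (Subtype.ext hz)
    let E : (AdjoinRoot f × P) ≃ₗ[F] V := LinearEquiv.ofInjectiveOfFinrankEq _ hEi (by
      rw [Module.finrank_prod, finrank_adjoinRoot]
      omega)
    have hE : ∀ z, E z = θ z.1 + z.2 := fun _ => rfl
    have hQP : LinearMap.Nondegenerate (QuadraticMap.polarBilin (Q.comp P.subtype)) := by
      refine nondegenerate_polarBilin_iff.2 fun x hx => Subtype.ext ?_
      refine nondegenerate_polarBilin_iff.1 hQ _ fun w => ?_
      obtain ⟨⟨a, y⟩, rfl⟩ := E.surjective w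
      rw [hE, QuadraticMap.polar_add_right, QuadraticMap.polar_comm, hperp, zero_add]
      have h := hx y
      simp only [QuadraticMap.polar, QuadraticMap.comp_apply, map_add] at h
      exact h
    have hQprod : ∀ z, ((Q.comp θ).prod (Q.comp P.subtype)) z = Q (E z) := fun z => by
      rw [QuadraticMap.prod_apply, hE, hQE]
      rfl
    have hchar : φ.charpoly = f * (φ.restrict hP).charpoly := by
      rw [charpoly_of_intertwines (χ := φ) (φ := (rootMul f).prodMap (φ.restrict hP)) E fun z => by
        rw [hE, hE, map_add, ← hθ]; rfl, LinearMap.charpoly_prodMap, charpoly_rootMul hf hi]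
    have h1 := ih (Module.finrank F P) (by omega) hQP (φ := φ.restrict hP) (fun x => hφ x)
      (hcop.of_isCoprime_of_dvd_left (by rw [hchar]; exact dvd_mul_left _ _)) rfl
    have : Finite (AdjoinRoot f) := Module.finite_of_finite F
    have h2 : gaussSumOf ψ Q = gaussSumOf ψ ((Q.comp θ).prod (Q.comp P.subtype)) := by
      rw [← gaussSumOf_comp_equiv ψ E.toEquiv Q]
      exact congrArg _ (funext fun z => (hQprod z).symm)
    have hfPhi : f ∈ Phi3 F := ⟨hf, hi, hd.symm, hdeg⟩
    rw [h2, gaussSumOf_prod, hK, h1, hchar,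
      omega3_mul hf.ne_zero (LinearMap.charpoly_monic _).ne_zero, omega3_of_irreducible hf hi,
      if_pos hfPhi, ← sqrtCard_congr E.toEquiv, sqrtCard_prod, pow_add,
      pow_one]
    ring

end Sign

end FormIsometry

namespace FormIsometry

universe u

/-! ### Splitting off the eigenvalues `1` and `-1` in odd characteristic -/

section Unipotent

variable {F : Type u} [Field F]

section Isotropic

variable {V : Type*} [AddCommGroup V] [Module F V]

/-- The kernel and the range of a power of `φ ^ 2 - 1` are orthogonal, because `φ ^ 2 - 1` is
adjoint to its negative up to a power of `φ`. -/
lemma polar_eq_zero_of_ker_range {Q : QuadraticForm F V} {φ : V →ₗ[F] V}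
    (hφ : ∀ v, Q (φ v) = Q v) (i : ℕ) {u : V}
    (hu : (aeval φ (X ^ 2 - 1 : F[X]) ^ i) u = 0) (w : V) :
    QuadraticMap.polar Q u ((aeval φ (X ^ 2 - 1 : F[X]) ^ i) w) = 0 := by
  set N := aeval φ (X ^ 2 - 1 : F[X]) with hN
  have hNv : ∀ v, φ (φ v) = N v + v := fun v => by
    rw [hN, map_sub, map_pow, aeval_X, map_one, LinearMap.sub_apply, Module.End.one_apply,
      sub_add_cancel, sq, Module.End.mul_apply]
  have hadj : ∀ u v, QuadraticMap.polar Q u (N v) = - QuadraticMap.polar Q (N u) (N v + v) :=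
    fun u v => by
      have h1 := (polar_map_map hφ (φ u) (φ v)).trans (polar_map_map hφ u v)
      rw [hNv, hNv, QuadraticMap.polar_add_left, QuadraticMap.polar_add_right Q u] at h1
      linear_combination h1
  induction i generalizing u w with
  | zero =>
    rw [pow_zero, Module.End.one_apply] at hu
    rw [hu, QuadraticMap.polar_zero_left]
  | succ i ih =>
    rw [pow_succ, Module.End.mul_apply] at hu
    rw [pow_succ', Module.End.mul_apply, hadj, ← Module.End.mul_apply, ← pow_succ', pow_succ,
      Module.End.mul_apply, ← map_add, ih _ hu, neg_zero]

/-- The sum of the subspaces `ker N ^ j ⊓ range N ^ j` for `N = φ ^ 2 - 1`. On a cyclic summand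
`F[X] / ((X ∓ 1) ^ (2 * k))` it is the image of `(X ∓ 1) ^ k`. -/
noncomputable def middle (φ : V →ₗ[F] V) : Submodule F V :=
  ⨆ j : ℕ, LinearMap.ker (aeval φ (X ^ 2 - 1 : F[X]) ^ j) ⊓
    LinearMap.range (aeval φ (X ^ 2 - 1 : F[X]) ^ j)

lemma middle_le_comap (φ : V →ₗ[F] V) : middle φ ≤ (middle φ).comap φ := by
  have hcomm : ∀ j v, (aeval φ (X ^ 2 - 1 : F[X]) ^ j) (φ v) =
      φ ((aeval φ (X ^ 2 - 1 : F[X]) ^ j) v) := fun j v => by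
    have h := map_aeval_of_intertwines (φ := φ) (ψ := φ) φ (fun _ => rfl) ((X ^ 2 - 1) ^ j) v
    rw [map_pow] at h
    exact h.symm
  refine iSup_le fun j v hv => ?_
  refine Submodule.mem_iSup_of_mem j ⟨?_, ?_⟩
  · rw [SetLike.mem_coe, LinearMap.mem_ker, hcomm, LinearMap.mem_ker.1 hv.1, map_zero]
  · obtain ⟨w, hw⟩ := hv.2
    exact ⟨φ w, by rw [hcomm, hw]⟩

lemma eq_zero_of_mem_middle (h2 : (2 : F) ≠ 0) {Q : QuadraticForm F V} {φ : V →ₗ[F] V}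
    (hφ : ∀ v, Q (φ v) = Q v) {v : V} (hv : v ∈ middle φ) : Q v = 0 := by
  have key : ∀ u ∈ middle φ, ∀ v ∈ middle φ, QuadraticMap.polar Q u v = 0 := by
    intro u hu v hv
    refine Submodule.iSup_induction _ (motive := fun u => QuadraticMap.polar Q u v = 0) hu
      (fun i u hu => ?_) (QuadraticMap.polar_zero_left Q v) fun a b ha hb => by
        rw [QuadraticMap.polar_add_left, ha, hb, add_zero]
    refine Submodule.iSup_induction _ (motive := fun v => QuadraticMap.polar Q u v = 0) hv
      (fun j v hv => ?_) (QuadraticMap.polar_zero_right Q u) fun a b ha hb => by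
        rw [QuadraticMap.polar_add_right, ha, hb, add_zero]
    rcases le_total i j with hij | hij
    · obtain ⟨w, rfl⟩ := hv.2
      rw [← Nat.add_sub_cancel' hij, pow_add, Module.End.mul_apply]
      exact polar_eq_zero_of_ker_range hφ i hu.1 _
    · obtain ⟨w, rfl⟩ := hu.2
      rw [QuadraticMap.polar_comm, ← Nat.add_sub_cancel' hij, pow_add, Module.End.mul_apply]
      exact polar_eq_zero_of_ker_range hφ j hv.1 _
  have h := key v hv v hv
  rw [QuadraticMap.polar_self, nsmul_eq_mul] at h
  exact (mul_eq_zero.1 h).resolve_left (by exact_mod_cast h2)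

lemma aeval_eq_zero_of_mem_middle [FiniteDimensional F V] {φ : V →ₗ[F] V} {v : V}
    (hv : v ∈ middle φ) :
    aeval φ ((X ^ 2 - 1 : F[X]) ^ Module.finrank F V) v = 0 := by
  rw [map_pow, ← LinearMap.mem_ker]
  refine (iSup_le fun j => ?_ : middle φ ≤ _) hv
  exact inf_le_left.trans (Module.End.ker_pow_le_ker_pow_finrank _ j)

end Isotropic

/-- On `F[X] / ((X - c) ^ (2 * k))` with `c = ± 1`, the image of `(X - c) ^ k` has half the
dimension. -/
lemma exists_half (h2 : (2 : F) ≠ 0) {c : F} (hc : c * c = 1) (k : ℕ) :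
    ∃ T : Submodule F (AdjoinRoot ((X - C c) ^ (2 * k))), 2 * k ≤ 2 * Module.finrank F T ∧
      ∀ a ∈ T, AdjoinRoot.mk _ (X ^ 2 - 1) ^ k * a = 0 ∧
        ∃ b, a = AdjoinRoot.mk _ (X ^ 2 - 1) ^ k * b := by
  have hm : (X - C c : F[X]).Monic := monic_X_sub_C c
  have := (hm.pow (2 * k)).finite_adjoinRoot
  have hcop : IsCoprime (X + C c) ((X - C c) ^ (2 * k)) := by
    have h1 : IsCoprime (X + C c) (X - C c) := by
      refine ⟨C ((2 * c)⁻¹), - C ((2 * c)⁻¹), ?_⟩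
      have hc0 : 2 * c ≠ 0 := mul_ne_zero h2 (by rintro rfl; simp at hc)
      have h3 : C ((2 * c)⁻¹) * C (2 * c) = (1 : F[X]) := by
        rw [← C_mul, inv_mul_cancel₀ hc0, C_1]
      rw [C_mul, show C (2 : F) = (2 : F[X]) from map_ofNat C 2] at h3
      linear_combination h3
    exact h1.pow_right
  obtain ⟨a, b, hab⟩ := hcop
  set p := (X - C c) ^ (2 * k) with hp
  have hfac : (X ^ 2 - 1 : F[X]) = (X - C c) * (X + C c) := by
    have h3 : C c * C c = (1 : F[X]) := by rw [← C_mul, hc, C_1]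
    linear_combination h3
  have hu : AdjoinRoot.mk p (X + C c) * AdjoinRoot.mk p a = 1 := by
    have h := congrArg (AdjoinRoot.mk p) hab
    rw [map_add, map_mul, map_mul _ b, AdjoinRoot.mk_self, mul_zero, add_zero, map_one] at h
    rw [mul_comm]
    exact h
  refine ⟨LinearMap.range (LinearMap.mulLeft F (AdjoinRoot.mk p ((X - C c) ^ k))), ?_, ?_⟩
  · have h1 := LinearMap.finrank_range_add_finrank_ker
      (LinearMap.mulLeft F (AdjoinRoot.mk p ((X - C c) ^ k)))
    have h3 : Module.finrank F (LinearMap.ker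
        (LinearMap.mulLeft F (AdjoinRoot.mk p ((X - C c) ^ k)))) = _ :=
      modNul_of_dvd (hm.pow _).ne_zero (pow_dvd_pow _ (by omega))
    have hpd : p.natDegree = 2 * k := by rw [hp, natDegree_pow, natDegree_X_sub_C, mul_one]
    rw [h3, finrank_adjoinRoot, hpd, natDegree_pow, natDegree_X_sub_C, mul_one] at h1
    omega
  · rintro _ ⟨x, rfl⟩
    rw [LinearMap.mulLeft_apply, hfac]
    constructor
    · rw [← mul_assoc, ← map_pow, ← map_mul, show ((X - C c) * (X + C c)) ^ k * (X - C c) ^ k =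
        p * (X + C c) ^ k by rw [hp, mul_pow, two_mul, pow_add]; ring, map_mul,
        AdjoinRoot.mk_self, zero_mul, zero_mul]
    · refine ⟨AdjoinRoot.mk p a ^ k * x, ?_⟩
      rw [map_mul, mul_pow, mul_assoc, ← mul_assoc (AdjoinRoot.mk p (X + C c) ^ k), ← mul_pow, hu,
        one_pow, one_mul, map_pow]

/-- If the exponents of all elementary divisors `(X ∓ 1) ^ e` are even, then `middle φ` is totally
singular of half the dimension of the generalized eigenspaces, and splitting it off removes the
factors `X - 1` and `X + 1` from the characteristic polynomial. -/
theorem gaussSumOf_eq_of_even_exponents [Finite F] {ψ : AddChar F ℂ} (hψ : ψ ≠ 1)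
    (h2 : (2 : F) ≠ 0) {V : Type u} [AddCommGroup V] [Module F V] [FiniteDimensional F V]
    {Q : QuadraticForm F V} (hQ : LinearMap.Nondegenerate Q.polarBilin) {φ : V →ₗ[F] V}
    (hφ : ∀ v, Q (φ v) = Q v) {s : Multiset F[X]} (hs : IsElementaryDivisors φ s)
    (heven : ∀ p ∈ s, IsCoprime p (X ^ 2 - 1) ∨
      ∃ (c : F) (k : ℕ), c * c = 1 ∧ p = (X - C c) ^ (2 * k)) :
    gaussSumOf ψ Q = (-1) ^ omega3 φ.charpoly * sqrtCard V := by
  classical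
  have hchars := hs.charpoly_eq
  obtain ⟨r, p, hp, rfl, E, hE⟩ := isElementaryDivisors_iff.1 hs
  have hS := middle_le_comap φ
  have hQS : ∀ w ∈ middle φ, Q w = 0 := fun w hw => eq_zero_of_mem_middle h2 hφ hw
  have hSM : ∀ w ∈ middle φ, aeval φ ((X ^ 2 - 1 : F[X]) ^ Module.finrank F V) w = 0 :=
    fun w hw => aeval_eq_zero_of_mem_middle hw
  set M := Module.finrank F V with hM
  -- The part of the characteristic polynomial with roots `± 1`, and the rest.
  let R₁ : F[X] := ∏ i, if IsCoprime (p i) (X ^ 2 - 1) then 1 else p i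
  let R₂ : F[X] := ∏ i, if IsCoprime (p i) (X ^ 2 - 1) then p i else 1
  have hR : φ.charpoly = R₁ * R₂ := by
    rw [hchars, ← Finset.prod_mul_distrib]
    change ∏ i, p i = _
    refine Finset.prod_congr rfl fun i _ => ?_
    split_ifs <;> simp
  have hR₁m : ∀ i, (if IsCoprime (p i) (X ^ 2 - 1) then 1 else p i).Monic := fun i => by
    split_ifs
    exacts [monic_one, (hp i).monic]
  have hR₂cop : IsCoprime R₂ (X ^ 2 - 1) := IsCoprime.prod_left fun i _ => by
    split_ifs with h
    exacts [h, isCoprime_one_left]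
  have hT : ∀ i, ∃ T : Submodule F (AdjoinRoot (p i)),
      (if IsCoprime (p i) (X ^ 2 - 1) then 1 else p i).natDegree ≤ 2 * Module.finrank F T ∧
      ∃ k : ℕ, ∀ a ∈ T, AdjoinRoot.mk (p i) (X ^ 2 - 1) ^ k * a = 0 ∧
        ∃ b : AdjoinRoot (p i), a = AdjoinRoot.mk (p i) (X ^ 2 - 1) ^ k * b := fun i => by
    by_cases h : IsCoprime (p i) (X ^ 2 - 1)
    · refine ⟨⊥, by simp [h], 0, fun a ha => ?_⟩
      rw [(Submodule.mem_bot F).1 ha]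
      exact ⟨mul_zero _, 0, (mul_zero _).symm⟩
    · obtain ⟨c, k, hc, hpi⟩ :=
        (heven (p i) (Multiset.mem_map_of_mem p (Finset.mem_univ i))).resolve_left h
      rw [if_neg h]
      generalize p i = P at hpi ⊢
      subst hpi
      obtain ⟨T, hT1, hT2⟩ := exists_half h2 hc k
      refine ⟨T, ?_, k, hT2⟩
      rw [natDegree_pow, natDegree_X_sub_C, mul_one]
      exact hT1
  choose T hTdim k hTk using hT
  have hSdim : R₁.natDegree ≤ 2 * Module.finrank F (middle φ) := by
    have hmem : ∀ t : ∀ i, T i, E.symm (fun i => (t i : AdjoinRoot (p i))) ∈ middle φ := fun t => by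
      have h1 : (fun i => (t i : AdjoinRoot (p i))) =
          ∑ i, Pi.single i (t i : AdjoinRoot (p i)) :=
        (Finset.univ_sum_single _).symm
      rw [h1, map_sum]
      refine Submodule.sum_mem _ fun i _ => Submodule.mem_iSup_of_mem (k i) ?_
      have hpow : ∀ (x : AdjoinRoot (p i)),
          (aeval φ (X ^ 2 - 1 : F[X]) ^ k i) (E.symm (Pi.single i x)) =
            E.symm (Pi.single i (AdjoinRoot.mk (p i) (X ^ 2 - 1) ^ k i * x)) := fun x => by
        rw [LinearEquiv.eq_symm_apply, ← map_pow, ← map_pow]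
        funext j
        have h2 := map_aeval_eq_mk_mul ((LinearMap.proj j).comp E.toLinearMap) (fun v => hE v j)
          ((X ^ 2 - 1) ^ k i) (E.symm (Pi.single i x))
        simp only [LinearMap.comp_apply, LinearEquiv.coe_coe, LinearEquiv.apply_symm_apply,
          LinearMap.proj_apply] at h2
        rw [h2]
        by_cases hj : j = i
        · subst hj
          rw [Pi.single_eq_same, Pi.single_eq_same]
        · rw [Pi.single_eq_of_ne hj, Pi.single_eq_of_ne hj, mul_zero]
      obtain ⟨h3, b, hb⟩ := hTk i (t i) (t i).2
      refine ⟨?_, E.symm (Pi.single i b), ?_⟩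
      · rw [SetLike.mem_coe, LinearMap.mem_ker, hpow, h3, Pi.single_zero, map_zero]
      · rw [hpow, ← hb]
    let j : (∀ i, T i) →ₗ[F] middle φ :=
      { toFun := fun t => ⟨_, hmem t⟩
        map_add' := fun a b => Subtype.ext (E.symm.map_add (fun i => (a i : AdjoinRoot (p i)))
          (fun i => (b i : AdjoinRoot (p i))))
        map_smul' := fun c a =>
          Subtype.ext (E.symm.map_smul c (fun i => (a i : AdjoinRoot (p i)))) }
    have hj : Function.Injective j := fun a b hab => by
      have h1 := E.symm.injective (congrArg Subtype.val hab)
      funext i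
      exact Subtype.ext (congrFun h1 i)
    have : ∀ i, Module.Finite F (AdjoinRoot (p i)) := fun i => (hp i).monic.finite_adjoinRoot
    have h1 := LinearMap.finrank_le_finrank_of_injective hj
    rw [Module.finrank_pi_fintype] at h1
    calc R₁.natDegree = ∑ i, (if IsCoprime (p i) (X ^ 2 - 1) then 1 else p i).natDegree :=
          natDegree_prod_of_monic _ _ fun i _ => hR₁m i
      _ ≤ ∑ i, 2 * Module.finrank F (T i) := Finset.sum_le_sum fun i _ => hTdim i
      _ ≤ 2 * Module.finrank F (middle φ) := by
          rw [← Finset.mul_sum]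
          omega
  obtain ⟨W, _, _, _, R, χ, hRn, hχ, hW, hG, hchar⟩ := exists_reduction hψ hQ hφ hS hQS
  have hA0 := aeval_restrict_eq_zero hS hSM
  have hB0 : aeval ((LinearMap.BilinForm.orthogonal Q.polarBilin (middle φ)).mapQ _ φ
      (orthogonal_le_comap hQ hφ hS)) ((X ^ 2 - 1 : F[X]) ^ M) = 0 := by
    have h1 : dual (X ^ 2 - 1 : F[X]) = X ^ 2 - 1 := by
      rw [show (X ^ 2 - 1 : F[X]) = (X - 1) * (X + 1) by ring, dual_mul, dual_X_sub_one,
        dual_X_add_one]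
    rw [← h1, ← dual_pow, dual, map_mul, aeval_reverse_mapQ_orthogonal hφ _ hSM, mul_zero]
  have hAm := LinearMap.charpoly_monic (φ.restrict hS)
  have hAdeg := LinearMap.charpoly_natDegree (φ.restrict hS)
  have hBm := LinearMap.charpoly_monic ((LinearMap.BilinForm.orthogonal Q.polarBilin
    (middle φ)).mapQ _ φ (orthogonal_le_comap hQ hφ hS))
  have hBdeg := LinearMap.charpoly_natDegree ((LinearMap.BilinForm.orthogonal Q.polarBilin
    (middle φ)).mapQ _ φ (orthogonal_le_comap hQ hφ hS))
  have hAo := omega3_charpoly_eq_zero hA0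
  have hBo := omega3_charpoly_eq_zero hB0
  have hAc := isCoprime_charpoly_of_aeval_eq_zero hA0 hR₂cop.symm.pow_left
  have hBc := isCoprime_charpoly_of_aeval_eq_zero hB0 hR₂cop.symm.pow_left
  set A := (φ.restrict hS).charpoly
  set B := ((LinearMap.BilinForm.orthogonal Q.polarBilin (middle φ)).mapQ _ φ
    (orthogonal_le_comap hQ hφ hS)).charpoly
  have hχm := LinearMap.charpoly_monic χ
  have hR₁ : R₁ = A * B := by
    refine eq_of_monic_of_dvd_of_natDegree_le (hAm.mul hBm)
      (monic_prod_of_monic _ _ fun i _ => hR₁m i) ((hAc.mul_left hBc).dvd_of_dvd_mul_right ?_) ?_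
    · rw [← hR, hchar, mul_right_comm]
      exact dvd_mul_right _ _
    · have h1 := Submodule.finrank_quotient_add_finrank
        (LinearMap.BilinForm.orthogonal Q.polarBilin (middle φ))
      have h3 := finrank_polarBilin_orthogonal hQ (middle φ)
      rw [hAm.natDegree_mul hBm, hAdeg, hBdeg]
      omega
  have hχR : χ.charpoly = R₂ := by
    refine mul_left_cancel₀ (hAm.mul hBm).ne_zero ?_
    rw [mul_right_comm, ← hchar, hR, hR₁]
  have h1 := gaussSumOf_eq_of_isCoprime_charpoly hψ hRn hχ (hχR ▸ hR₂cop)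
  have hW0 : sqrtCard W ≠ 0 := by
    have : Finite W := Module.finite_of_finite F
    exact sqrtCard_ne_zero W
  rw [hchar, omega3_mul (hAm.mul hχm).ne_zero hBm.ne_zero, omega3_mul hAm.ne_zero hχm.ne_zero, hAo,
    hBo, zero_add, add_zero]
  refine mul_right_cancel₀ hW0 ?_
  rw [hG, h1]
  ring

end Unipotent

end FormIsometry

namespace FormIsometry

universe u

/-! ### Types of invariant quadratic forms -/

section Types

variable {F : Type u} [Field F] {n : ℕ}

open Classical in
/-- The number of self-dual factors of degree greater than one of the characteristic polynomial,
counted with multiplicity, is `phi3Sum`. -/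
lemma omega3_charpoly_eq_phi3Sum (X : GL (Fin n) F) :
    omega3 (Matrix.vecMulLinear X.1).charpoly = phi3Sum X := by
  have hs := elementaryDivisors_spec (Matrix.vecMulLinear X.1)
  rw [hs.charpoly_eq, omega3_prod fun p hp => hs.isMonicPrimePow hp]
  change ((elemDiv X).map omega3).sum = _
  rw [Finset.sum_multiset_map_count, phi3Sum, ← finsum_mem_inter_support]
  have ho : ∀ f ∈ Phi3 F, ∀ e, omega3 (f ^ e) = e := fun f hf e => by
    rw [omega3_pow hf.1.ne_zero, omega3_of_irreducible hf.1 hf.2.1, if_pos hf, mul_one]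
  have hbij : Set.BijOn (fun p : F[X] × ℕ => p.1 ^ p.2)
      ({p : F[X] × ℕ | p.1 ∈ Phi3 F ∧ 1 ≤ p.2} ∩
        Function.support fun p => p.2 * mult X (p.1 ^ p.2))
      {g | g ∈ elemDiv X ∧ omega3 g ≠ 0} := by
    refine ⟨?_, ?_, ?_⟩
    · rintro ⟨f, e⟩ ⟨⟨hf, he⟩, hsupp⟩
      have h1 : mult X (f ^ e) ≠ 0 := right_ne_zero_of_mul hsupp
      refine ⟨Multiset.count_ne_zero.1 h1, ?_⟩
      change omega3 (f ^ e) ≠ 0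
      rw [ho f hf]
      exact left_ne_zero_of_mul hsupp
    · rintro ⟨f, a⟩ ⟨⟨hf, ha⟩, -⟩ ⟨g, b⟩ ⟨⟨hg, -⟩, -⟩ h
      obtain ⟨h1, h2⟩ := eq_of_pow_eq_pow hf.1 hf.2.1 hg.1 hg.2.1 (show 0 < a from ha) h
      exact Prod.ext h1 h2
    · rintro g ⟨hg, hg0⟩
      obtain ⟨f, e, hf, hi, he, rfl⟩ := hs.isMonicPrimePow hg
      have hfP : f ∈ Phi3 F := by
        by_contra h
        rw [omega3_pow hf.ne_zero, omega3_of_irreducible hf hi, if_neg h, mul_zero] at hg0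
        exact hg0 rfl
      exact ⟨(f, e), ⟨⟨hfP, he⟩, mul_ne_zero he.ne' (Multiset.count_ne_zero.2 hg)⟩, rfl⟩
  rw [finsum_mem_eq_of_bijOn (g := fun g => (elemDiv X).count g * omega3 g) _ hbij ?_,
    finsum_mem_eq_sum_of_inter_support_eq (t := (elemDiv X).toFinset)]
  · simp only [smul_eq_mul]
  · ext g
    simp only [Set.mem_inter_iff, Set.mem_ofPred_eq, Function.mem_support, SetLike.mem_coe,
      Multiset.mem_toFinset]
    exact ⟨fun h => ⟨h.1.1, h.2⟩, fun h => ⟨⟨h.1, right_ne_zero_of_mul h.2⟩, h.2⟩⟩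
  · rintro ⟨f, e⟩ ⟨⟨hf, -⟩, -⟩
    change e * mult X (f ^ e) = (elemDiv X).count (f ^ e) * omega3 (f ^ e)
    rw [ho f hf, mul_comm, mult]

/-- The type of a form is read off from the sign of its Gauss sum. -/
lemma type_iff_of_gaussSumOf [Finite F] {ψ : AddChar F ℂ} (hψ : ψ ≠ 1) (hn : Even n)
    {Q : QuadraticForm F (Fin n → F)} (hQ : NonSingular Q) {m : ℕ}
    (h : gaussSumOf ψ Q = (-1) ^ m * sqrtCard (Fin n → F)) :
    (PlusType Q ↔ Even m) ∧ (MinusType Q ↔ Odd m) := by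
  have h0 := sqrtCard_ne_zero (Fin n → F)
  have hne : sqrtCard (Fin n → F) ≠ - sqrtCard (Fin n → F) := fun h =>
    h0 (self_eq_neg.1 h)
  rcases gaussSumOf_type hψ hQ hn with ⟨h1, h2, h3⟩ | ⟨h1, h2, h3⟩ <;>
  rcases Nat.even_or_odd m with hm | hm <;>
  rw [hm.neg_one_pow, h3] at h
  · simp [h1, h2, hm]
  · rw [neg_one_mul] at h
    exact absurd h hne
  · rw [one_mul] at h
    exact absurd h.symm hne
  · simp [h1, h2, hm]

lemma eq_or_eq_of_dvd_X_sq_sub_one {f : F[X]} (hf : f.Monic) (hi : Irreducible f)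
    (h : f ∣ X ^ 2 - 1) : f = X - 1 ∨ f = X + 1 := by
  rw [show (X ^ 2 - 1 : F[X]) = (X - 1) * (X + 1) by ring] at h
  have key : ∀ g : F[X], g = X - 1 ∨ g = X + 1 → f ∣ g → f = g := fun g hg hd => by
    obtain ⟨-, -, -, -, hgm, hgi⟩ := eq_X_sub_C_of_eq hg
    exact eq_of_monic_of_associated hf hgm (hi.associated_of_dvd hgi hd)
  exact (hi.prime.dvd_or_dvd h).imp (key _ (Or.inl rfl)) (key _ (Or.inr rfl))

/-- In odd characteristic, the type of a preserved form is determined if there is no elementary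
divisor `(X - 1) ^ e` or `(X + 1) ^ e` with odd `e`. -/
lemma type_iff_of_odd [Finite F] (h2 : ¬ CharP F 2) (hn : Even n) {X : GL (Fin n) F}
    (hno : ¬ ∃ k : ℕ, (.X - 1) ^ (2 * k + 1) ∈ elemDiv X ∨ (.X + 1) ^ (2 * k + 1) ∈ elemDiv X)
    {Q : QuadraticForm F (Fin n → F)} (hns : NonSingular Q) (hQ : PreservesQuad X Q) :
    (PlusType Q ↔ Even (phi3Sum X)) ∧ (MinusType Q ↔ Odd (phi3Sum X)) := by
  obtain ⟨ψ, hψ⟩ := exists_addChar_ne_one (F := F)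
  have hs := elementaryDivisors_spec (Matrix.vecMulLinear X.1)
  refine type_iff_of_gaussSumOf hψ hn hns ?_
  rw [← omega3_charpoly_eq_phi3Sum]
  refine gaussSumOf_eq_of_even_exponents hψ (two_ne_zero_of_not_charP h2) hns hQ hs
    fun p hp => ?_
  obtain ⟨f, e, hf, hi, he, rfl⟩ := hs.isMonicPrimePow hp
  by_cases hd : f ∣ .X ^ 2 - 1
  · have hpm := eq_or_eq_of_dvd_X_sq_sub_one hf hi hd
    obtain ⟨c, hc, hfc, -⟩ := eq_X_sub_C_of_eq hpm
    rcases Nat.even_or_odd' e with ⟨k, rfl | rfl⟩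
    · exact Or.inr ⟨c, k, hc, by rw [hfc]⟩
    · refine absurd ⟨k, ?_⟩ hno
      rcases hpm with rfl | rfl
      exacts [Or.inl hp, Or.inr hp]
  · exact Or.inl ((hi.coprime_iff_not_dvd.2 hd).pow_left)

/-- In characteristic two, the type of a preserved form is determined if `X + 1` does not divide
the characteristic polynomial. -/
lemma type_iff_of_even [Finite F] [CharP F 2] (hn : Even n) {X : GL (Fin n) F}
    (hno : ¬ ∃ k : ℕ, 1 ≤ k ∧ (.X + 1) ^ k ∈ elemDiv X)
    {Q : QuadraticForm F (Fin n → F)} (hns : NonSingular Q) (hQ : PreservesQuad X Q) :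
    (PlusType Q ↔ Even (phi3Sum X)) ∧ (MinusType Q ↔ Odd (phi3Sum X)) := by
  obtain ⟨ψ, hψ⟩ := exists_addChar_ne_one (F := F)
  have hs := elementaryDivisors_spec (Matrix.vecMulLinear X.1)
  refine type_iff_of_gaussSumOf hψ hn hns ?_
  rw [← omega3_charpoly_eq_phi3Sum]
  have hcop : ∀ p ∈ elementaryDivisors (Matrix.vecMulLinear X.1),
      IsCoprime p (.X ^ 2 - 1 : F[X]) := fun p hp => by
    obtain ⟨f, e, hf, hi, he, rfl⟩ := hs.isMonicPrimePow hp
    refine (hi.coprime_iff_not_dvd.2 fun hd => hno ⟨e, he, ?_⟩).pow_left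
    have hfX : f = .X + 1 := (eq_or_eq_of_dvd_X_sq_sub_one hf hi hd).elim
      (fun h => h.trans X_add_one_eq_X_sub_one.symm) id
    rw [← hfX]
    exact hp
  exact gaussSumOf_eq_of_isCoprime_charpoly hψ hns (φ := Matrix.vecMulLinear X.1) hQ
    (hs.charpoly_eq ▸ isCoprime_multiset_prod hcop)

lemma conj_conj [Finite F] (q : ℕ) (hq : Nat.card F = q ^ 2) (x : F) :
    conj q hq (conj q hq x) = x := by
  have := Fintype.ofFinite F
  change (x ^ q) ^ q = x
  rw [← pow_mul, ← sq, ← hq, Nat.card_eq_fintype_card, FiniteField.pow_card]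

lemma exists_conj_ne [Finite F] (q : ℕ) (hq : Nat.card F = q ^ 2) : ∃ x, conj q hq x ≠ x := by
  have hcard : 1 < Nat.card F := Finite.one_lt_card
  have hq1 : 1 < q := by
    by_contra h
    have : q ≤ 1 := by omega
    have := Nat.pow_le_pow_left this 2
    omega
  by_contra! h
  have hroots : ∀ x : F, (X ^ q - X : F[X]).IsRoot x := fun x => by
    rw [IsRoot, eval_sub, eval_pow, eval_X, sub_eq_zero]
    exact h x
  have := Fintype.ofFinite F
  have h1 := card_le_degree_of_subset_roots (p := (X ^ q - X : F[X])) (Z := Finset.univ)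
    (fun x _ => (mem_roots (FiniteField.X_pow_card_sub_X_ne_zero F hq1)).2 (hroots x))
  rw [FiniteField.X_pow_card_sub_X_natDegree_eq F hq1, Finset.card_univ,
    ← Nat.card_eq_fintype_card, hq] at h1
  nlinarith

lemma charP_two_iff_even_card [Finite F] : CharP F 2 ↔ Even (Nat.card F) := by
  have := Fintype.ofFinite F
  rw [Nat.card_eq_fintype_card, Nat.even_iff, ← FiniteField.even_card_iff_char_two]
  exact ⟨fun _ => ringChar.eq F 2, fun h => h ▸ ringChar.charP F⟩

end Types

end FormIsometry

open FormIsometry in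
theorem mainTheorem1 {F : Type*} [Field F] [Finite F] {n : ℕ} (X : GL (Fin n) F) :
    -- hermitian forms
    (∀ (q : ℕ) (hq : Nat.card F = q ^ 2),
      (∃ β : (Fin n → F) →ₗ[F] (Fin n → F) →ₛₗ[conj q hq] F,
        LinearMap.Nondegenerate β ∧ IsHermitian β ∧ Preserves X β) ↔
      IsConj X (adj (conj q hq) X)⁻¹) ∧
    -- alternating forms
    ((∃ β : (Fin n → F) →ₗ[F] (Fin n → F) →ₗ[F] F,
        LinearMap.Nondegenerate β ∧ LinearMap.IsAlt β ∧ Preserves X β) ↔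
      IsConj X X⁻¹ ∧
        ∀ k : ℕ, Even (mult X ((.X - 1) ^ (2 * k + 1))) ∧
          Even (mult X ((.X + 1) ^ (2 * k + 1)))) ∧
    -- quadratic forms, odd characteristic
    (Odd (Nat.card F) →
      ((∃ Q : QuadraticForm F (Fin n → F), NonSingular Q ∧ PreservesQuad X Q) ↔
        IsConj X X⁻¹ ∧
          ∀ k : ℕ, 1 ≤ k → Even (mult X ((.X - 1) ^ (2 * k))) ∧
            Even (mult X ((.X + 1) ^ (2 * k)))) ∧
      ((∃ Q : QuadraticForm F (Fin n → F), NonSingular Q ∧ PreservesQuad X Q) → Even n →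
        (((∃ Q : QuadraticForm F (Fin n → F), NonSingular Q ∧ PreservesQuad X Q ∧ PlusType Q) ∧
            (∃ Q : QuadraticForm F (Fin n → F), NonSingular Q ∧ PreservesQuad X Q ∧ MinusType Q)) ↔
          ∃ k : ℕ, (.X - 1) ^ (2 * k + 1) ∈ elemDiv X ∨ (.X + 1) ^ (2 * k + 1) ∈ elemDiv X) ∧
        ((¬ ∃ k : ℕ, (.X - 1) ^ (2 * k + 1) ∈ elemDiv X ∨ (.X + 1) ^ (2 * k + 1) ∈ elemDiv X) →
          ∀ Q : QuadraticForm F (Fin n → F), NonSingular Q → PreservesQuad X Q →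
            (PlusType Q ↔ Even (phi3Sum X)) ∧ (MinusType Q ↔ Odd (phi3Sum X))))) ∧
    -- quadratic forms, characteristic two
    (Even (Nat.card F) →
      ((∃ Q : QuadraticForm F (Fin n → F), NonSingular Q ∧ PreservesQuad X Q) ↔
        IsConj X X⁻¹ ∧ ∀ k : ℕ, Even (mult X ((.X + 1) ^ (2 * k + 1)))) ∧
      ((∃ Q : QuadraticForm F (Fin n → F), NonSingular Q ∧ PreservesQuad X Q) →
        (((∃ Q : QuadraticForm F (Fin n → F), NonSingular Q ∧ PreservesQuad X Q ∧ PlusType Q) ∧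
            (∃ Q : QuadraticForm F (Fin n → F), NonSingular Q ∧ PreservesQuad X Q ∧ MinusType Q)) ↔
          ∃ k : ℕ, 1 ≤ k ∧ (.X + 1) ^ k ∈ elemDiv X) ∧
        ((¬ ∃ k : ℕ, 1 ≤ k ∧ (.X + 1) ^ k ∈ elemDiv X) →
          ∀ Q : QuadraticForm F (Fin n → F), NonSingular Q → PreservesQuad X Q →
            (PlusType Q ↔ Even (phi3Sum X)) ∧ (MinusType Q ↔ Odd (phi3Sum X))))) := by
  refine ⟨fun q hq => exists_hermitian_iff (conj_conj q hq) (exists_conj_ne q hq) X,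
    exists_alternating_iff X, fun hodd => ?_, fun heven => ?_⟩
  · have h2 : ¬ CharP F 2 := fun h =>
      Nat.not_even_iff_odd.2 hodd (charP_two_iff_even_card.1 h)
    have hdual : ∀ h : IsSelfDual (RingHom.id F) (Matrix.vecMulLinear X.1),
        IsDualInvariant (RingHom.id F) (elemDiv X) := fun h =>
      .of_isSelfDual (fun _ => rfl) (vecMulLinear_injective X) h (elementaryDivisors_spec _)
    refine ⟨⟨?_, ?_⟩, ?_⟩
    · rintro ⟨Q, hns, hQ⟩
      exact ⟨(isConj_inv_iff X).2 (isSelfDual_of_quadratic hns hQ), fun k hk =>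
        even_mult_of_quadratic_odd (two_ne_zero_of_not_charP h2) hns hQ hk⟩
    · rintro ⟨hconj, hk⟩
      exact exists_quadratic_of_realizes
        ((hdual ((isConj_inv_iff X).1 hconj)).quadraticRealizes_of_odd h2 hk)
    · rintro ⟨Q₀, hns₀, hQ₀⟩ hn
      refine ⟨⟨?_, ?_⟩, fun hno Q hns hQ => type_iff_of_odd h2 hn hno hns hQ⟩
      · rintro ⟨⟨Q, hns, hQ, hplus⟩, ⟨Q', hns', hQ', hminus⟩⟩
        by_contra hno
        have h3 := (type_iff_of_odd h2 hn hno hns hQ).1.1 hplus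
        have h4 := (type_iff_of_odd h2 hn hno hns' hQ').2.1 hminus
        exact Nat.not_even_iff_odd.2 h4 h3
      · rintro ⟨k, hk⟩
        have hd := hdual (isSelfDual_of_quadratic hns₀ hQ₀)
        have heven := fun k hk =>
          even_mult_of_quadratic_odd (k := k) (two_ne_zero_of_not_charP h2) hns₀ hQ₀ hk
        rcases hk with hk | hk
        · exact exists_both_types_of_odd h2 hn hd heven (Or.inl rfl) ⟨k, rfl⟩ hk
        · exact exists_both_types_of_odd h2 hn hd heven (Or.inr rfl) ⟨k, rfl⟩ hk
  · have : CharP F 2 := charP_two_iff_even_card.2 heven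
    have hdual : ∀ h : IsSelfDual (RingHom.id F) (Matrix.vecMulLinear X.1),
        IsDualInvariant (RingHom.id F) (elemDiv X) := fun h =>
      .of_isSelfDual (fun _ => rfl) (vecMulLinear_injective X) h (elementaryDivisors_spec _)
    refine ⟨⟨?_, ?_⟩, ?_⟩
    · rintro ⟨Q, hns, hQ⟩
      exact ⟨(isConj_inv_iff X).2 (isSelfDual_of_quadratic hns hQ),
        even_mult_of_quadratic_even hns hQ⟩
    · rintro ⟨hconj, hk⟩
      exact exists_quadratic_of_realizes
        ((hdual ((isConj_inv_iff X).1 hconj)).quadraticRealizes_of_even hk)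
    · rintro ⟨Q₀, hns₀, hQ₀⟩
      have hn := even_of_nonSingular_of_charTwo hns₀
      refine ⟨⟨?_, ?_⟩, fun hno Q hns hQ => type_iff_of_even hn hno hns hQ⟩
      · rintro ⟨⟨Q, hns, hQ, hplus⟩, ⟨Q', hns', hQ', hminus⟩⟩
        by_contra hno
        have h3 := (type_iff_of_even hn hno hns hQ).1.1 hplus
        have h4 := (type_iff_of_even hn hno hns' hQ').2.1 hminus
        exact Nat.not_even_iff_odd.2 h4 h3
      · rintro ⟨k, hk, hmem⟩
        exact exists_both_types_of_even hn (hdual (isSelfDual_of_quadratic hns₀ hQ₀))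
          (even_mult_of_quadratic_even hns₀ hQ₀) hk hmem
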